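/- Let $\gamma=\gamma(n)>0$ be polynomially bounded in $n$. For $n\ge 1$ and a unit vector $w\in\mathbb{R}^n$, let $D_{\mathbb{R}^n}$ be the Gaussian distribution on $\mathbb{R}^n$ with mean $0$ and covariance $\frac{1}{2\pi}I_n$, let $A_{w,0,\gamma}$ be the distribution of $(y,\ \gamma\langle y,w\rangle \bmod 1)\in\mathbb{R}^n\times[0,1)$ with $y\sim D_{\mathbb{R}^n}$ (noiseless CLWE samples), and let $U$ be the uniform distribution on $[0,1)=\mathbb{R}/\mathbb{Z}$. The average-case decision problem $\mathrm{CLWE}_{0,\gamma}$ is to distinguish, given the dimension $n$ and access to independent samples, between (1) samples from $A_{w,0,\gamma(n)}$, where $w$ is a uniformly random unit vector that is fixed for all samples, and (2) samples from $D_{\mathbb{R}^n}\times U$. Then there is a polynomial-time algorithm that solves $\mathrm{CLWE}_{0,\gamma}$. That is, there is a single algorithm $\mathcal{A}$ (a program for a random access machine over the integers with logarithmic, i.e. bit, cost, which reads the real coordinates of the samples binary digit by binary digit, a digit at place $k$ costing time at least $|k|$) such that, on input $n$ in unary, $\mathcal{A}$ halts within time polynomial in $n$ for all $n$ and all samples,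 and such that for some constant $c>0$ its advantage $$\Bigl|\Pr_{w,\ \text{samples}\sim A_{w,0,\gamma(n)}}[\mathcal{A}=\mathrm{YES}]-\Pr_{\text{samples}\sim D_{\mathbb{R}^n}\times U}[\mathcal{A}=\mathrm{YES}]\Bigr|$$ is $\Omega(n^{-c})$ as $n\to\infty$. -/

import Mathlib

open MeasureTheory ProbabilityTheory Asymptotics Filter

/-! ## The probability distributions -/

/-- The space `ℝⁿ × ℝ` in which samples live.  The second component of a sample, an element of
`𝕋 = ℝ / ℤ`, is given by its representative in `[0, 1)`. -/
abbrev CLWESample (n : ℕ) : Type := EuclideanSpace ℝ (Fin n) × ℝ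

/-- The Gaussian `D_{ℝ, r}` of width `r` on the line: mean `0` and variance `r² / (2π)`, that is,
density proportional to `exp (-π (x / r)²)`.  For `r = 0` it is the point mass at `0`. -/
noncomputable def gaussianWidth (r : ℝ) : Measure ℝ :=
  gaussianReal 0 (Real.toNNReal (r ^ 2 / (2 * Real.pi)))

/-- The Gaussian `D_{ℝⁿ}` of width `1`: independent coordinates, each of law `D_{ℝ, 1}`. -/
noncomputable def gaussianSpace (n : ℕ) : Measure (EuclideanSpace ℝ (Fin n)) :=
  (Measure.pi fun _ : Fin n => gaussianWidth 1).map (WithLp.toLp 2)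

/-- The uniform distribution on `[0, 1)`, which stands for the one on `𝕋`. -/
noncomputable def uniformTorus : Measure ℝ :=
  (volume : Measure ℝ).restrict (Set.Ico 0 1)

/-- The uniform probability distribution on the unit sphere of `ℝⁿ` (`n ≥ 1`). -/
noncomputable def uniformSphere (n : ℕ) :
    Measure (Metric.sphere (0 : EuclideanSpace ℝ (Fin n)) 1) :=
  ((volume : Measure (EuclideanSpace ℝ (Fin n))).toSphere Set.univ)⁻¹ •
    (volume : Measure (EuclideanSpace ℝ (Fin n))).toSphere

/-- The CLWE distribution `A_{w, β, γ}`: the law of `(y, (γ ⟨y, w⟩ + e) mod 1)` where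
`y ∼ D_{ℝⁿ}` and `e ∼ D_{ℝ, β}` are independent.  In the noiseless case `β = 0` one has `e = 0`. -/
noncomputable def clweDistribution {n : ℕ} (w : EuclideanSpace ℝ (Fin n)) (β γ : ℝ) :
    Measure (CLWESample n) :=
  ((gaussianSpace n).prod (gaussianWidth β)).map
    fun p => (p.1, Int.fract (γ * inner ℝ p.1 w + p.2))

/-- The null distribution `D_{ℝⁿ} × U`. -/
noncomputable def nullDistribution (n : ℕ) : Measure (CLWESample n) :=
  (gaussianSpace n).prod uniformTorus

/-! ## The machine model

A random access machine over the integers with logarithmic (bit) cost, programmed in a small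
structured language.  Its memory is an array of integers with indirect addressing.  The machine
does not compute with real numbers: it can only read single binary digits of the samples. -/

/-- The memory of the machine: the contents of the cell at every address. -/
abbrev Memory : Type := ℤ → ℤ

/-- Access to real data, digit by digit: `O i j k` is the binary digit at place `k` of coordinate
`j` of sample `i`. -/
abbrev DigitOracle : Type := ℕ → ℕ → ℤ → ℤ

/-- The arithmetic expressions. -/
inductive RamExpr : Type
  /-- an integer constant -/
  | const (c : ℤ) : RamExpr
  /-- the contents of the memory cell with address `a` -/
  | load (a : RamExpr) : RamExpr
  | add (a b : RamExpr) : RamExpr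
  | sub (a b : RamExpr) : RamExpr
  | mul (a b : RamExpr) : RamExpr
  /-- integer division, rounding down for positive `b`; division by `0` gives `0` -/
  | div (a b : RamExpr) : RamExpr
  /-- `1` if `a < b` and `0` otherwise -/
  | lt (a b : RamExpr) : RamExpr
  /-- the binary digit at place `k` of coordinate `j` of sample `i` -/
  | digit (i j k : RamExpr) : RamExpr

/-- The bit length of an integer, with one more bit for its sign. -/
def bitLength (x : ℤ) : ℕ := Nat.size x.natAbs + 1

/-- The value of an expression. -/
def RamExpr.eval (O : DigitOracle) (m : Memory) : RamExpr → ℤ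
  | .const c => c
  | .load a => m (a.eval O m)
  | .add a b => a.eval O m + b.eval O m
  | .sub a b => a.eval O m - b.eval O m
  | .mul a b => a.eval O m * b.eval O m
  | .div a b => a.eval O m / b.eval O m
  | .lt a b => if a.eval O m < b.eval O m then 1 else 0
  | .digit i j k => O (i.eval O m).toNat (j.eval O m).toNat (k.eval O m)

/-- The time for the evaluation of an expression: every operation costs the total bit length of
its operands, and of the cell contents for a memory access.  Reading the digit at place `k` costs,
in addition, `|k|` time units, as it does on a machine that has to scan the digits one by one. -/
def RamExpr.cost (O : DigitOracle) (m : Memory) : RamExpr → ℕ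
  | .const c => bitLength c
  | .load a => a.cost O m + bitLength (a.eval O m) + bitLength (m (a.eval O m))
  | .add a b => a.cost O m + b.cost O m + bitLength (a.eval O m) + bitLength (b.eval O m)
  | .sub a b => a.cost O m + b.cost O m + bitLength (a.eval O m) + bitLength (b.eval O m)
  | .mul a b => a.cost O m + b.cost O m + bitLength (a.eval O m) + bitLength (b.eval O m)
  | .div a b => a.cost O m + b.cost O m + bitLength (a.eval O m) + bitLength (b.eval O m)
  | .lt a b => a.cost O m + b.cost O m + bitLength (a.eval O m) + bitLength (b.eval O m)
  | .digit i j k => i.cost O m + j.cost O m + k.cost O m +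
      bitLength (i.eval O m) + bitLength (j.eval O m) + bitLength (k.eval O m) +
      (k.eval O m).natAbs

/-- The programs. -/
inductive RamProgram : Type
  | skip : RamProgram
  /-- store the value of `e` in the cell with address `a` -/
  | store (a e : RamExpr) : RamProgram
  | seq (p q : RamProgram) : RamProgram
  /-- execute `p` if `e` is not zero, and `q` otherwise -/
  | ite (e : RamExpr) (p q : RamProgram) : RamProgram
  /-- execute `p` as long as `e` is not zero -/
  | loop (e : RamExpr) (p : RamProgram) : RamProgram

/-- `RamRun O p m m' t`: the program `p`, started on memory `m` with access to `O`, halts after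
time exactly `t` and leaves memory `m'`. -/
inductive RamRun (O : DigitOracle) : RamProgram → Memory → Memory → ℕ → Prop
  | skip (m : Memory) : RamRun O .skip m m 1
  | store (a e : RamExpr) (m : Memory) :
      RamRun O (.store a e) m (Function.update m (a.eval O m) (e.eval O m))
        (a.cost O m + e.cost O m + bitLength (a.eval O m) + bitLength (e.eval O m) + 1)
  | seq {p q : RamProgram} {m m' m'' : Memory} {t t' : ℕ} :
      RamRun O p m m' t → RamRun O q m' m'' t' → RamRun O (.seq p q) m m'' (t + t' + 1)
  | ite_true {e : RamExpr} {p q : RamProgram} {m m' : Memory} {t : ℕ} :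
      e.eval O m ≠ 0 → RamRun O p m m' t → RamRun O (.ite e p q) m m' (e.cost O m + t + 1)
  | ite_false {e : RamExpr} {p q : RamProgram} {m m' : Memory} {t : ℕ} :
      e.eval O m = 0 → RamRun O q m m' t → RamRun O (.ite e p q) m m' (e.cost O m + t + 1)
  | loop_done {e : RamExpr} {p : RamProgram} {m : Memory} :
      e.eval O m = 0 → RamRun O (.loop e p) m m (e.cost O m + 1)
  | loop_step {e : RamExpr} {p : RamProgram} {m m' m'' : Memory} {t t' : ℕ} :
      e.eval O m ≠ 0 → RamRun O p m m' t → RamRun O (.loop e p) m' m'' t' →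
      RamRun O (.loop e p) m m'' (e.cost O m + t + t' + 1)

/-- The machine is deterministic: final memory and running time are determined by the input. -/
theorem RamRun.deterministic {O : DigitOracle} {p : RamProgram} {m m₁ : Memory} {t₁ : ℕ}
    (h₁ : RamRun O p m m₁ t₁) :
    ∀ {m₂ : Memory} {t₂ : ℕ}, RamRun O p m m₂ t₂ → m₁ = m₂ ∧ t₁ = t₂ := by
  induction h₁ with
  | skip m => intro m₂ t₂ h; cases h; exact ⟨rfl, rfl⟩
  | store a e m => intro m₂ t₂ h; cases h; exact ⟨rfl, rfl⟩
  | seq _ _ ih ih' =>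
    intro m₂ t₂ h
    cases h with
    | seq h h' =>
      obtain ⟨rfl, rfl⟩ := ih h
      obtain ⟨rfl, rfl⟩ := ih' h'
      exact ⟨rfl, rfl⟩
  | ite_true he _ ih =>
    intro m₂ t₂ h
    cases h with
    | ite_true _ h => obtain ⟨rfl, rfl⟩ := ih h; exact ⟨rfl, rfl⟩
    | ite_false he' _ => exact absurd he' he
  | ite_false he _ ih =>
    intro m₂ t₂ h
    cases h with
    | ite_true he' _ => exact absurd he he'
    | ite_false _ h => obtain ⟨rfl, rfl⟩ := ih h; exact ⟨rfl, rfl⟩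
  | loop_done he =>
    intro m₂ t₂ h
    cases h with
    | loop_done _ => exact ⟨rfl, rfl⟩
    | loop_step he' _ _ => exact absurd he he'
  | loop_step he _ _ ih ih' =>
    intro m₂ t₂ h
    cases h with
    | loop_done he' => exact absurd he' he
    | loop_step _ h h' =>
      obtain ⟨rfl, rfl⟩ := ih h
      obtain ⟨rfl, rfl⟩ := ih' h'
      exact ⟨rfl, rfl⟩

/-! ## Distinguishing algorithms -/

/-- The binary digit of `x` at place `k` after the binary point (places `k ≤ 0` lie before it), in
two's complement if `x` is negative: the parity of `⌊2 ^ k * x⌋`. -/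
noncomputable def binaryDigit (x : ℝ) (k : ℤ) : ℤ := ⌊(2 : ℝ) ^ k * x⌋ % 2

/-- The sampling oracle, for an infinite sequence `ω` of samples `(yᵢ, zᵢ)`.  The coordinates with
index less than `n` are those of `yᵢ`; every other index refers to `zᵢ`. -/
noncomputable def sampleOracle {n : ℕ} (ω : ℕ → CLWESample n) : DigitOracle :=
  fun i j k => if h : j < n then binaryDigit ((ω i).1 ⟨j, h⟩) k else binaryDigit (ω i).2 k

/-- The initial memory: cell `0` holds the dimension `n`, all other cells hold `0`. -/
def initialMemory (n : ℕ) : Memory := Function.update (fun _ => 0) 0 (n : ℤ)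

/-- The algorithm `A` halts on input `1ⁿ` with the samples `ω`, with answer `YES` (a `1` in
cell `0`). -/
def AnswersYes (A : RamProgram) {n : ℕ} (ω : ℕ → CLWESample n) : Prop :=
  ∃ m t, RamRun (sampleOracle ω) A (initialMemory n) m t ∧ m 0 = 1

/-- The algorithm `A` runs in polynomial time: for one polynomial `p`, it halts within time `p n`
on input `1ⁿ`, whatever the samples are. -/
def IsPolyTime (A : RamProgram) : Prop :=
  ∃ p : Polynomial ℕ, ∀ (n : ℕ) (ω : ℕ → CLWESample n),
    ∃ m t, RamRun (sampleOracle ω) A (initialMemory n) m t ∧ t ≤ p.eval n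

/-- The probability that `A` answers `YES` on independent samples from `A_{w, β, γ}`, where `w` is
a uniformly random unit vector, fixed for all samples. -/
noncomputable def probYesCLWE (A : RamProgram) (n : ℕ) (β γ : ℝ) : ℝ :=
  (∫⁻ w, Measure.infinitePi (fun _ : ℕ => clweDistribution (w : EuclideanSpace ℝ (Fin n)) β γ)
    {ω | AnswersYes A ω} ∂(uniformSphere n)).toReal

/-- The probability that `A` answers `YES` on independent samples from `D_{ℝⁿ} × U`. -/
noncomputable def probYesNull (A : RamProgram) (n : ℕ) : ℝ :=
  (Measure.infinitePi (fun _ : ℕ => nullDistribution n) {ω | AnswersYes A ω}).toReal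

/-- The advantage of `A` in the average-case decision problem `CLWE_{β, γ}` in dimension `n`. -/
noncomputable def clweAdvantage (A : RamProgram) (n : ℕ) (β γ : ℝ) : ℝ :=
  |probYesCLWE A n β γ - probYesNull A n|

/-- `A` solves the decision problem `CLWE_{β, γ}`, for `β = β(n)` and `γ = γ(n)`: its advantage is
non-negligible, that is, `Ω(n⁻ᶜ)` for a constant `c > 0`. -/
def SolvesCLWE (A : RamProgram) (β γ : ℕ → ℝ) : Prop :=
  ∃ c : ℝ, 0 < c ∧
    (fun n : ℕ => (n : ℝ) ^ (-c)) =O[atTop] fun n : ℕ => clweAdvantage A n (β n) (γ n)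

/-! ## A program logic for the machine with a syntactic time bound -/

/-! Noiseless samples satisfy linear equations modulo 1. If integers `a l` make `∑ a l • y l` tiny,
then for CLWE samples `∑ a l * z l` equals `γ ⟨∑ a l • y l, w⟩` up to an integer, so it lies close
to an integer, since `γ ≤ 2 ^ n` for large `n` (`accepts_of_clwe`). Under the null distribution the
`z l` are independent of the `y l`, from which `a` is computed, and for fixed `a ≠ 0` the
combination is uniform on the circle (`measurePreserving_sum_zsmul`, `measure_relationOf_near_le`).
Accepting within about `1 / 4` of an integer gives acceptance probability at least `7 / 8` against
at most `3 / 4`.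

The relation `a` comes from lattice reduction. The vectors `2 ^ (20 n) y` of `2 n` samples are
rounded to an integer matrix `Y`, and the rows of `(Y | 1)` are reduced. The first reduced row is
`(∑ a l Y l | a)`; if it is short, both `a` and the combination of the `y l` are small. Its Gram
determinant is `det (1 + Y Yᵀ) = det (1 + Yᵀ Y)`, where the second matrix has size only `n`, so it
is at most `2 ^ (44 n ^ 2)`. Its `2 n`-th root, with the loss from reduction, bounds the first row
by `2 ^ (13 n)`, far below the precision `2 ^ (20 n)` (`pivotProd_initRows_le`,
`pivot_reducedBasis_le`).

The reduction is a variant of LLL: size-reduce all rows, then swap one consecutive pair whose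
squared Gram–Schmidt norms drop by more than a factor 4. A swap at least halves the product of the
leading Gram determinants, which are positive integers (`pivotProd_swap_succ`, `isGapFree_lll`), so
a fixed number of rounds suffices. These determinants never exceed their initial bound and control
the norms of size-reduced rows, so the entries keep polynomially many bits (`reduceRows_spec`). All
Gram–Schmidt data are stored as integer minors, computed by fraction-free elimination
(`gramMinor_succ`).

For the running time, `WP` couples functional correctness with the invariant that every cell stays
below `2 ^ s` and every loop below `N` rounds; `RamProgram.timeBound` then reads off from the
program text a bound that is polynomial in `s` and `N`. -/

namespace RamExpr

/-- `|e| ≤ 2 ^ (s * size e)` if all memory cells are bounded by `2 ^ s`. -/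
def size : RamExpr → ℕ
  | .const c => bitLength c
  | .load _ => 1
  | .add a b => a.size + b.size
  | .sub a b => a.size + b.size
  | .mul a b => a.size + b.size
  | .div a b => a.size + b.size
  | .lt _ _ => 1
  | .digit _ _ _ => 1

/-- A bound for the cost of an expression if all memory cells are bounded by `2 ^ s` and all digits
read are at places of absolute value at most `N`. -/
def costBound (s N : ℕ) : RamExpr → ℕ
  | .const c => bitLength c
  | .load a => a.costBound s N + (s * a.size + 2) + (s + 2)
  | .add a b => a.costBound s N + b.costBound s N + (s * a.size + 2) + (s * b.size + 2)
  | .sub a b => a.costBound s N + b.costBound s N + (s * a.size + 2) + (s * b.size + 2)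
  | .mul a b => a.costBound s N + b.costBound s N + (s * a.size + 2) + (s * b.size + 2)
  | .div a b => a.costBound s N + b.costBound s N + (s * a.size + 2) + (s * b.size + 2)
  | .lt a b => a.costBound s N + b.costBound s N + (s * a.size + 2) + (s * b.size + 2)
  | .digit i j k => i.costBound s N + j.costBound s N + k.costBound s N +
      (s * i.size + 2) + (s * j.size + 2) + (s * k.size + 2) + N

/-- All digits read in the evaluation are at places of absolute value at most `N`. -/
def DigitsWithin (N : ℕ) (O : DigitOracle) (m : Memory) : RamExpr → Prop
  | .const _ => True
  | .load a => a.DigitsWithin N O m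
  | .add a b => a.DigitsWithin N O m ∧ b.DigitsWithin N O m
  | .sub a b => a.DigitsWithin N O m ∧ b.DigitsWithin N O m
  | .mul a b => a.DigitsWithin N O m ∧ b.DigitsWithin N O m
  | .div a b => a.DigitsWithin N O m ∧ b.DigitsWithin N O m
  | .lt a b => a.DigitsWithin N O m ∧ b.DigitsWithin N O m
  | .digit i j k => i.DigitsWithin N O m ∧ j.DigitsWithin N O m ∧ k.DigitsWithin N O m ∧
      (k.eval O m).natAbs ≤ N

end RamExpr

/-- The digits given by the oracle are `0` or `1`. -/
def DigitOracle.IsBinary (O : DigitOracle) : Prop := ∀ i j k, 0 ≤ O i j k ∧ O i j k ≤ 1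

/-- All memory cells are bounded by `2 ^ s`. -/
def Memory.BoundedBy (s : ℕ) (m : Memory) : Prop := ∀ a, |m a| ≤ 2 ^ s

/-! ### Sizes of values and costs of expressions -/

theorem one_le_bitLength (x : ℤ) : 1 ≤ bitLength x := by simp [bitLength]

theorem abs_lt_two_pow_bitLength (x : ℤ) : |x| < 2 ^ bitLength x := by
  have h := Nat.lt_size_self x.natAbs
  have h' : x.natAbs < 2 ^ (Nat.size x.natAbs + 1) :=
    h.trans_le (Nat.pow_le_pow_right (by norm_num) (Nat.le_succ _))
  rw [Int.abs_eq_natAbs, bitLength]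
  exact_mod_cast h'

theorem bitLength_le {x : ℤ} {k : ℕ} (h : |x| ≤ 2 ^ k) : bitLength x ≤ k + 2 := by
  rw [Int.abs_eq_natAbs] at h
  have h' : x.natAbs ≤ 2 ^ k := by exact_mod_cast h
  have : Nat.size x.natAbs ≤ k + 1 := by
    rw [Nat.size_le, pow_succ]
    have := Nat.one_le_two_pow (n := k)
    omega
  simpa [bitLength] using this

namespace RamExpr

theorem one_le_size (e : RamExpr) : 1 ≤ e.size := by
  induction e <;> simp only [size] <;> first | omega | exact one_le_bitLength _

/-- Every operation at most multiplies the bounds of its operands. For sums this uses that both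
bounds are at least 2, which is where `1 ≤ s` enters. -/
theorem abs_eval_le {s : ℕ} (hs : 1 ≤ s) {O : DigitOracle} (hO : O.IsBinary) {m : Memory}
    (hm : m.BoundedBy s) (e : RamExpr) : |e.eval O m| ≤ 2 ^ (s * e.size) := by
  have hadd : ∀ (x y : ℤ) (a b : ℕ), 1 ≤ a → 1 ≤ b → |x| ≤ 2 ^ (s * a) → |y| ≤ 2 ^ (s * b) →
      |x| + |y| ≤ 2 ^ (s * (a + b)) := by
    intro x y a b ha hb hx hy
    have h1 : (2 : ℤ) ^ (s * (a + b)) = 2 ^ (s * a) * 2 ^ (s * b) := by rw [mul_add, pow_add]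
    have h2 : (2 : ℤ) ≤ 2 ^ (s * a) := by
      calc (2 : ℤ) = 2 ^ 1 := by norm_num
        _ ≤ _ := pow_le_pow_right₀ (by norm_num) (Nat.mul_pos hs ha)
    have h3 : (2 : ℤ) ≤ 2 ^ (s * b) := by
      calc (2 : ℤ) = 2 ^ 1 := by norm_num
        _ ≤ _ := pow_le_pow_right₀ (by norm_num) (Nat.mul_pos hs hb)
    rw [h1]
    nlinarith
  induction e with
  | const c =>
    refine (abs_lt_two_pow_bitLength c).le.trans (pow_le_pow_right₀ (by norm_num) ?_)
    simp only [size]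
    nlinarith [one_le_bitLength c]
  | load a _ => simpa [eval, size] using hm _
  | add a b iha ihb =>
    exact (abs_add_le _ _).trans (hadd _ _ _ _ a.one_le_size b.one_le_size iha ihb)
  | sub a b iha ihb =>
    exact (abs_sub _ _).trans (hadd _ _ _ _ a.one_le_size b.one_le_size iha ihb)
  | mul a b iha ihb =>
    simp only [eval, size, abs_mul, mul_add, pow_add]
    exact mul_le_mul iha ihb (abs_nonneg _) (by positivity)
  | div a b iha ihb =>
    have h : |a.eval O m / b.eval O m| ≤ |a.eval O m| := Int.abs_ediv_le_abs _ _
    have := hadd _ _ _ _ a.one_le_size b.one_le_size iha ihb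
    simp only [eval, size]
    linarith [abs_nonneg (b.eval O m)]
  | lt a b _ _ =>
    simp only [eval, size]
    split_ifs <;> simp [one_le_pow₀]
  | digit i j k _ _ _ =>
    simp only [eval, size]
    rw [abs_of_nonneg (hO _ _ _).1]
    exact (hO _ _ _).2.trans (one_le_pow₀ (by norm_num))

theorem bitLength_eval_le {s : ℕ} (hs : 1 ≤ s) {O : DigitOracle} (hO : O.IsBinary) {m : Memory}
    (hm : m.BoundedBy s) (e : RamExpr) : bitLength (e.eval O m) ≤ s * e.size + 2 :=
  bitLength_le (e.abs_eval_le hs hO hm)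

theorem cost_le {s N : ℕ} (hs : 1 ≤ s) {O : DigitOracle} (hO : O.IsBinary) {m : Memory}
    (hm : m.BoundedBy s) (e : RamExpr) (he : e.DigitsWithin N O m) :
    e.cost O m ≤ e.costBound s N := by
  induction e with
  | const c => exact le_rfl
  | load a iha =>
    have := iha he
    have h1 := a.bitLength_eval_le hs hO hm
    have h2 := bitLength_le (hm (a.eval O m))
    simp only [cost, costBound]
    omega
  | add a b iha ihb | sub a b iha ihb | mul a b iha ihb | div a b iha ihb | lt a b iha ihb =>
    have := iha he.1
    have := ihb he.2
    have h1 := a.bitLength_eval_le hs hO hm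
    have h2 := b.bitLength_eval_le hs hO hm
    simp only [cost, costBound]
    omega
  | digit i j k ihi ihj ihk =>
    obtain ⟨hi, hj, hk, hk'⟩ := he
    have := ihi hi
    have := ihj hj
    have := ihk hk
    have h1 := i.bitLength_eval_le hs hO hm
    have h2 := j.bitLength_eval_le hs hO hm
    have h3 := k.bitLength_eval_le hs hO hm
    simp only [cost, costBound]
    omega

end RamExpr

/-- A bound for the running time of a program if all memory cells are bounded by `2 ^ s`, all digits
read are at places of absolute value at most `N`, and all loops have at most `N` iterations. -/
def RamProgram.timeBound (s N : ℕ) : RamProgram → ℕ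
  | .skip => 1
  | .store a e => a.costBound s N + e.costBound s N + (s * a.size + 2) + (s * e.size + 2) + 1
  | .seq p q => p.timeBound s N + q.timeBound s N + 1
  | .ite e p q => e.costBound s N + p.timeBound s N + q.timeBound s N + 1
  | .loop e p => (N + 1) * (e.costBound s N + p.timeBound s N + 1)

/-- The natural-valued functions bounded by a polynomial. -/
def PolyBounded (f : ℕ → ℕ) : Prop := ∃ p : Polynomial ℕ, ∀ n, f n ≤ p.eval n

namespace PolyBounded

theorem const (c : ℕ) : PolyBounded fun _ => c := ⟨Polynomial.C c, fun n => by simp⟩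

theorem add {f g : ℕ → ℕ} (hf : PolyBounded f) (hg : PolyBounded g) :
    PolyBounded fun n => f n + g n := by
  obtain ⟨p, hp⟩ := hf
  obtain ⟨q, hq⟩ := hg
  exact ⟨p + q, fun n => by rw [Polynomial.eval_add]; exact add_le_add (hp n) (hq n)⟩

theorem mul {f g : ℕ → ℕ} (hf : PolyBounded f) (hg : PolyBounded g) :
    PolyBounded fun n => f n * g n := by
  obtain ⟨p, hp⟩ := hf
  obtain ⟨q, hq⟩ := hg
  exact ⟨p * q, fun n => by rw [Polynomial.eval_mul]; exact Nat.mul_le_mul (hp n) (hq n)⟩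

end PolyBounded

theorem RamExpr.polyBounded_costBound {s N : ℕ → ℕ} (hs : PolyBounded s) (hN : PolyBounded N)
    (e : RamExpr) : PolyBounded fun n => e.costBound (s n) (N n) := by
  have h : ∀ a : RamExpr, PolyBounded fun n => s n * a.size + 2 := fun a =>
    (hs.mul (.const _)).add (.const _)
  induction e with
  | const c => exact .const _
  | load a iha => exact (iha.add (h a)).add (hs.add (.const _))
  | add a b iha ihb | sub a b iha ihb | mul a b iha ihb | div a b iha ihb | lt a b iha ihb =>
    exact ((iha.add ihb).add (h a)).add (h b)
  | digit i j k ihi ihj ihk =>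
    exact ((((((ihi.add ihj).add ihk).add (h i)).add (h j)).add (h k))).add hN

/-- The program is fixed, so its nesting depth is a constant and each loop contributes only one more
factor `N + 1`. -/
theorem RamProgram.polyBounded_timeBound {s N : ℕ → ℕ} (hs : PolyBounded s) (hN : PolyBounded N)
    (p : RamProgram) : PolyBounded fun n => p.timeBound (s n) (N n) := by
  have h : ∀ a : RamExpr, PolyBounded fun n => s n * a.size + 2 := fun a =>
    (hs.mul (.const _)).add (.const _)
  have hc := fun e : RamExpr => e.polyBounded_costBound hs hN
  induction p with
  | skip => exact .const _
  | store a e => exact ((((hc a).add (hc e)).add (h a)).add (h e)).add (.const _)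
  | seq p q ihp ihq => exact (ihp.add ihq).add (.const _)
  | ite e p q ihp ihq => exact (((hc e).add ihp).add ihq).add (.const _)
  | loop e p ihp => exact (hN.add (.const _)).mul (((hc e).add ihp).add (.const _))

/-! ### Proof rules -/

/-- The parameters of the program logic: an oracle with binary digits, a bound `2 ^ s` for the
memory cells, and a bound `N` for the numbers of loop iterations and the places of digits. -/
structure RamContext where
  oracle : DigitOracle
  s : ℕ
  N : ℕ
  one_le_s : 1 ≤ s
  N_le : (N : ℤ) ≤ 2 ^ s
  isBinary : oracle.IsBinary

/-- From the bounded memory `m`, the program `p` halts within its time bound, in a bounded memory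
that satisfies `Q`. -/
def WP (Γ : RamContext) (p : RamProgram) (Q : Memory → Prop) (m : Memory) : Prop :=
  m.BoundedBy Γ.s → ∃ m' t, RamRun Γ.oracle p m m' t ∧ t ≤ p.timeBound Γ.s Γ.N ∧
    m'.BoundedBy Γ.s ∧ Q m'

namespace WP

variable {Γ : RamContext}

theorem mono {p : RamProgram} {Q Q' : Memory → Prop} {m : Memory} (h : WP Γ p Q m)
    (hQ : ∀ m', Q m' → Q' m') : WP Γ p Q' m := by
  intro hm
  obtain ⟨m', t, h1, h2, h3, h4⟩ := h hm
  exact ⟨m', t, h1, h2, h3, hQ m' h4⟩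

theorem skip {Q : Memory → Prop} {m : Memory} (h : Q m) : WP Γ .skip Q m :=
  fun hm => ⟨m, 1, .skip m, le_rfl, hm, h⟩

/-- Only assignments can enlarge the memory contents, so this is the one rule with a size condition
on the computed value. -/
theorem store {a e : RamExpr} {Q : Memory → Prop} {m : Memory}
    (ha : a.DigitsWithin Γ.N Γ.oracle m) (he : e.DigitsWithin Γ.N Γ.oracle m)
    (hb : |e.eval Γ.oracle m| ≤ 2 ^ Γ.s)
    (h : Q (Function.update m (a.eval Γ.oracle m) (e.eval Γ.oracle m))) :
    WP Γ (.store a e) Q m := by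
  intro hm
  refine ⟨_, _, .store a e m, ?_, ?_, h⟩
  · have h1 := a.cost_le Γ.one_le_s Γ.isBinary hm ha
    have h2 := e.cost_le Γ.one_le_s Γ.isBinary hm he
    have h3 := a.bitLength_eval_le Γ.one_le_s Γ.isBinary hm
    have h4 := e.bitLength_eval_le Γ.one_le_s Γ.isBinary hm
    simp only [RamProgram.timeBound]
    omega
  · intro x
    rcases eq_or_ne x (a.eval Γ.oracle m) with rfl | hx
    · simpa using hb
    · simpa [hx] using hm x

theorem seq {p q : RamProgram} {Q : Memory → Prop} {m : Memory} (h : WP Γ p (WP Γ q Q) m) :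
    WP Γ (.seq p q) Q m := by
  intro hm
  obtain ⟨m', t, h1, h2, h3, h4⟩ := h hm
  obtain ⟨m'', t', h5, h6, h7, h8⟩ := h4 h3
  refine ⟨m'', _, .seq h1 h5, ?_, h7, h8⟩
  simp only [RamProgram.timeBound]
  omega

theorem ite {e : RamExpr} {p q : RamProgram} {Q : Memory → Prop} {m : Memory}
    (he : e.DigitsWithin Γ.N Γ.oracle m) (hp : e.eval Γ.oracle m ≠ 0 → WP Γ p Q m)
    (hq : e.eval Γ.oracle m = 0 → WP Γ q Q m) : WP Γ (.ite e p q) Q m := by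
  intro hm
  have hc := e.cost_le Γ.one_le_s Γ.isBinary hm he
  by_cases h0 : e.eval Γ.oracle m = 0
  · obtain ⟨m', t, h1, h2, h3, h4⟩ := hq h0 hm
    refine ⟨m', _, .ite_false h0 h1, ?_, h3, h4⟩
    simp only [RamProgram.timeBound]
    omega
  · obtain ⟨m', t, h1, h2, h3, h4⟩ := hp h0 hm
    refine ⟨m', _, .ite_true h0 h1, ?_, h3, h4⟩
    simp only [RamProgram.timeBound]
    omega

/-- The exact number of rounds is supplied beforehand, and the invariant is indexed by the rounds
already done; this gives termination and the factor `N + 1` of the time bound together. -/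
theorem loop {e : RamExpr} {p : RamProgram} {Q : Memory → Prop} {m : Memory} (cnt : ℕ)
    (hN : cnt ≤ Γ.N) (Inv : ℕ → Memory → Prop)
    (he : ∀ i m', Inv i m' → e.DigitsWithin Γ.N Γ.oracle m') (hinit : Inv 0 m)
    (hstep : ∀ i < cnt, ∀ m', Inv i m' → e.eval Γ.oracle m' ≠ 0 ∧ WP Γ p (Inv (i + 1)) m')
    (hfin : ∀ m', Inv cnt m' → e.eval Γ.oracle m' = 0 ∧ Q m') : WP Γ (.loop e p) Q m := by
  -- Induction on the number `r` of remaining rounds; the extra round in `r + 1` pays for the final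
  -- failing evaluation of the condition.
  have key : ∀ r i : ℕ, i + r = cnt → ∀ m : Memory, Inv i m → m.BoundedBy Γ.s →
      ∃ m' t, RamRun Γ.oracle (.loop e p) m m' t ∧
        t ≤ (r + 1) * (e.costBound Γ.s Γ.N + p.timeBound Γ.s Γ.N + 1) ∧
        m'.BoundedBy Γ.s ∧ Q m' := by
    intro r
    induction r with
    | zero =>
      intro i hi m hI hm
      obtain rfl : i = cnt := by omega
      obtain ⟨h0, hQ⟩ := hfin m hI
      have hc := e.cost_le Γ.one_le_s Γ.isBinary hm (he _ _ hI)
      exact ⟨m, _, .loop_done h0, by omega, hm, hQ⟩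
    | succ r ih =>
      intro i hi m hI hm
      obtain ⟨h0, hp⟩ := hstep i (by omega) m hI
      have hc := e.cost_le Γ.one_le_s Γ.isBinary hm (he _ _ hI)
      obtain ⟨m', t, h1, h2, h3, h4⟩ := hp hm
      obtain ⟨m'', t', h5, h6, h7, h8⟩ := ih (i + 1) (by omega) m' h4 h3
      refine ⟨m'', _, .loop_step h0 h1 h5, ?_, h7, h8⟩
      rw [add_mul (r + 1) 1]
      omega
  intro hm
  obtain ⟨m', t, h1, h2, h3, h4⟩ := key cnt 0 (by omega) m hinit hm
  refine ⟨m', t, h1, h2.trans ?_, h3, h4⟩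
  simp only [RamProgram.timeBound]
  exact Nat.mul_le_mul_right _ (by omega)

end WP

/-! ### Scalar variables and two-dimensional arrays -/

/-- The address of the scalar variable `k`. -/
def scalarAddr (k : ℕ) : ℤ := -(k : ℤ) - 1

/-- The address of the entry `(i, j)` of the array `c`, for `c = 0, 1, 2`. -/
def arrayAddr (c i j : ℕ) : ℤ := 3 * (((i : ℤ) + j) * ((i : ℤ) + j) + i) + c

/-- The value of the scalar variable `k`. -/
def Memory.scalar (m : Memory) (k : ℕ) : ℤ := m (scalarAddr k)

/-- The entry `(i, j)` of the array `c`. -/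
def Memory.array (m : Memory) (c i j : ℕ) : ℤ := m (arrayAddr c i j)

/-- The memory after an assignment to the scalar variable `k`. -/
def Memory.setScalar (m : Memory) (k : ℕ) (x : ℤ) : Memory := Function.update m (scalarAddr k) x

/-- The memory after an assignment to the entry `(i, j)` of the array `c`. -/
def Memory.setArray (m : Memory) (c i j : ℕ) (x : ℤ) : Memory :=
  Function.update m (arrayAddr c i j) x

theorem scalarAddr_injective : Function.Injective scalarAddr := fun a b h => by
  simp only [scalarAddr] at h; omega

theorem arrayAddr_nonneg (c i j : ℕ) : 0 ≤ arrayAddr c i j := by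
  unfold arrayAddr; positivity

theorem scalarAddr_neg (k : ℕ) : scalarAddr k < 0 := by simp only [scalarAddr]; omega

/-- The residue modulo 3 gives `c`. The rest is `u ^ 2 + i` with `u = i + j ≥ i`, which lies
strictly before `(u + 1) ^ 2`, so it determines `u` and then `i`. -/
theorem arrayAddr_eq_iff {c i j c' i' j' : ℕ} (hc : c < 3) (hc' : c' < 3) :
    arrayAddr c i j = arrayAddr c' i' j' ↔ c = c' ∧ i = i' ∧ j = j' := by
  refine ⟨fun h => ?_, by rintro ⟨rfl, rfl, rfl⟩; rfl⟩
  simp only [arrayAddr] at h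
  have h1 : c = c' := by omega
  have h2 : ((i : ℤ) + j) * ((i : ℤ) + j) + i = ((i' : ℤ) + j') * ((i' : ℤ) + j') + i' := by omega
  have h3 : i + j = i' + j' := by
    zify
    rcases lt_trichotomy ((i : ℤ) + j) (i' + j') with h | h | h
    · nlinarith
    · exact h
    · nlinarith
  have h4 : (i : ℤ) + j = i' + j' := by exact_mod_cast h3
  rw [h4] at h2
  omega

namespace Memory

@[simp] theorem scalar_setScalar (m : Memory) (k k' : ℕ) (x : ℤ) :
    (m.setScalar k x).scalar k' = if k' = k then x else m.scalar k' := by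
  simp [scalar, setScalar, Function.update_apply, scalarAddr_injective.eq_iff]

@[simp] theorem scalar_setArray (m : Memory) (c i j k : ℕ) (x : ℤ) :
    (m.setArray c i j x).scalar k = m.scalar k := by
  have : scalarAddr k ≠ arrayAddr c i j := by
    have := scalarAddr_neg k; have := arrayAddr_nonneg c i j; omega
  simp [scalar, setArray, this]

@[simp] theorem array_setScalar (m : Memory) (k : ℕ) (x : ℤ) :
    (m.setScalar k x).array = m.array := by
  ext c i j
  have : arrayAddr c i j ≠ scalarAddr k := by
    have := scalarAddr_neg k; have := arrayAddr_nonneg c i j; omega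
  simp [array, setScalar, this]

theorem array_setArray (m : Memory) {c i j c' i' j' : ℕ} (x : ℤ) (hc : c < 3) (hc' : c' < 3) :
    (m.setArray c i j x).array c' i' j' =
      if c' = c ∧ i' = i ∧ j' = j then x else m.array c' i' j' := by
  simp [array, setArray, Function.update_apply, arrayAddr_eq_iff hc' hc]

theorem array_setArray_self (m : Memory) {c : ℕ} (i j : ℕ) (x : ℤ) (hc : c < 3) (i' j' : ℕ) :
    (m.setArray c i j x).array c i' j' = if i' = i ∧ j' = j then x else m.array c i' j' := by
  simp [array_setArray m x hc hc]

theorem array_setArray_of_ne (m : Memory) {c c' : ℕ} (i j : ℕ) (x : ℤ) (hc : c < 3) (hc' : c' < 3)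
    (h : c' ≠ c) : (m.setArray c i j x).array c' = m.array c' := by
  ext i' j'
  simp [array_setArray m x hc hc', h]

/-- The first `c` scalar variables agree. -/
def Agree (c : ℕ) (m m' : Memory) : Prop := ∀ k < c, m'.scalar k = m.scalar k

theorem Agree.refl (c : ℕ) (m : Memory) : Agree c m m := fun _ _ => rfl

/-- Agreement serves as the frame condition: reading and setup preserve the variables below 6,
Gram–Schmidt those below 20, a reduction round those below 10 and the whole reduction those below 9.
Hence globals and the callers' loop counters survive. -/
theorem Agree.trans {c c' : ℕ} {m m' m'' : Memory} (h : Agree c m m') (h' : Agree c' m' m'')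
    (hc : c ≤ c') : Agree c m m'' := fun k hk => (h' k (by omega)).trans (h k hk)

theorem Agree.setScalar {c k : ℕ} {m m' : Memory} (h : Agree c m m') (hk : c ≤ k) (x : ℤ) :
    Agree c m (m'.setScalar k x) := fun l hl => by
  rw [scalar_setScalar, if_neg (by omega), h l hl]

theorem Agree.setArray {c : ℕ} {m m' : Memory} (h : Agree c m m') (a i j : ℕ) (x : ℤ) :
    Agree c m (m'.setArray a i j x) := fun l hl => by
  rw [scalar_setArray, h l hl]

end Memory

namespace RamExpr

/-- The scalar variable `k`. -/
def var (k : ℕ) : RamExpr := .load (.const (scalarAddr k))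

/-- The address of an array entry. -/
def cell (c : ℕ) (i j : RamExpr) : RamExpr :=
  .add (.mul (.const 3) (.add (.mul (.add i j) (.add i j)) i)) (.const c)

/-- An array entry. -/
def entry (c : ℕ) (i j : RamExpr) : RamExpr := .load (cell c i j)

variable {O : DigitOracle} {m : Memory}

@[simp] theorem eval_const (c : ℤ) : (const c).eval O m = c := rfl
@[simp] theorem eval_add (a b : RamExpr) : (add a b).eval O m = a.eval O m + b.eval O m := rfl
@[simp] theorem eval_sub (a b : RamExpr) : (sub a b).eval O m = a.eval O m - b.eval O m := rfl
@[simp] theorem eval_mul (a b : RamExpr) : (mul a b).eval O m = a.eval O m * b.eval O m := rfl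
@[simp] theorem eval_div (a b : RamExpr) : (div a b).eval O m = a.eval O m / b.eval O m := rfl
@[simp] theorem eval_lt (a b : RamExpr) :
    (lt a b).eval O m = if a.eval O m < b.eval O m then 1 else 0 := rfl
@[simp] theorem eval_digit (i j k : RamExpr) : (digit i j k).eval O m =
    O (i.eval O m).toNat (j.eval O m).toNat (k.eval O m) := rfl
@[simp] theorem eval_var (k : ℕ) : (var k).eval O m = m.scalar k := rfl

theorem eval_cell {c : ℕ} {i j : RamExpr} {i' j' : ℕ} (hi : i.eval O m = i')
    (hj : j.eval O m = j') : (cell c i j).eval O m = arrayAddr c i' j' := by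
  simp [cell, arrayAddr, hi, hj]

theorem eval_entry {c : ℕ} {i j : RamExpr} {i' j' : ℕ} (hi : i.eval O m = i')
    (hj : j.eval O m = j') : (entry c i j).eval O m = m.array c i' j' := by
  rw [entry, eval, eval_cell hi hj, Memory.array]

variable {N : ℕ}

@[simp] theorem digitsWithin_const (c : ℤ) : (const c).DigitsWithin N O m := trivial
@[simp] theorem digitsWithin_var (k : ℕ) : (var k).DigitsWithin N O m := trivial
@[simp] theorem digitsWithin_add (a b : RamExpr) : (add a b).DigitsWithin N O m ↔
    a.DigitsWithin N O m ∧ b.DigitsWithin N O m := Iff.rfl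
@[simp] theorem digitsWithin_sub (a b : RamExpr) : (sub a b).DigitsWithin N O m ↔
    a.DigitsWithin N O m ∧ b.DigitsWithin N O m := Iff.rfl
@[simp] theorem digitsWithin_mul (a b : RamExpr) : (mul a b).DigitsWithin N O m ↔
    a.DigitsWithin N O m ∧ b.DigitsWithin N O m := Iff.rfl
@[simp] theorem digitsWithin_div (a b : RamExpr) : (div a b).DigitsWithin N O m ↔
    a.DigitsWithin N O m ∧ b.DigitsWithin N O m := Iff.rfl
@[simp] theorem digitsWithin_lt (a b : RamExpr) : (lt a b).DigitsWithin N O m ↔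
    a.DigitsWithin N O m ∧ b.DigitsWithin N O m := Iff.rfl
@[simp] theorem digitsWithin_digit (i j k : RamExpr) : (digit i j k).DigitsWithin N O m ↔
    i.DigitsWithin N O m ∧ j.DigitsWithin N O m ∧ k.DigitsWithin N O m ∧
      (k.eval O m).natAbs ≤ N := Iff.rfl
@[simp] theorem digitsWithin_cell (c : ℕ) (i j : RamExpr) : (cell c i j).DigitsWithin N O m ↔
    i.DigitsWithin N O m ∧ j.DigitsWithin N O m := by simp [cell]; tauto
@[simp] theorem digitsWithin_entry (c : ℕ) (i j : RamExpr) : (entry c i j).DigitsWithin N O m ↔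
    i.DigitsWithin N O m ∧ j.DigitsWithin N O m := digitsWithin_cell c i j

end RamExpr

namespace RamProgram

/-- Assignment to a scalar variable. -/
def setVar (k : ℕ) (e : RamExpr) : RamProgram := .store (.const (scalarAddr k)) e

/-- Assignment to an array entry. -/
def setEntry (c : ℕ) (i j e : RamExpr) : RamProgram := .store (.cell c i j) e

/-- `for v = 0, …, e - 1 do p`. -/
def forLoop (v : ℕ) (e : RamExpr) (p : RamProgram) : RamProgram :=
  .seq (setVar v (.const 0))
    (.loop (.lt (.var v) e) (.seq p (setVar v (.add (.var v) (.const 1)))))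

end RamProgram

namespace WP

variable {Γ : RamContext}

theorem setVar {k : ℕ} {e : RamExpr} {Q : Memory → Prop} {m : Memory}
    (he : e.DigitsWithin Γ.N Γ.oracle m) (hb : |e.eval Γ.oracle m| ≤ 2 ^ Γ.s)
    (h : Q (m.setScalar k (e.eval Γ.oracle m))) :
    WP Γ (.setVar k e) Q m := store trivial he hb h

theorem setEntry {c : ℕ} {i j e : RamExpr} {Q : Memory → Prop} {m : Memory} {i' j' : ℕ}
    (hi : i.eval Γ.oracle m = i') (hj : j.eval Γ.oracle m = j')
    (hi' : i.DigitsWithin Γ.N Γ.oracle m) (hj' : j.DigitsWithin Γ.N Γ.oracle m)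
    (he : e.DigitsWithin Γ.N Γ.oracle m) (hb : |e.eval Γ.oracle m| ≤ 2 ^ Γ.s)
    (h : Q (m.setArray c i' j' (e.eval Γ.oracle m))) :
    WP Γ (.setEntry c i j e) Q m :=
  store (by simp [hi', hj']) he hb (by rwa [RamExpr.eval_cell hi hj, ← Memory.setArray])

/-- The bound `e` is evaluated anew in each round, so the invariant must fix its value. The counter
fits into a cell because it never exceeds `N ≤ 2 ^ s`. -/
theorem forLoop {v : ℕ} {e : RamExpr} {p : RamProgram} {Q : Memory → Prop} {m : Memory} (cnt : ℕ)
    (hN : cnt ≤ Γ.N) (Inv : ℕ → Memory → Prop)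
    (he : ∀ i m', Inv i m' → e.DigitsWithin Γ.N Γ.oracle m' ∧ e.eval Γ.oracle m' = cnt)
    (hinit : Inv 0 (m.setScalar v 0))
    (hstep : ∀ i < cnt, ∀ m' : Memory, m'.scalar v = i → Inv i m' → WP Γ p
      (fun m'' : Memory => m''.scalar v = i ∧ Inv (i + 1) (m''.setScalar v (i + 1))) m')
    (hfin : ∀ m', Inv cnt m' → Q m') : WP Γ (.forLoop v e p) Q m := by
  refine seq (setVar trivial (by simp) ?_)
  refine loop cnt hN (fun i (m' : Memory) => m'.scalar v = i ∧ Inv i m') ?_ ?_ ?_ ?_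
  · rintro i m' ⟨-, h⟩
    simpa using (he i m' h).1
  · simpa using hinit
  · rintro i hi m' ⟨hv, hI⟩
    refine ⟨by simp [hv, (he i m' hI).2, hi], seq ((hstep i hi m' hv hI).mono ?_)⟩
    rintro m'' ⟨hv', hI'⟩
    refine setVar (by simp) ?_ ?_
    · have h1 : ((i + 1 : ℕ) : ℤ) ≤ Γ.N := by exact_mod_cast (by omega : i + 1 ≤ Γ.N)
      have h2 := Γ.N_le
      simp only [RamExpr.eval_add, RamExpr.eval_var, RamExpr.eval_const, hv']
      push_cast at h1
      rw [abs_of_nonneg (by positivity)]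
      exact h1.trans h2
    · simpa [hv'] using hI'
  · rintro m' ⟨hv, hI⟩
    exact ⟨by simp [hv, (he _ m' hI).2], hfin m' hI⟩

/-- Two nested loops, where the inner one may depend on the variable of the outer one. -/
theorem forLoop₂ {v w : ℕ} (hvw : v ≠ w) {e₁ e₂ : RamExpr} {p : RamProgram} {Q : Memory → Prop}
    {m : Memory} (cnt₁ : ℕ) (cnt₂ : ℕ → ℕ) (Inv : ℕ → ℕ → Memory → Prop) (hN₁ : cnt₁ ≤ Γ.N)
    (hN₂ : ∀ i < cnt₁, cnt₂ i ≤ Γ.N)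
    (hv : ∀ i j m' x, Inv i j m' → Inv i j (m'.setScalar v x))
    (hw : ∀ i j m' x, Inv i j m' → Inv i j (m'.setScalar w x))
    (he₁ : ∀ i j m', Inv i j m' → e₁.DigitsWithin Γ.N Γ.oracle m' ∧ e₁.eval Γ.oracle m' = cnt₁)
    (he₂ : ∀ i < cnt₁, ∀ j (m' : Memory), m'.scalar v = i → Inv i j m' →
      e₂.DigitsWithin Γ.N Γ.oracle m' ∧ e₂.eval Γ.oracle m' = cnt₂ i)
    (hinit : Inv 0 0 m) (hrow : ∀ i < cnt₁, ∀ m', Inv i (cnt₂ i) m' → Inv (i + 1) 0 m')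
    (hstep : ∀ i < cnt₁, ∀ j < cnt₂ i, ∀ m' : Memory, m'.scalar v = i → m'.scalar w = j →
      Inv i j m' → WP Γ p (fun m'' : Memory => m''.scalar v = i ∧ m''.scalar w = j ∧
        Inv i (j + 1) m'') m')
    (hfin : ∀ m', Inv cnt₁ 0 m' → Q m') :
    WP Γ (.forLoop v e₁ (.forLoop w e₂ p)) Q m := by
  refine forLoop cnt₁ hN₁ (fun i => Inv i 0) (fun i => he₁ i 0) (hv _ _ _ _ hinit) ?_ hfin
  intro i hi m' hvi hI
  refine forLoop (cnt₂ i) (hN₂ i hi) (fun j m' => m'.scalar v = i ∧ Inv i j m')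
    (fun j m' h => he₂ i hi j m' h.1 h.2) ⟨by simp [hvw, hvi], hw _ _ _ _ hI⟩ ?_ ?_
  · rintro j hj m' hwj ⟨hvi, hI⟩
    refine (hstep i hi j hj m' hvi hwj hI).mono ?_
    rintro m'' ⟨h1, h2, h3⟩
    exact ⟨h2, by simp [hvw, h1], hw _ _ _ _ h3⟩
  · rintro m'' ⟨h1, h2⟩
    exact ⟨h1, hv _ _ _ _ (hrow i hi m'' h2)⟩

end WP

/-! ## Gram–Schmidt orthogonalization by successive elimination -/

section GramSchmidt

variable {E : Type*} [NormedAddCommGroup E] [InnerProductSpace ℝ E]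

/-- The component of `b i` orthogonal to `b 0, …, b (k - 1)`. -/
noncomputable def projPerp (b : ℕ → E) : ℕ → ℕ → E
  | 0, i => b i
  | k + 1, i => projPerp b k i -
      (inner ℝ (projPerp b k i) (projPerp b k k) / inner ℝ (projPerp b k k) (projPerp b k k)) •
        projPerp b k k

/-- The inner products of the projected vectors. -/
noncomputable def projInner (b : ℕ → E) (k i j : ℕ) : ℝ :=
  inner ℝ (projPerp b k i) (projPerp b k j)

/-- The squared norm of the `k`-th Gram–Schmidt vector. -/
noncomputable def pivot (b : ℕ → E) (k : ℕ) : ℝ := projInner b k k k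

/-- The product of the first `k` pivots, which is the Gram determinant of the first `k` vectors. -/
noncomputable def pivotProd (b : ℕ → E) (k : ℕ) : ℝ := ∏ l ∈ Finset.range k, pivot b l

variable (b : ℕ → E)

theorem projInner_comm (k i j : ℕ) : projInner b k i j = projInner b k j i :=
  real_inner_comm _ _

theorem projInner_self (k i : ℕ) : projInner b k i i = ‖projPerp b k i‖ ^ 2 :=
  real_inner_self_eq_norm_sq _

theorem projInner_self_nonneg (k i : ℕ) : 0 ≤ projInner b k i i := by
  rw [projInner_self]; positivity

theorem projInner_zero (i j : ℕ) : projInner b 0 i j = inner ℝ (b i) (b j) := rfl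

/-- One step of symmetric Gaussian elimination on the Gram matrix. -/
theorem projInner_succ (k i j : ℕ) : projInner b (k + 1) i j =
    projInner b k i j - projInner b k i k * projInner b k j k / pivot b k := by
  simp only [projInner, pivot, projPerp, inner_sub_left, inner_sub_right, real_inner_smul_left,
    real_inner_smul_right]
  rw [real_inner_comm (projPerp b k j) (projPerp b k k)]
  -- For a zero pivot the projected vector itself vanishes, and division by zero gives 0 on both
  -- sides.
  by_cases h : inner ℝ (projPerp b k k) (projPerp b k k) = 0
  · rw [inner_self_eq_zero] at h
    simp [h]
  · field_simp
    ring

theorem projPerp_eq_zero {k j : ℕ} (h : j < k) : projPerp b k j = 0 := by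
  induction k with
  | zero => omega
  | succ k ih =>
    rcases Nat.lt_succ_iff_lt_or_eq.mp h with h | rfl
    · simp [projPerp, ih h]
    · by_cases h0 : projPerp b j j = 0
      · simp [projPerp, h0]
      · rw [projPerp, div_self (inner_self_ne_zero (𝕜 := ℝ).mpr h0), one_smul, sub_self]

/-- Pythagoras, with the identity for one elimination step summed up. -/
theorem projInner_self_eq_sum (k i : ℕ) : projInner b 0 i i =
    projInner b k i i + ∑ l ∈ Finset.range k, projInner b l i l ^ 2 / pivot b l := by
  induction k with
  | zero => simp
  | succ k ih =>
    rw [Finset.sum_range_succ, projInner_succ, ih]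
    ring

theorem projInner_self_le (k i : ℕ) : projInner b k i i ≤ ‖b i‖ ^ 2 := by
  rw [← real_inner_self_eq_norm_sq, ← projInner_zero, projInner_self_eq_sum b k i]
  have : 0 ≤ ∑ l ∈ Finset.range k, projInner b l i l ^ 2 / pivot b l :=
    Finset.sum_nonneg fun l _ => div_nonneg (sq_nonneg _) (projInner_self_nonneg b l l)
  linarith

theorem norm_projPerp_le (k i : ℕ) : ‖projPerp b k i‖ ≤ ‖b i‖ := by
  have := projInner_self_le b k i
  rw [projInner_self] at this
  exact (sq_le_sq₀ (norm_nonneg _) (norm_nonneg _)).mp this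

theorem abs_projInner_le (k i j : ℕ) : |projInner b k i j| ≤ ‖b i‖ * ‖b j‖ :=
  (abs_real_inner_le_norm _ _).trans
    (mul_le_mul (norm_projPerp_le b k i) (norm_projPerp_le b k j) (norm_nonneg _) (norm_nonneg _))

theorem pivot_nonneg (k : ℕ) : 0 ≤ pivot b k := projInner_self_nonneg b k k

theorem pivot_le (k : ℕ) : pivot b k ≤ ‖b k‖ ^ 2 := projInner_self_le b k k

theorem pivotProd_succ (k : ℕ) : pivotProd b (k + 1) = pivotProd b k * pivot b k :=
  Finset.prod_range_succ _ _

theorem pivotProd_pos {k : ℕ} (h : ∀ l < k, 0 < pivot b l) : 0 < pivotProd b k :=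
  Finset.prod_pos fun l hl => h l (Finset.mem_range.mp hl)

theorem pivotProd_le_prod (k : ℕ) : pivotProd b k ≤ ∏ l ∈ Finset.range k, ‖b l‖ ^ 2 :=
  Finset.prod_le_prod (fun l _ => pivot_nonneg b l) fun l _ => pivot_le b l

/-- A functional that kills all earlier vectors does not notice the subtraction of their
projections, so it still takes the value 1 on the Gram–Schmidt vector, which is therefore nonzero.
-/
theorem pivot_pos_of_functionals {r : ℕ} (φ : ℕ → E →ₗ[ℝ] ℝ)
    (h0 : ∀ j < r, ∀ i < j, φ j (b i) = 0) (h1 : ∀ j < r, φ j (b j) = 1) {k : ℕ} (hk : k < r) :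
    0 < pivot b k := by
  have key : ∀ j < r, ∀ l ≤ j, ∀ i ≤ j, φ j (projPerp b l i) = φ j (b i) := by
    intro j hj l
    induction l with
    | zero => intro _ i _; rfl
    | succ l ih =>
      intro hl i hi
      simp [projPerp, ih (by omega) i hi, ih (by omega) l (by omega), h0 j hj l (by omega)]
  have hne : projPerp b k k ≠ 0 := by
    intro h
    have := key k hk k le_rfl k le_rfl
    simp [h, h1 k hk] at this
  rw [pivot, projInner_self]
  exact pow_pos (norm_pos_iff.mpr hne) 2

/-! ### Determinants -/

/-- Multiples of the first row clear the first column below the corner; expansion along that column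
leaves the Schur complement. -/
theorem det_succ_eq_mul_det_schur {n : ℕ} (A : Matrix (Fin (n + 1)) (Fin (n + 1)) ℝ)
    (h : A 0 0 ≠ 0) : A.det =
      A 0 0 * (Matrix.of fun i j : Fin n =>
        A i.succ j.succ - A i.succ 0 * A 0 j.succ / A 0 0).det := by
  let B : Matrix (Fin (n + 1)) (Fin (n + 1)) ℝ := Matrix.of fun i j =>
    A i j - (if i = 0 then 0 else A i 0 / A 0 0) * A 0 j
  have hAB : A.det = B.det := by
    refine Matrix.det_eq_of_forall_row_eq_smul_add_const
      (fun i => if i = 0 then 0 else A i 0 / A 0 0) 0 (by simp) ?_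
    intro i j
    simp only [B, Matrix.of_apply]
    by_cases hi : i = 0
    · simp [hi]
    · simp [hi]
  rw [hAB, Matrix.det_succ_column_zero, Fin.sum_univ_succ]
  have hz : ∀ i : Fin n, B i.succ 0 = 0 := fun i => by
    simp [B, Fin.succ_ne_zero, div_mul_cancel₀ _ h]
  have h00 : B 0 0 = A 0 0 := by simp [B]
  simp only [hz, h00, Fin.val_zero, pow_zero, one_mul, mul_zero, zero_mul, Finset.sum_const_zero,
    add_zero]
  congr 2
  ext i j
  simp only [B, Matrix.submatrix_apply, Matrix.of_apply, Fin.succAbove_zero, Fin.succ_ne_zero,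
    if_false]
  ring

/-- Eliminating the first row and column turns the matrix into one of the same shape with `l + 1` in
place of `l`; the free offset `l` is what lets the induction close. It links minors of the Gram
matrix, which are integers for integer vectors, with Gram–Schmidt data. -/
theorem det_bordered_projInner (k : ℕ) : ∀ (l i j : ℕ), (∀ t < k, pivot b (l + t) ≠ 0) →
    (Matrix.of fun x y : Fin (k + 1) => projInner b l (if (x : ℕ) < k then l + x else i)
      (if (y : ℕ) < k then l + y else j)).det =
    (∏ t ∈ Finset.range k, pivot b (l + t)) * projInner b (l + k) i j := by
  induction k with
  | zero => intro l i j _; simp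
  | succ k ih =>
    intro l i j h
    rw [det_succ_eq_mul_det_schur _ (by simpa [pivot] using h 0 (by omega))]
    have := ih (l + 1) i j fun t ht => by
      have := h (t + 1) (by omega)
      rwa [show l + (t + 1) = l + 1 + t by ring] at this
    rw [Finset.prod_range_succ', mul_comm _ (pivot b (l + 0)), mul_assoc]
    have e1 : ∀ t, l + 1 + t = l + (t + 1) := fun t => by ring
    simp only [e1] at this
    rw [← this]
    have e2 : ∀ x : Fin (k + 1), (if ((x.succ : Fin (k + 2)) : ℕ) < k + 1 then
        l + ((x.succ : Fin (k + 2)) : ℕ) else i) = if (x : ℕ) < k then l + ((x : ℕ) + 1) else i := by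
      intro x; simp
    have e3 : ∀ x : Fin (k + 1), (if ((x.succ : Fin (k + 2)) : ℕ) < k + 1 then
        l + ((x.succ : Fin (k + 2)) : ℕ) else j) = if (x : ℕ) < k then l + ((x : ℕ) + 1) else j := by
      intro x; simp
    simp only [Matrix.of_apply, e2, e3, projInner_succ, pivot]
    refine congrArg₂ _ (by simp) (congrArg Matrix.det (Matrix.ext fun x y => ?_))
    simp [projInner_comm b l l]

theorem det_gram_eq_pivotProd {k : ℕ} (h : ∀ t < k, pivot b t ≠ 0) :
    (Matrix.of fun x y : Fin k => inner ℝ (b x) (b y)).det = pivotProd b k := by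
  cases k with
  | zero => simp [pivotProd]
  | succ k =>
    have := det_bordered_projInner b k 0 k k fun t ht => by simpa using h t (by omega)
    simp only [zero_add] at this
    rw [pivotProd_succ, pivot, pivotProd, ← this]
    congr 1
    ext x y
    have e : ∀ x : Fin (k + 1), (if (x : ℕ) < k then (x : ℕ) else k) = x := fun x => by
      split_ifs with h
      · rfl
      · have := x.isLt; omega
    simp [e, projInner_zero]

/-! ### Subtracting a multiple of an earlier vector -/

section RowOp

variable {b} {b' : ℕ → E} {i j : ℕ} {q : ℝ}

/-- Up to stage `i` the changed vector is not used as a pivot, so the operation passes through each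
elimination step by linearity. -/
theorem projPerp_rowOp_le (hi : b' i = b i - q • b j) (hne : ∀ a ≠ i, b' a = b a)
    {l : ℕ} (hl : l ≤ i) : projPerp b' l i = projPerp b l i - q • projPerp b l j ∧
      ∀ a ≠ i, projPerp b' l a = projPerp b l a := by
  induction l with
  | zero => exact ⟨hi, hne⟩
  | succ l ih =>
    obtain ⟨h1, h2⟩ := ih (by omega)
    have h3 := h2 l (by omega)
    refine ⟨?_, fun a ha => by simp only [projPerp, h2 a ha, h3]⟩
    simp only [projPerp, h1, h3, inner_sub_left, real_inner_smul_left, sub_div, mul_div_assoc]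
    module

/-- By stage `i > j` the projection of `b j` is already zero, so the subtracted multiple has
disappeared. -/
theorem projPerp_rowOp_ge (hij : j < i) (hi : b' i = b i - q • b j) (hne : ∀ a ≠ i, b' a = b a)
    {l : ℕ} (hl : i ≤ l) (a : ℕ) : projPerp b' l a = projPerp b l a := by
  induction l, hl using Nat.le_induction generalizing a with
  | base =>
    obtain ⟨h1, h2⟩ := projPerp_rowOp_le hi hne le_rfl
    by_cases ha : a = i
    · subst ha; rw [h1, projPerp_eq_zero b hij, smul_zero, sub_zero]
    · exact h2 a ha
  | succ l _ ih => simp only [projPerp, ih]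

theorem projPerp_rowOp_of_ne (hij : j < i) (hi : b' i = b i - q • b j) (hne : ∀ a ≠ i, b' a = b a)
    (l : ℕ) {a : ℕ} (ha : a ≠ i) : projPerp b' l a = projPerp b l a := by
  rcases le_total l i with h | h
  · exact (projPerp_rowOp_le hi hne h).2 a ha
  · exact projPerp_rowOp_ge hij hi hne h a

theorem projPerp_rowOp_self (hij : j < i) (hi : b' i = b i - q • b j) (hne : ∀ a ≠ i, b' a = b a)
    (l : ℕ) : projPerp b' l l = projPerp b l l := by
  rcases eq_or_ne l i with rfl | h
  · exact projPerp_rowOp_ge hij hi hne le_rfl _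
  · exact projPerp_rowOp_of_ne hij hi hne l h

theorem pivot_rowOp (hij : j < i) (hi : b' i = b i - q • b j) (hne : ∀ a ≠ i, b' a = b a) :
    pivot b' = pivot b := by
  ext l
  rw [pivot, pivot, projInner, projInner, projPerp_rowOp_self hij hi hne]

theorem projInner_rowOp_of_ne (hij : j < i) (hi : b' i = b i - q • b j)
    (hne : ∀ a ≠ i, b' a = b a) (l : ℕ) {a : ℕ} (ha : a ≠ i) :
    projInner b' l a l = projInner b l a l := by
  rw [projInner, projInner, projPerp_rowOp_self hij hi hne, projPerp_rowOp_of_ne hij hi hne l ha]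

/-- Subtracting `b j` leaves the coefficients with index above `j` alone. Treating `j = i - 1, …, 0`
in descending order therefore never spoils a coefficient already reduced. -/
theorem projInner_rowOp_of_gt (hij : j < i) (hi : b' i = b i - q • b j)
    (hne : ∀ a ≠ i, b' a = b a) {l : ℕ} (hl : j < l) :
    projInner b' l i l = projInner b l i l := by
  rw [projInner, projInner, projPerp_rowOp_self hij hi hne]
  rcases le_total l i with h | h
  · rw [(projPerp_rowOp_le hi hne h).1, projPerp_eq_zero b hl, smul_zero, sub_zero]
  · rw [projPerp_rowOp_ge hij hi hne h]

theorem projInner_rowOp_self (hij : j < i) (hi : b' i = b i - q • b j)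
    (hne : ∀ a ≠ i, b' a = b a) :
    projInner b' j i j = projInner b j i j - q * pivot b j := by
  rw [projInner, projPerp_rowOp_self hij hi hne, (projPerp_rowOp_le hi hne hij.le).1,
    inner_sub_left, real_inner_smul_left]
  rfl

end RowOp

/-! ### Swapping two consecutive vectors -/

section Swap

variable {b} {b' : ℕ → E} {k : ℕ}

theorem projPerp_swap_le (h : ∀ a, b' a = b (Equiv.swap k (k + 1) a)) {l : ℕ} (hl : l ≤ k)
    (a : ℕ) : projPerp b' l a = projPerp b l (Equiv.swap k (k + 1) a) := by
  induction l generalizing a with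
  | zero => exact h a
  | succ l ih =>
    have hl' : Equiv.swap k (k + 1) l = l :=
      Equiv.swap_apply_of_ne_of_ne (by omega) (by omega)
    simp only [projPerp, ih (by omega), hl']

theorem projInner_swap_le (h : ∀ a, b' a = b (Equiv.swap k (k + 1) a)) {l : ℕ} (hl : l ≤ k)
    (a c : ℕ) : projInner b' l a c =
      projInner b l (Equiv.swap k (k + 1) a) (Equiv.swap k (k + 1) c) := by
  simp only [projInner, projPerp_swap_le h hl]

theorem pivot_swap_of_lt (h : ∀ a, b' a = b (Equiv.swap k (k + 1) a)) {l : ℕ} (hl : l < k) :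
    pivot b' l = pivot b l := by
  rw [pivot, projInner_swap_le h hl.le, Equiv.swap_apply_of_ne_of_ne (by omega) (by omega), pivot]

/-- The new vector at position `k` is the old `b (k + 1)`, now projected away from only `k` vectors;
its component along the old Gram–Schmidt vector comes back. -/
theorem pivot_swap_self (h : ∀ a, b' a = b (Equiv.swap k (k + 1) a)) :
    pivot b' k = pivot b (k + 1) + projInner b k (k + 1) k ^ 2 / pivot b k := by
  rw [pivot, projInner_swap_le h le_rfl, Equiv.swap_apply_left, pivot.eq_1 b (k + 1),
    projInner_succ]
  ring

/-- The product is the Gram determinant of the two projected vectors, which does not depend on their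
order. -/
theorem pivot_swap_succ (h : ∀ a, b' a = b (Equiv.swap k (k + 1) a)) (h0 : 0 < pivot b k)
    (h1 : 0 < pivot b (k + 1)) :
    pivot b' k * pivot b' (k + 1) = pivot b k * pivot b (k + 1) := by
  have hk := pivot_swap_self h
  have hpos : 0 < pivot b' k := by rw [hk]; positivity
  have e1 : pivot b' (k + 1) = pivot b k - projInner b k (k + 1) k ^ 2 / pivot b' k := by
    rw [pivot, projInner_succ, projInner_swap_le h le_rfl, projInner_swap_le h le_rfl,
      Equiv.swap_apply_left, Equiv.swap_apply_right, projInner_comm b k k (k + 1)]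
    simp only [pivot]
    ring
  rw [e1, mul_sub, mul_div_cancel₀ _ hpos.ne', hk]
  field_simp
  ring

/-- After both vectors have been projected out, only their span matters. The base case verifies this
as an identity of rational functions in the inner products at stage `k`. -/
theorem projInner_swap_ge (h : ∀ a, b' a = b (Equiv.swap k (k + 1) a)) (h0 : 0 < pivot b k)
    (h1 : 0 < pivot b (k + 1)) {l : ℕ} (hl : k + 2 ≤ l) (a c : ℕ) : projInner b' l a c =
      projInner b l (Equiv.swap k (k + 1) a) (Equiv.swap k (k + 1) c) := by
  induction l, hl using Nat.le_induction generalizing a c with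
  | base =>
    have hk := pivot_swap_self h
    have hpos : 0 < pivot b' k := by rw [hk]; positivity
    have hr : pivot b' k = projInner b k (k + 1) (k + 1) := by
      rw [pivot, projInner_swap_le h le_rfl, Equiv.swap_apply_left]
    have hs := pivot_swap_succ h h0 h1
    have hs' : pivot b' (k + 1) = pivot b k * pivot b (k + 1) / pivot b' k := by
      rw [← hs, mul_div_cancel_left₀ _ hpos.ne']
    have e1 : pivot b (k + 1) = pivot b' k - projInner b k (k + 1) k ^ 2 / pivot b k := by
      rw [hk]; ring
    -- This Gram determinant of the pair is the denominator that remains after two elimination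
    -- steps; both orders share it.
    have e2 : pivot b k * pivot b' k - projInner b k (k + 1) k ^ 2 ≠ 0 := by
      have : pivot b k * pivot b (k + 1) ≠ 0 := by positivity
      rw [e1] at this
      field_simp at this
      exact this
    rw [projInner_succ b' (k + 1), projInner_succ b (k + 1)]
    simp only [projInner_succ _ k]
    rw [hs', e1]
    simp only [projInner_swap_le h le_rfl, Equiv.swap_apply_left, Equiv.swap_apply_right,
      projInner_comm b k k (k + 1)]
    generalize pivot b' k = r at *
    generalize pivot b k = p at *
    generalize projInner b k (k + 1) k = x at *
    generalize Equiv.swap k (k + 1) a = a' at *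
    generalize Equiv.swap k (k + 1) c = c' at *
    have hp := h0.ne'
    have hr' := hpos.ne'
    have e4 : r - x ^ 2 / p = (p * r - x ^ 2) / p := by field_simp
    rw [e4]
    generalize hu : p * r - x ^ 2 = u at *
    field_simp
    rw [← hu]
    ring
  | succ l hl ih =>
    have hl' : Equiv.swap k (k + 1) l = l :=
      Equiv.swap_apply_of_ne_of_ne (by omega) (by omega)
    simp only [projInner_succ, pivot, ih, hl']

theorem pivot_swap_of_gt (h : ∀ a, b' a = b (Equiv.swap k (k + 1) a)) (h0 : 0 < pivot b k)
    (h1 : 0 < pivot b (k + 1)) {l : ℕ} (hl : k + 2 ≤ l) : pivot b' l = pivot b l := by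
  rw [pivot, projInner_swap_ge h h0 h1 hl, Equiv.swap_apply_of_ne_of_ne (by omega) (by omega),
    pivot]

theorem pivotProd_swap_of_ne (h : ∀ a, b' a = b (Equiv.swap k (k + 1) a)) (h0 : 0 < pivot b k)
    (h1 : 0 < pivot b (k + 1)) {l : ℕ} (hl : l ≠ k + 1) : pivotProd b' l = pivotProd b l := by
  have hle : ∀ l ≤ k, pivotProd b' l = pivotProd b l := fun l hl =>
    Finset.prod_congr rfl fun t ht => pivot_swap_of_lt h (by have := Finset.mem_range.mp ht; omega)
  rcases Nat.lt_or_ge l (k + 1) with hlt | hge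
  · exact hle l (by omega)
  · have hge : k + 2 ≤ l := by omega
    clear hl
    induction l, hge using Nat.le_induction with
    | base =>
      rw [pivotProd_succ, pivotProd_succ, mul_assoc, pivot_swap_succ h h0 h1, hle k le_rfl,
        pivotProd_succ, pivotProd_succ, mul_assoc]
    | succ l hl ih =>
      rw [pivotProd_succ, pivotProd_succ, ih (by omega), pivot_swap_of_gt h h0 h1 hl]

/-- The new `k`-th pivot is at most a quarter of the old one from the gap plus a quarter from the
size-reduced coefficient, so the determinant of size `k + 1` is halved; by `pivotProd_swap_of_ne` no
other one changes. -/
theorem pivotProd_swap_succ (h : ∀ a, b' a = b (Equiv.swap k (k + 1) a))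
    (hpos : ∀ l ≤ k, 0 < pivot b l)
    (hred : |projInner b k (k + 1) k| ≤ pivot b k / 2) (hgap : 4 * pivot b (k + 1) < pivot b k) :
    pivotProd b' (k + 1) ≤ pivotProd b (k + 1) / 2 := by
  have h0 := hpos k le_rfl
  have hd := pivotProd_pos b (k := k) fun l hl => hpos l hl.le
  have hle : pivotProd b' k = pivotProd b k :=
    Finset.prod_congr rfl fun t ht => pivot_swap_of_lt h (Finset.mem_range.mp ht)
  rw [pivotProd_succ, pivotProd_succ, hle, mul_div_assoc, pivot_swap_self h]
  refine mul_le_mul_of_nonneg_left ?_ hd.le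
  have hsq : projInner b k (k + 1) k ^ 2 ≤ (pivot b k / 2) ^ 2 := sq_le_sq' (by
    linarith [(abs_le.mp hred).1]) (abs_le.mp hred).2
  have : projInner b k (k + 1) k ^ 2 / pivot b k ≤ pivot b k / 4 := by
    rw [div_le_iff₀ h0]; nlinarith
  linarith

end Swap

/-! ### Reduced bases -/

/-- Without gaps the first pivot is at most `4 ^ k` times the `k`-th; multiplying over all `k`
compares its power with the determinant. -/
theorem pivot_zero_pow_le {M : ℕ}
    (hred : ∀ k, k + 1 < M → pivot b k ≤ 4 * pivot b (k + 1)) :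
    pivot b 0 ^ M ≤ (4 ^ M) ^ M * pivotProd b M := by
  have h : ∀ k < M, pivot b 0 ≤ 4 ^ k * pivot b k := by
    intro k
    induction k with
    | zero => intro _; simp
    | succ k ih =>
      intro hk
      have h1 := ih (by omega)
      have h2 := hred k hk
      have h3 : (0 : ℝ) < 4 ^ k := by positivity
      rw [pow_succ]
      nlinarith
  calc pivot b 0 ^ M = ∏ _k ∈ Finset.range M, pivot b 0 := by simp
    _ ≤ ∏ k ∈ Finset.range M, (4 ^ M * pivot b k) := by
        refine Finset.prod_le_prod (fun _ _ => pivot_nonneg b 0) fun k hk => ?_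
        have hk := Finset.mem_range.mp hk
        refine (h k hk).trans (mul_le_mul_of_nonneg_right ?_ (pivot_nonneg b k))
        exact pow_le_pow_right₀ (by norm_num) hk.le
    _ = (4 ^ M) ^ M * pivotProd b M := by
        rw [Finset.prod_mul_distrib]; simp [pivotProd]

/-- In a size-reduced row each earlier direction contributes at most a quarter of its pivot. The
norm is thus bounded by the pivots alone, whatever happened before. -/
theorem norm_sq_le_of_reduced {M : ℕ} {i : ℕ} {P : ℝ} (hi : i < M) (hP : ∀ k < M, pivot b k ≤ P)
    (hpos : ∀ k < M, 0 < pivot b k)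
    (hred : ∀ l < i, |projInner b l i l| ≤ pivot b l / 2) : ‖b i‖ ^ 2 ≤ M * P := by
  have hP0 : 0 ≤ P := (hpos i hi).le.trans (hP i hi)
  rw [← real_inner_self_eq_norm_sq, ← projInner_zero, projInner_self_eq_sum b i i]
  have h1 : ∑ l ∈ Finset.range i, projInner b l i l ^ 2 / pivot b l ≤
      ∑ _l ∈ Finset.range i, P := by
    refine Finset.sum_le_sum fun l hl => ?_
    have hl := Finset.mem_range.mp hl
    have h0 := hpos l (by omega)
    have hsq : projInner b l i l ^ 2 ≤ (pivot b l / 2) ^ 2 := sq_le_sq' (by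
      linarith [(abs_le.mp (hred l hl)).1]) (abs_le.mp (hred l hl)).2
    refine le_trans ?_ (hP l (by omega))
    rw [div_le_iff₀ h0]
    nlinarith
  rw [Finset.sum_const, Finset.card_range, nsmul_eq_mul] at h1
  have h2 : projInner b i i i ≤ P := hP i hi
  have h3 : ((i : ℝ) + 1) ≤ M := by exact_mod_cast hi
  nlinarith

end GramSchmidt

/-! ## Lattice basis reduction of integer matrices -/

/-- The rows of an integer matrix, as vectors with `D` coordinates. -/
noncomputable def rowVec (D : ℕ) (B : ℕ → ℕ → ℤ) (i : ℕ) : EuclideanSpace ℝ (Fin D) :=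
  WithLp.toLp 2 fun l => (B i l : ℝ)

/-- The Gram matrix of the rows. -/
def gram (D : ℕ) (B : ℕ → ℕ → ℤ) (i j : ℕ) : ℤ := ∑ l ∈ Finset.range D, B i l * B j l

/-- The minor of the Gram matrix with rows `0, …, k - 1, i` and columns `0, …, k - 1, j`. -/
def gramMinor (D : ℕ) (B : ℕ → ℕ → ℤ) (k i j : ℕ) : ℤ :=
  (Matrix.of fun x y : Fin (k + 1) =>
    gram D B (if (x : ℕ) < k then x else i) (if (y : ℕ) < k then y else j)).det

/-- The leading principal minor of size `k` of the Gram matrix. -/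
def gramDet (D : ℕ) (B : ℕ → ℕ → ℤ) : ℕ → ℤ
  | 0 => 1
  | k + 1 => gramMinor D B k k k

/-! ### Gram–Schmidt data as integer minors -/

section RowVec

variable {D : ℕ} {B : ℕ → ℕ → ℤ}

theorem cast_gram (i j : ℕ) : (gram D B i j : ℝ) = inner ℝ (rowVec D B i) (rowVec D B j) := by
  simp only [gram, rowVec, PiLp.inner_apply, Finset.sum_range]
  push_cast
  exact Finset.sum_congr rfl fun l _ => by simp [mul_comm]

theorem abs_entry_le (i l : ℕ) (hl : l < D) : |(B i l : ℝ)| ≤ ‖rowVec D B i‖ := by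
  simpa [rowVec] using PiLp.norm_apply_le (rowVec D B i) (⟨l, hl⟩ : Fin D)

theorem cast_gramMinor {k : ℕ} (h : ∀ t < k, pivot (rowVec D B) t ≠ 0) (i j : ℕ) :
    (gramMinor D B k i j : ℝ) = pivotProd (rowVec D B) k * projInner (rowVec D B) k i j := by
  have := det_bordered_projInner (rowVec D B) k 0 i j fun t ht => by simpa using h t ht
  simp only [zero_add] at this
  rw [pivotProd, ← this, gramMinor]
  refine (RingHom.map_det (Int.castRingHom ℝ) _).trans ?_
  congr 1
  ext x y
  simp [projInner_zero, cast_gram]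

theorem cast_gramDet {k : ℕ} (h : ∀ t < k, pivot (rowVec D B) t ≠ 0) :
    (gramDet D B k : ℝ) = pivotProd (rowVec D B) k := by
  cases k with
  | zero => simp [gramDet, pivotProd]
  | succ k => rw [gramDet, cast_gramMinor fun t ht => h t (by omega), pivotProd_succ, pivot]

/-- For integer rows the determinant is a positive integer. This is the lower bound behind
termination and behind all estimates of pivots from below. -/
theorem one_le_pivotProd {k : ℕ} (h : ∀ t < k, 0 < pivot (rowVec D B) t) :
    1 ≤ pivotProd (rowVec D B) k := by
  have h1 := cast_gramDet (B := B) fun t ht => (h t ht).ne'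
  have h2 := pivotProd_pos _ h
  rw [← h1] at h2 ⊢
  have h3 : 0 < gramDet D B k := by exact_mod_cast h2
  exact_mod_cast h3

/-- Fraction-free (Bareiss) elimination: the determinant identity makes the integer division exact,
so intermediate values are minors and never become large fractions. -/
theorem gramMinor_succ {k : ℕ} (h : ∀ t ≤ k, 0 < pivot (rowVec D B) t) (i j : ℕ) :
    gramMinor D B (k + 1) i j = (gramMinor D B k k k * gramMinor D B k i j -
      gramMinor D B k i k * gramMinor D B k k j) / gramDet D B k := by
  have hk : ∀ t < k, pivot (rowVec D B) t ≠ 0 := fun t ht => (h t ht.le).ne'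
  have h0 : gramDet D B k ≠ 0 := by
    have := cast_gramDet hk
    have h2 := pivotProd_pos _ fun t ht => h t (le_of_lt ht)
    rw [← this] at h2
    exact_mod_cast h2.ne'
  refine Int.eq_ediv_of_mul_eq_right h0 ?_
  have hp := (h k le_rfl).ne'
  have : (gramDet D B k * gramMinor D B (k + 1) i j : ℝ) =
      gramMinor D B k k k * gramMinor D B k i j - gramMinor D B k i k * gramMinor D B k k j := by
    rw [cast_gramDet hk, cast_gramMinor fun t ht => (h t (by omega)).ne', cast_gramMinor hk,
      cast_gramMinor hk, cast_gramMinor hk, cast_gramMinor hk, pivotProd_succ, projInner_succ,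
      projInner_comm _ k k j, show projInner (rowVec D B) k k k = pivot (rowVec D B) k from rfl]
    field_simp
  exact_mod_cast this

end RowVec

/-- The nearest integer to the Gram–Schmidt coefficient of row `i` with respect to row `j`. -/
def nearestCoeff (D : ℕ) (B : ℕ → ℕ → ℤ) (i j : ℕ) : ℤ :=
  (2 * gramMinor D B j i j + gramMinor D B j j j) / (2 * gramMinor D B j j j)

/-- Subtraction of a multiple of row `j` from row `i`. -/
def rowOp (D : ℕ) (B : ℕ → ℕ → ℤ) (i j : ℕ) : ℕ → ℕ → ℤ := fun a l =>
  if a = i then B i l - nearestCoeff D B i j * B j l else B a l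

/-- The first `t` steps of the size reduction of row `i`. -/
def reduceRow (D : ℕ) (B : ℕ → ℕ → ℤ) (i : ℕ) : ℕ → ℕ → ℕ → ℤ
  | 0 => B
  | t + 1 => rowOp D (reduceRow D B i t) i (i - 1 - t)

/-- The size reduction of the first `i` rows. -/
def reduceRows (D : ℕ) (B : ℕ → ℕ → ℤ) : ℕ → ℕ → ℕ → ℤ
  | 0 => B
  | i + 1 => reduceRow D (reduceRows D B i) i i

/-- The `k`-th Gram–Schmidt vector is more than twice as long as the next one. -/
def HasGap (D : ℕ) (B : ℕ → ℕ → ℤ) (k : ℕ) : Prop :=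
  4 * (gramDet D B k * gramDet D B (k + 2)) < gramDet D B (k + 1) * gramDet D B (k + 1)

instance (D : ℕ) (B : ℕ → ℕ → ℤ) (k : ℕ) : Decidable (HasGap D B k) := Int.decLt _ _

/-- The number `k + 1` for the last `k < t` such that rows `k` and `k + 1` have to be swapped, or
`0` if there is none. -/
def lastGap (D M : ℕ) (B : ℕ → ℕ → ℤ) : ℕ → ℕ
  | 0 => 0
  | k + 1 => if k + 1 < M ∧ HasGap D B k then k + 1 else lastGap D M B k

/-- A swap of two rows, if one is called for. -/
def swapStep (D M : ℕ) (B : ℕ → ℕ → ℤ) : ℕ → ℕ → ℤ :=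
  if lastGap D M B M = 0 then B else
    fun a => B (Equiv.swap (lastGap D M B M - 1) (lastGap D M B M) a)

/-- An iteration of the reduction algorithm. -/
def lllStep (D M : ℕ) (B : ℕ → ℕ → ℤ) : ℕ → ℕ → ℤ := swapStep D M (reduceRows D B M)

/-- `T` iterations of the reduction algorithm. -/
def lll (D M : ℕ) (B : ℕ → ℕ → ℤ) : ℕ → ℕ → ℕ → ℤ
  | 0 => B
  | T + 1 => lllStep D M (lll D M B T)

/-- The first `M` rows are linearly independent, with Gram determinants at most `Δ`, and of norm at
most `S`. -/
structure IsBoundedBasis (D M : ℕ) (Δ S : ℝ) (B : ℕ → ℕ → ℤ) : Prop where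
  pivot_pos : ∀ k < M, 0 < pivot (rowVec D B) k
  pivotProd_le : ∀ k ≤ M, pivotProd (rowVec D B) k ≤ Δ
  norm_le : ∀ i < M, ‖rowVec D B i‖ ≤ S

/-- The Gram–Schmidt vectors do not decrease too fast. -/
def IsGapFree (D M : ℕ) (B : ℕ → ℕ → ℤ) : Prop :=
  ∀ k, k + 1 < M → pivot (rowVec D B) k ≤ 4 * pivot (rowVec D B) (k + 1)

/-- The coefficients of the first row with respect to the Gram–Schmidt vectors before are at most
`1 / 2`. -/
def IsSizeReduced (D : ℕ) (B : ℕ → ℕ → ℤ) (i : ℕ) : Prop :=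
  ∀ l < i, |projInner (rowVec D B) l i l| ≤ pivot (rowVec D B) l / 2

/-! ### Invariants and termination of the reduction -/

section Reduction

variable {D M : ℕ} {B : ℕ → ℕ → ℤ} {Δ S : ℝ}

namespace IsBoundedBasis

theorem mono (h : IsBoundedBasis D M Δ S B) {S' : ℝ} (hS : S ≤ S') : IsBoundedBasis D M Δ S' B :=
  ⟨h.1, h.2, fun i hi => (h.3 i hi).trans hS⟩

theorem one_le_pivotProd (h : IsBoundedBasis D M Δ S B) {k : ℕ} (hk : k ≤ M) :
    1 ≤ pivotProd (rowVec D B) k :=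
  _root_.one_le_pivotProd fun t ht => h.pivot_pos t (by omega)

theorem one_le (h : IsBoundedBasis D M Δ S B) : 1 ≤ Δ :=
  (h.one_le_pivotProd (Nat.zero_le M)).trans (h.pivotProd_le 0 (Nat.zero_le M))

theorem pivot_le (h : IsBoundedBasis D M Δ S B) {k : ℕ} (hk : k < M) :
    pivot (rowVec D B) k ≤ Δ := by
  have h1 := h.one_le_pivotProd hk.le
  have h2 := h.pivotProd_le (k + 1) hk
  rw [pivotProd_succ] at h2
  nlinarith [h.pivot_pos k hk]

/-- A pivot is the quotient of two consecutive determinants, the larger index being at least 1 and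
the smaller index at most `Δ`. -/
theorem one_le_mul_pivot (h : IsBoundedBasis D M Δ S B) {k : ℕ} (hk : k < M) :
    1 ≤ Δ * pivot (rowVec D B) k := by
  have h1 := h.one_le_pivotProd (k := k + 1) hk
  rw [pivotProd_succ] at h1
  exact h1.trans (mul_le_mul_of_nonneg_right (h.pivotProd_le k hk.le) (h.pivot_pos k hk).le)

theorem abs_gramMinor_le (h : IsBoundedBasis D M Δ S B) {k i j : ℕ} (hk : k ≤ M) (hi : i < M)
    (hj : j < M) : |(gramMinor D B k i j : ℝ)| ≤ Δ * (S * S) := by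
  rw [cast_gramMinor fun t ht => (h.pivot_pos t (by omega)).ne', abs_mul]
  have h1 := h.one_le_pivotProd hk
  rw [abs_of_pos (by linarith)]
  refine mul_le_mul (h.pivotProd_le k hk) ((abs_projInner_le _ _ _ _).trans ?_) (abs_nonneg _)
    (by linarith [h.one_le])
  exact mul_le_mul (h.norm_le i hi) (h.norm_le j hj) (norm_nonneg _)
    ((norm_nonneg _).trans (h.norm_le i hi))

theorem abs_entry_le (h : IsBoundedBasis D M Δ S B) {i l : ℕ} (hi : i < M) (hl : l < D) :
    |(B i l : ℝ)| ≤ S := (_root_.abs_entry_le i l hl).trans (h.norm_le i hi)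

/-- The common factor `pivotProd` of both minors cancels in their quotient, so the integer division
computes the floor of the Gram–Schmidt coefficient plus `1 / 2`. -/
theorem abs_nearestCoeff_sub_le (h : IsBoundedBasis D M Δ S B) {i j : ℕ} (hj : j < M) :
    |projInner (rowVec D B) j i j - nearestCoeff D B i j * pivot (rowVec D B) j| ≤
      pivot (rowVec D B) j / 2 := by
  have hne : ∀ t < j, pivot (rowVec D B) t ≠ 0 := fun t ht => (h.pivot_pos t (by omega)).ne'
  have hd := h.one_le_pivotProd hj.le
  have hp := h.pivot_pos j hj
  have e1 := cast_gramMinor hne i j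
  have e2 := cast_gramMinor hne j j
  rw [show projInner (rowVec D B) j j j = pivot (rowVec D B) j from rfl] at e2
  have hpos : 0 < gramMinor D B j j j := by
    have : (0 : ℝ) < gramMinor D B j j j := by rw [e2]; positivity
    exact_mod_cast this
  have h1 := Int.mul_ediv_self_le (x := 2 * gramMinor D B j i j + gramMinor D B j j j)
    (k := 2 * gramMinor D B j j j) (by omega)
  have h2 := Int.lt_mul_ediv_self_add (x := 2 * gramMinor D B j i j + gramMinor D B j j j)
    (k := 2 * gramMinor D B j j j) (by omega)
  rw [← nearestCoeff] at h1 h2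
  generalize nearestCoeff D B i j = q at *
  generalize gramMinor D B j i j = x at *
  generalize gramMinor D B j j j = y at *
  have h1' : (2 * y * q : ℝ) ≤ 2 * x + y := by exact_mod_cast h1
  have h2' : (2 * x + y : ℝ) < 2 * y * q + 2 * y := by exact_mod_cast h2
  rw [e1, e2] at h1' h2'
  have hd0 : 0 < pivotProd (rowVec D B) j := by linarith
  rw [abs_le]
  constructor
  · refine le_of_mul_le_mul_left ?_ hd0
    nlinarith
  · refine le_of_mul_le_mul_left ?_ hd0
    nlinarith

/-- The coefficient is an inner product divided by a pivot, and the reciprocal of the pivot is at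
most `Δ`; rounding costs at most 1. -/
theorem abs_nearestCoeff_le (h : IsBoundedBasis D M Δ S B) {i j : ℕ} {R : ℝ} (hj : j < M)
    (hi : i < M) (hR : ‖rowVec D B j‖ ≤ R) : |(nearestCoeff D B i j : ℝ)| ≤ S * R * Δ + 1 := by
  have hp := h.pivot_pos j hj
  have h1 := h.abs_nearestCoeff_sub_le (i := i) hj
  have h2 : |projInner (rowVec D B) j i j| ≤ S * R := (abs_projInner_le _ _ _ _).trans
    (mul_le_mul (h.norm_le i hi) hR (norm_nonneg _) ((norm_nonneg _).trans (h.norm_le i hi)))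
  have h3 := h.one_le_mul_pivot hj
  have h4 : |nearestCoeff D B i j * pivot (rowVec D B) j| ≤ S * R + pivot (rowVec D B) j / 2 := by
    have := abs_sub_abs_le_abs_sub (nearestCoeff D B i j * pivot (rowVec D B) j)
      (projInner (rowVec D B) j i j)
    rw [abs_sub_comm] at this
    linarith
  rw [abs_mul, abs_of_pos hp] at h4
  refine le_of_mul_le_mul_right (h4.trans ?_) hp
  have h5 : 0 ≤ S * R := (abs_nonneg _).trans h2
  nlinarith

end IsBoundedBasis

theorem rowVec_rowOp_self (i j : ℕ) : rowVec D (rowOp D B i j) i =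
    rowVec D B i - (nearestCoeff D B i j : ℝ) • rowVec D B j := by
  ext l
  simp [rowVec, rowOp]

theorem rowVec_rowOp_of_ne {i j a : ℕ} (ha : a ≠ i) :
    rowVec D (rowOp D B i j) a = rowVec D B a := by
  ext l
  simp [rowVec, rowOp, ha]

/-- Row `i` may have grown to norm `S`, while the subtracted row still has norm at most `R`. The
bound is linear in `S`, so repeated subtractions cause a geometric growth with a fixed ratio. -/
theorem IsBoundedBasis.norm_rowOp_le (h : IsBoundedBasis D M Δ S B) {i j : ℕ} {R : ℝ} (hi : i < M)
    (hj : j < M) (hR : ‖rowVec D B j‖ ≤ R) (hS : 1 ≤ S) :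
    ‖rowVec D (rowOp D B i j) i‖ ≤ S * (1 + R + R * R * Δ) := by
  have h1 := h.abs_nearestCoeff_le hj hi hR
  have hR0 : 0 ≤ R := (norm_nonneg _).trans hR
  have hΔ := h.one_le
  rw [rowVec_rowOp_self]
  refine (norm_sub_le _ _).trans ?_
  rw [norm_smul, Real.norm_eq_abs]
  have h2 : |(nearestCoeff D B i j : ℝ)| * ‖rowVec D B j‖ ≤ (S * R * Δ + 1) * R :=
    mul_le_mul h1 hR (norm_nonneg _) (by positivity)
  have h3 := h.norm_le i hi
  nlinarith

/-- The effect of the first `t` steps of the size reduction of row `i`. -/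
theorem reduceRow_spec {R : ℝ} (hB : IsBoundedBasis D M Δ R B) (hR : 1 ≤ R) {i : ℕ} (hi : i < M)
    {t : ℕ} (ht : t ≤ i) :
    (∀ a ≠ i, rowVec D (reduceRow D B i t) a = rowVec D B a) ∧
    pivot (rowVec D (reduceRow D B i t)) = pivot (rowVec D B) ∧
    (∀ a ≠ i, ∀ l, projInner (rowVec D (reduceRow D B i t)) l a l =
      projInner (rowVec D B) l a l) ∧
    (∀ l < i, i - t ≤ l → |projInner (rowVec D (reduceRow D B i t)) l i l| ≤
      pivot (rowVec D B) l / 2) ∧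
    ‖rowVec D (reduceRow D B i t) i‖ ≤ R * (1 + R + R * R * Δ) ^ t := by
  induction t with
  | zero =>
    refine ⟨fun _ _ => rfl, rfl, fun _ _ _ => rfl, fun l hl hl' => by omega, ?_⟩
    simpa [reduceRow] using hB.norm_le i hi
  | succ t ih =>
    obtain ⟨h1, h2, h3, h4, h5⟩ := ih (by omega)
    have hΔ := hB.one_le
    -- The growth factor of row `i` per subtraction; the other rows keep the bound `R`.
    set C := 1 + R + R * R * Δ with hC
    have hC1 : 1 ≤ C := by rw [hC]; have : 0 ≤ R * R * Δ := by positivity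
                           linarith
    have hCt : 1 ≤ C ^ t := one_le_pow₀ hC1
    have hBt : IsBoundedBasis D M Δ (R * C ^ t) (reduceRow D B i t) := by
      refine ⟨by rw [h2]; exact hB.pivot_pos, fun k hk => ?_, fun a ha => ?_⟩
      · rw [pivotProd, h2]; exact hB.pivotProd_le k hk
      · rcases eq_or_ne a i with rfl | hai
        · exact h5
        · rw [h1 a hai]
          exact (hB.norm_le a ha).trans (le_mul_of_one_le_right (by linarith) hCt)
    have hji : i - 1 - t < i := by omega
    have e1 := rowVec_rowOp_self (D := D) (B := reduceRow D B i t) i (i - 1 - t)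
    have e2 : ∀ a ≠ i, _ := fun a ha => rowVec_rowOp_of_ne (D := D) (B := reduceRow D B i t)
      (j := i - 1 - t) ha
    refine ⟨fun a ha => (e2 a ha).trans (h1 a ha), ?_, fun a ha l => ?_, fun l hl hl' => ?_, ?_⟩
    · rw [reduceRow, pivot_rowOp hji e1 e2, h2]
    · rw [reduceRow, projInner_rowOp_of_ne hji e1 e2 l ha, h3 a ha]
    -- The current step reduces the coefficient with index `i - 1 - t`; those with larger index were
    -- reduced before and are not affected.
    · rcases eq_or_ne l (i - 1 - t) with rfl | hne
      · rw [reduceRow, projInner_rowOp_self hji e1 e2, ← h2]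
        exact hBt.abs_nearestCoeff_sub_le (by omega)
      · rw [reduceRow, projInner_rowOp_of_gt hji e1 e2 (by omega)]
        exact h4 l hl (by omega)
    · have := hBt.norm_rowOp_le (j := i - 1 - t) (R := R) hi (by omega)
        (by rw [h1 _ (by omega)]; exact hB.norm_le _ (by omega))
        (by nlinarith)
      rw [reduceRow, pow_succ, ← mul_assoc]
      exact this

theorem IsBoundedBasis.reduceRow {R : ℝ} (hB : IsBoundedBasis D M Δ R B) (hR : 1 ≤ R) {i : ℕ}
    (hi : i < M) {t : ℕ} (ht : t ≤ i) :
    IsBoundedBasis D M Δ (R * (1 + R + R * R * Δ) ^ M) (reduceRow D B i t) := by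
  obtain ⟨h1, h2, -, -, h5⟩ := reduceRow_spec hB hR hi ht
  have hΔ := hB.one_le
  set C := 1 + R + R * R * Δ with hC
  have hC1 : 1 ≤ C := by rw [hC]; have : 0 ≤ R * R * Δ := by positivity
                         linarith
  refine ⟨by rw [h2]; exact hB.pivot_pos, fun k hk => ?_, fun a ha => ?_⟩
  · rw [pivotProd, h2]; exact hB.pivotProd_le k hk
  · rcases eq_or_ne a i with rfl | hai
    · refine h5.trans (mul_le_mul_of_nonneg_left ?_ (by linarith))
      exact pow_le_pow_right₀ hC1 (by omega)
    · rw [h1 a hai]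
      exact (hB.norm_le a ha).trans (le_mul_of_one_le_right (by linarith) (one_le_pow₀ hC1))

/-- The growth inside one row is temporary: once size-reduced, the row has squared norm at most `M *
Δ ≤ R ^ 2`, so the bound `R` is restored before the next row and does not deteriorate over the
iterations. -/
theorem reduceRows_spec {R : ℝ} (hB : IsBoundedBasis D M Δ R B) (hR : 1 ≤ R)
    (hMR : M * Δ ≤ R ^ 2) {i : ℕ} (hi : i ≤ M) :
    IsBoundedBasis D M Δ R (reduceRows D B i) ∧
    pivot (rowVec D (reduceRows D B i)) = pivot (rowVec D B) ∧
    ∀ a < i, IsSizeReduced D (reduceRows D B i) a := by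
  induction i with
  | zero => exact ⟨hB, rfl, fun a ha => by omega⟩
  | succ i ih =>
    obtain ⟨h1, h2, h3⟩ := ih (by omega)
    obtain ⟨r1, r2, r3, r4, -⟩ := reduceRow_spec h1 hR hi le_rfl
    have hsr : IsSizeReduced D (reduceRows D B (i + 1)) i := fun l hl => by
      have := r4 l hl (by omega)
      rw [← r2] at this
      exact this
    have hbd := h1.reduceRow hR hi le_rfl
    refine ⟨⟨hbd.1, hbd.2, fun a ha => ?_⟩, r2.trans h2, fun a ha => ?_⟩
    · rcases eq_or_ne a i with rfl | hai
      · have h6 : ‖rowVec D (reduceRows D B (a + 1)) a‖ ^ 2 ≤ M * Δ :=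
          norm_sq_le_of_reduced _ hi (fun k hk => hbd.pivot_le hk) hbd.pivot_pos hsr
        exact (sq_le_sq₀ (norm_nonneg _) (by linarith)).mp (h6.trans hMR)
      · rw [reduceRows, r1 a hai]
        exact h1.norm_le a ha
    · rcases eq_or_ne a i with rfl | hai
      · exact hsr
      · intro l hl
        rw [reduceRows, r3 a hai, r2]
        exact h3 a (by omega) l hl

/-- With pivots written as quotients of determinants, this is the comparison with denominators
cleared. -/
theorem hasGap_iff (hB : IsBoundedBasis D M Δ S B) {k : ℕ} (hk : k + 1 < M) :
    HasGap D B k ↔ 4 * pivot (rowVec D B) (k + 1) < pivot (rowVec D B) k := by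
  have hne : ∀ t < M, pivot (rowVec D B) t ≠ 0 := fun t ht => (hB.pivot_pos t ht).ne'
  have h0 := hB.one_le_pivotProd (k := k) (by omega)
  have h1 := hB.pivot_pos k (by omega)
  have : HasGap D B k ↔ (4 * (gramDet D B k * gramDet D B (k + 2)) : ℝ) <
      gramDet D B (k + 1) * gramDet D B (k + 1) := by
    rw [HasGap]; exact_mod_cast Iff.rfl
  rw [this, cast_gramDet fun t ht => hne t (by omega), cast_gramDet fun t ht => hne t (by omega),
    cast_gramDet fun t ht => hne t (by omega), pivotProd_succ _ (k + 1), pivotProd_succ]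
  generalize pivotProd (rowVec D B) k = d at *
  generalize pivot (rowVec D B) k = p at *
  generalize pivot (rowVec D B) (k + 1) = p' at *
  have : 0 < d * d * p := by positivity
  rw [show 4 * (d * (d * p * p')) = d * d * p * (4 * p') by ring,
    show d * p * (d * p) = d * d * p * p by ring, mul_lt_mul_iff_right₀ this]

theorem lastGap_spec (t : ℕ) :
    (lastGap D M B t = 0 → ∀ k < t, k + 1 < M → ¬ HasGap D B k) ∧
    (lastGap D M B t ≠ 0 → lastGap D M B t < M ∧ HasGap D B (lastGap D M B t - 1)) := by
  induction t with
  | zero => simp [lastGap]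
  | succ t ih =>
    rw [lastGap]
    split_ifs with h
    · simpa using h
    · refine ⟨fun h0 k hk hkM => ?_, ih.2⟩
      rcases Nat.lt_succ_iff_lt_or_eq.mp hk with hk | rfl
      · exact ih.1 h0 k hk hkM
      · exact fun hg => h ⟨hkM, hg⟩

theorem swapStep_spec {R : ℝ} (hB : IsBoundedBasis D M Δ R B)
    (hred : ∀ a < M, IsSizeReduced D B a) :
    (IsGapFree D M B → swapStep D M B = B) ∧ IsBoundedBasis D M Δ R (swapStep D M B) ∧
    pivotProd (rowVec D (swapStep D M B)) M = pivotProd (rowVec D B) M ∧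
    (¬ IsGapFree D M B → ∏ k ∈ Finset.range (M + 1), pivotProd (rowVec D (swapStep D M B)) k ≤
      (∏ k ∈ Finset.range (M + 1), pivotProd (rowVec D B) k) / 2) := by
  obtain ⟨h1, h2⟩ := lastGap_spec (D := D) (M := M) (B := B) M
  by_cases h0 : lastGap D M B M = 0
  · have heq : swapStep D M B = B := by simp [swapStep, h0]
    refine ⟨fun _ => heq, by rwa [heq], by rw [heq], fun hng => (hng fun k hk => ?_).elim⟩
    have := h1 h0 k (by omega) hk
    rw [hasGap_iff hB hk, not_lt] at this
    exact this
  · obtain ⟨hlt, hgap⟩ := h2 h0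
    obtain ⟨k, hk⟩ : ∃ k, lastGap D M B M = k + 1 := ⟨_, (Nat.succ_pred_eq_of_ne_zero h0).symm⟩
    rw [hk] at hlt hgap
    rw [Nat.add_sub_cancel, hasGap_iff hB hlt] at hgap
    have hsw : ∀ a, rowVec D (swapStep D M B) a = rowVec D B (Equiv.swap k (k + 1) a) := by
      intro a; simp [rowVec, swapStep, hk]
    have hp0 := hB.pivot_pos k (by omega)
    have hp1 := hB.pivot_pos (k + 1) hlt
    have hsucc := pivotProd_swap_succ hsw (fun l hl => hB.pivot_pos l (by omega))
      (hred (k + 1) hlt k (by omega)) hgap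
    have hne : ∀ l, l ≠ k + 1 → _ := fun l hl => pivotProd_swap_of_ne hsw hp0 hp1 hl
    have hpk : 0 < pivot (rowVec D (swapStep D M B)) k := by
      rw [pivot_swap_self hsw]; positivity
    refine ⟨fun hgf => absurd (hgf k hlt) (not_le.mpr hgap),
      ⟨fun l hl => ?_, fun l hl => ?_, fun a ha => ?_⟩, hne M (by omega), fun _ => ?_⟩
    · rcases lt_trichotomy l k with hlk | rfl | hlk
      · rw [pivot_swap_of_lt hsw hlk]; exact hB.pivot_pos l hl
      · exact hpk
      · rcases Nat.lt_or_ge l (k + 2) with hl2 | hl2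
        · obtain rfl : l = k + 1 := by omega
          have := pivot_swap_succ hsw hp0 hp1
          have h3 : 0 < pivot (rowVec D B) k * pivot (rowVec D B) (k + 1) := by positivity
          rw [← this] at h3
          exact (pos_iff_pos_of_mul_pos h3).mp hpk
        · rw [pivot_swap_of_gt hsw hp0 hp1 hl2]; exact hB.pivot_pos l hl
    · rcases eq_or_ne l (k + 1) with rfl | hlk
      · have := hB.one_le_pivotProd hl
        linarith [hB.pivotProd_le (k + 1) hl]
      · rw [hne l hlk]; exact hB.pivotProd_le l hl
    · rw [hsw]
      refine hB.norm_le _ ?_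
      rcases eq_or_ne a k with rfl | h3
      · simpa using hlt
      · rcases eq_or_ne a (k + 1) with rfl | h4
        · simp; omega
        · rwa [Equiv.swap_apply_of_ne_of_ne h3 h4]
    -- Exactly one factor of the potential changes, and it is at least halved.
    · have hmem : k + 1 ∈ Finset.range (M + 1) := Finset.mem_range.mpr (by omega)
      rw [← Finset.mul_prod_erase _ _ hmem, ← Finset.mul_prod_erase (Finset.range (M + 1)) _ hmem,
        mul_div_right_comm]
      rw [Finset.prod_congr rfl fun l hl => hne l (Finset.ne_of_mem_erase hl)]
      refine mul_le_mul_of_nonneg_right hsucc (Finset.prod_nonneg fun l hl => ?_)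
      have := Finset.mem_range.mp (Finset.mem_of_mem_erase hl)
      linarith [hB.one_le_pivotProd (k := l) (by omega)]

/-- Size reduction keeps all pivots, so the potential moves only by the swap. A gap-free basis stays
gap-free; surplus iterations are harmless and the program needs no termination test. -/
theorem lllStep_spec {R : ℝ} (hB : IsBoundedBasis D M Δ R B) (hR : 1 ≤ R) (hMR : M * Δ ≤ R ^ 2) :
    IsBoundedBasis D M Δ R (lllStep D M B) ∧
    pivotProd (rowVec D (lllStep D M B)) M = pivotProd (rowVec D B) M ∧
    (IsGapFree D M B → IsGapFree D M (lllStep D M B)) ∧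
    (¬ IsGapFree D M B → ∏ k ∈ Finset.range (M + 1), pivotProd (rowVec D (lllStep D M B)) k ≤
      (∏ k ∈ Finset.range (M + 1), pivotProd (rowVec D B) k) / 2) := by
  obtain ⟨h1, h2, h3⟩ := reduceRows_spec hB hR hMR le_rfl
  obtain ⟨h4, h5, h7, h6⟩ := swapStep_spec h1 h3
  have hiff : IsGapFree D M (reduceRows D B M) ↔ IsGapFree D M B := by
    simp only [IsGapFree, h2]
  rw [hiff] at h4 h6
  refine ⟨h5, h7.trans (by simp only [pivotProd, h2]), fun hg => ?_, fun hg => ?_⟩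
  · rw [lllStep, h4 hg, hiff]
    exact hg
  · have := h6 hg
    simp only [pivotProd, h2] at this ⊢
    exact this

theorem IsBoundedBasis.lll {R : ℝ} (hB : IsBoundedBasis D M Δ R B) (hR : 1 ≤ R)
    (hMR : M * Δ ≤ R ^ 2) (T : ℕ) : IsBoundedBasis D M Δ R (lll D M B T) := by
  induction T with
  | zero => exact hB
  | succ T ih => exact (lllStep_spec ih hR hMR).1

theorem pivotProd_lll {R : ℝ} (hB : IsBoundedBasis D M Δ R B) (hR : 1 ≤ R)
    (hMR : M * Δ ≤ R ^ 2) (T : ℕ) :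
    pivotProd (rowVec D (lll D M B T)) M = pivotProd (rowVec D B) M := by
  induction T with
  | zero => rfl
  | succ T ih => exact (lllStep_spec (hB.lll hR hMR T) hR hMR).2.1.trans ih

theorem isGapFree_lll {R : ℝ} (hB : IsBoundedBasis D M Δ R B) (hR : 1 ≤ R) (hMR : M * Δ ≤ R ^ 2)
    {T : ℕ} (hT : Δ ^ (M + 1) < 2 ^ T) : IsGapFree D M (lll D M B T) := by
  -- The potential starts at most at `Δ ^ (M + 1)` and halves as long as gaps remain.
  have key : ∀ T, IsGapFree D M (_root_.lll D M B T) ∨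
      (∏ k ∈ Finset.range (M + 1), pivotProd (rowVec D (_root_.lll D M B T)) k) * 2 ^ T ≤
        Δ ^ (M + 1) := by
    intro T
    induction T with
    | zero =>
      right
      have : ∏ k ∈ Finset.range (M + 1), pivotProd (rowVec D B) k ≤
          ∏ _k ∈ Finset.range (M + 1), Δ := by
        refine Finset.prod_le_prod (fun k hk => ?_) fun k hk => ?_
        · have := Finset.mem_range.mp hk
          linarith [hB.one_le_pivotProd (k := k) (by omega)]
        · have := Finset.mem_range.mp hk
          exact hB.pivotProd_le k (by omega)
      simpa [_root_.lll] using this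
    | succ T ih =>
      obtain ⟨-, -, h2, h3⟩ := lllStep_spec (hB.lll hR hMR T) hR hMR
      by_cases hg : IsGapFree D M (_root_.lll D M B T)
      · exact Or.inl (h2 hg)
      · right
        have h4 := ih.resolve_left hg
        have h5 := h3 hg
        have : (0 : ℝ) < 2 ^ T := by positivity
        rw [pow_succ, _root_.lll]
        nlinarith
  rcases key T with h | h
  · exact h
  · exfalso
    -- Being a product of positive integers, the potential cannot fall below 1, so `T` halvings are
    -- impossible.
    have h1 : (1 : ℝ) ≤ ∏ k ∈ Finset.range (M + 1), pivotProd (rowVec D (_root_.lll D M B T)) k := by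
      rw [← Finset.prod_const_one (s := Finset.range (M + 1))]
      refine Finset.prod_le_prod (fun _ _ => zero_le_one) fun k hk => ?_
      have := Finset.mem_range.mp hk
      exact (hB.lll hR hMR T).one_le_pivotProd (by omega)
    have : (0 : ℝ) < 2 ^ T := by positivity
    nlinarith

/-! ### The row lattice -/

/-- The last `M` columns of the rows express their first `n` columns in terms of the rows of `Y`. -/
def IsRelated (n M : ℕ) (Y B : ℕ → ℕ → ℤ) : Prop :=
  ∀ i < M, ∀ j < n, B i j = ∑ l ∈ Finset.range M, B i (n + l) * Y l j

variable {n : ℕ} {Y : ℕ → ℕ → ℤ}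

theorem IsRelated.rowOp (h : IsRelated n M Y B) {i j : ℕ} (hj : j < M) :
    IsRelated n M Y (rowOp D B i j) := by
  intro a ha c hc
  rcases eq_or_ne a i with rfl | hai
  · simp only [_root_.rowOp, if_true, sub_mul, Finset.sum_sub_distrib, h a ha c hc, h j hj c hc,
      Finset.mul_sum, mul_assoc]
  · simpa [_root_.rowOp, hai] using h a ha c hc

theorem IsRelated.reduceRow (h : IsRelated n M Y B) {i : ℕ} (hi : i < M) (t : ℕ) :
    IsRelated n M Y (reduceRow D B i t) := by
  induction t with
  | zero => exact h
  | succ t ih => exact ih.rowOp (by omega)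

theorem IsRelated.reduceRows (h : IsRelated n M Y B) {i : ℕ} (hi : i ≤ M) :
    IsRelated n M Y (reduceRows D B i) := by
  induction i with
  | zero => exact h
  | succ i ih => exact (ih (by omega)).reduceRow hi i

theorem IsRelated.swapStep (h : IsRelated n M Y B) : IsRelated n M Y (swapStep D M B) := by
  rw [_root_.swapStep]
  split_ifs with h0
  · exact h
  · obtain ⟨hlt, -⟩ := (lastGap_spec (D := D) (M := M) (B := B) M).2 h0
    intro a ha c hc
    refine h _ ?_ c hc
    rcases eq_or_ne a (lastGap D M B M - 1) with rfl | h3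
    · simpa using hlt
    · rcases eq_or_ne a (lastGap D M B M) with rfl | h4
      · simp; omega
      · rwa [Equiv.swap_apply_of_ne_of_ne h3 h4]

theorem IsRelated.lll (h : IsRelated n M Y B) (T : ℕ) : IsRelated n M Y (lll D M B T) := by
  induction T with
  | zero => exact h
  | succ T ih => exact (ih.reduceRows le_rfl).swapStep

end Reduction

/-! ### The initial basis -/

/-- The matrix `(Y | 1)`, where `Y` has `n` columns. -/
def initRows (n : ℕ) (Y : ℕ → ℕ → ℤ) (i l : ℕ) : ℤ :=
  (if l < n then Y i l else 0) + if l = i + n then 1 else 0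

section InitRows

variable {n M : ℕ} {Y : ℕ → ℕ → ℤ}

theorem inner_initRows {i j : ℕ} (hi : i < M) (_hj : j < M) :
    (inner ℝ (rowVec (n + M) (initRows n Y) i) (rowVec (n + M) (initRows n Y) j) : ℝ) =
      (∑ l ∈ Finset.range n, (Y i l : ℝ) * Y j l) + if i = j then 1 else 0 := by
  rw [← cast_gram, gram, Finset.sum_range_add]
  have h1 : ∑ l ∈ Finset.range n, initRows n Y i l * initRows n Y j l =
      ∑ l ∈ Finset.range n, Y i l * Y j l := Finset.sum_congr rfl fun l hl => by
    have hl := Finset.mem_range.mp hl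
    rw [initRows, initRows, if_pos hl, if_pos hl, if_neg (by omega), if_neg (by omega)]
    ring
  have h2 : ∑ l ∈ Finset.range M, initRows n Y i (n + l) * initRows n Y j (n + l) =
      ∑ l ∈ Finset.range M, if l = i then (if i = j then 1 else 0) else 0 :=
    Finset.sum_congr rfl fun l _ => by
      simp only [initRows, not_lt.mpr (Nat.le_add_right n l), if_false, zero_add]
      by_cases h : l = i
      · subst h
        simp [add_comm]
      · rw [if_neg (by omega), if_neg h, zero_mul]
  rw [h1, h2, Finset.sum_ite_eq' , if_pos (Finset.mem_range.mpr hi)]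
  push_cast
  rfl

theorem pivot_initRows_pos {k : ℕ} (hk : k < M) :
    0 < pivot (rowVec (n + M) (initRows n Y)) k := by
  -- The coordinates of the identity block separate the rows.
  let φ : ℕ → EuclideanSpace ℝ (Fin (n + M)) →ₗ[ℝ] ℝ := fun j =>
    if h : j < M then (EuclideanSpace.proj (⟨n + j, by omega⟩ : Fin (n + M)) :
      EuclideanSpace ℝ (Fin (n + M)) →L[ℝ] ℝ).toLinearMap else 0
  have hφ : ∀ j < M, ∀ i, φ j (rowVec (n + M) (initRows n Y) i) = if j = i then 1 else 0 := by
    intro j hj i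
    simp [φ, hj, rowVec, initRows, add_comm]
  refine pivot_pos_of_functionals _ φ (fun j hj i hi => ?_) (fun j hj => ?_) hk
  · rw [hφ j hj, if_neg (by omega)]
  · rw [hφ j hj, if_pos rfl]

theorem norm_sq_initRows_le {K : ℝ} {i : ℕ} (hi : i < M)
    (hY : ∀ l < n, |(Y i l : ℝ)| ≤ K) :
    ‖rowVec (n + M) (initRows n Y) i‖ ^ 2 ≤ 1 + n * K ^ 2 := by
  rw [← real_inner_self_eq_norm_sq, inner_initRows hi hi, if_pos rfl, add_comm]
  have : ∑ l ∈ Finset.range n, (Y i l : ℝ) * Y i l ≤ ∑ _l ∈ Finset.range n, K ^ 2 :=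
    Finset.sum_le_sum fun l hl => by
      rw [← sq, ← sq_abs]
      exact pow_le_pow_left₀ (abs_nonneg _) (hY l (Finset.mem_range.mp hl)) 2
  rw [Finset.sum_const, Finset.card_range, nsmul_eq_mul] at this
  linarith

/-- The determinants of `1 + Y Yᵀ` and `1 + Yᵀ Y` agree. -/
theorem pivotProd_initRows_transpose : pivotProd (rowVec (n + M) (initRows n Y)) M =
    pivotProd (rowVec (M + n) (initRows M fun i j => Y j i)) n := by
  rw [← det_gram_eq_pivotProd _ fun t ht => (pivot_initRows_pos ht).ne',
    ← det_gram_eq_pivotProd _ fun t ht => (pivot_initRows_pos ht).ne']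
  let A : Matrix (Fin M) (Fin n) ℝ := Matrix.of fun i j => (Y i j : ℝ)
  have h1 : (Matrix.of fun x y : Fin M => (inner ℝ (rowVec (n + M) (initRows n Y) x)
      (rowVec (n + M) (initRows n Y) y) : ℝ)) = 1 + A * A.transpose := by
    ext x y
    rw [Matrix.of_apply, inner_initRows x.isLt y.isLt, Matrix.add_apply, Matrix.mul_apply, add_comm,
      Finset.sum_range]
    simp [A, Matrix.one_apply, Fin.ext_iff]
  have h2 : (Matrix.of fun x y : Fin n => (inner ℝ
      (rowVec (M + n) (initRows M fun i j => Y j i) x)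
      (rowVec (M + n) (initRows M fun i j => Y j i) y) : ℝ)) = 1 + A.transpose * A := by
    ext x y
    rw [Matrix.of_apply, inner_initRows x.isLt y.isLt, Matrix.add_apply, Matrix.mul_apply, add_comm,
      Finset.sum_range]
    simp [A, Matrix.one_apply, Fin.ext_iff]
  rw [h1, h2, Matrix.det_one_add_mul_comm]

/-- Passing to the transpose before applying Hadamard's bound gives the exponent `n`, the number of
columns, in place of `M`, the number of rows. This gain is what makes the first reduced row short.
-/
theorem pivotProd_initRows_le {K : ℝ} (hY : ∀ i < M, ∀ l < n, |(Y i l : ℝ)| ≤ K) :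
    pivotProd (rowVec (n + M) (initRows n Y)) M ≤ (1 + M * K ^ 2) ^ n := by
  rw [pivotProd_initRows_transpose]
  refine (pivotProd_le_prod _ n).trans ?_
  calc _ ≤ ∏ _l ∈ Finset.range n, (1 + (M : ℝ) * K ^ 2) :=
        Finset.prod_le_prod (fun _ _ => by positivity) fun l hl =>
          norm_sq_initRows_le (Finset.mem_range.mp hl) fun i hi =>
            hY i hi l (Finset.mem_range.mp hl)
    _ = _ := by simp

theorem isRelated_initRows : IsRelated n M Y (initRows n Y) := by
  intro i hi j hj
  have : ∀ l ∈ Finset.range M, initRows n Y i (n + l) * Y l j = if l = i then Y i j else 0 := by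
    intro l _
    simp only [initRows, not_lt.mpr (Nat.le_add_right n l), if_false, zero_add]
    by_cases h : l = i
    · subst h
      simp [add_comm]
    · rw [if_neg (by omega), if_neg h, zero_mul]
  rw [Finset.sum_congr rfl this, Finset.sum_ite_eq', if_pos (Finset.mem_range.mpr hi), initRows,
    if_pos hj, if_neg (by omega), add_zero]

end InitRows

/-! ### Choice of the parameters -/

/-- The number of iterations in dimension `n`. -/
def iterations (n : ℕ) : ℕ := 300 * (n + 1) ^ 3

/-- The reduced basis computed from `2 n` vectors in dimension `n`. -/
def reducedBasis (n : ℕ) (Y : ℕ → ℕ → ℤ) : ℕ → ℕ → ℤ :=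
  lll (n + 2 * n) (2 * n) (initRows n Y) (iterations n)

/-- The coefficients of the linear combination found by the reduction algorithm. -/
def shortRelation (n : ℕ) (Y : ℕ → ℕ → ℤ) (l : ℕ) : ℤ := reducedBasis n Y 0 (n + l)

section Parameters

variable {n : ℕ} {Y : ℕ → ℕ → ℤ}

theorem one_add_mul_le (n : ℕ) {c : ℕ} (hc : c ≤ 2 * n) :
    1 + (c : ℝ) * (2 ^ (21 * n)) ^ 2 ≤ 2 ^ (44 * n) := by
  have h1 : 1 + 2 * n ≤ 4 ^ n := by
    have := one_add_mul_le_pow (a := (3 : ℤ)) (by norm_num) n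
    zify
    norm_num at this
    linarith
  have h2 : (1 + (c : ℝ)) ≤ 4 ^ n := by exact_mod_cast (by omega : 1 + c ≤ 4 ^ n)
  have h3 : (2 : ℝ) ^ (44 * n) = 4 ^ n * (2 ^ (21 * n)) ^ 2 := by
    rw [← pow_mul, show (4 : ℝ) = 2 ^ 2 by norm_num, ← pow_mul, ← pow_add]
    congr 1
    ring
  have h4 : (1 : ℝ) ≤ (2 ^ (21 * n)) ^ 2 := one_le_pow₀ (one_le_pow₀ (by norm_num))
  rw [h3]
  nlinarith

/-- Squared row norms are at most `2 ^ (44 n)`, so determinants of size at most `2 n` are below `2 ^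
(88 n ^ 2)`. The norm bound is far from tight here; it is chosen so that `mul_le_sq_bound` holds. -/
theorem isBoundedBasis_initRows (hY : ∀ i < 2 * n, ∀ l < n, |(Y i l : ℝ)| ≤ 2 ^ (21 * n)) :
    IsBoundedBasis (n + 2 * n) (2 * n) (2 ^ (88 * n ^ 2)) (2 ^ (n + 88 * n ^ 2))
      (initRows n Y) := by
  have hnorm : ∀ i < 2 * n, ‖rowVec (n + 2 * n) (initRows n Y) i‖ ^ 2 ≤ 2 ^ (44 * n) :=
    fun i hi => (norm_sq_initRows_le hi (hY i hi)).trans (one_add_mul_le n (by omega))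
  refine ⟨fun k hk => pivot_initRows_pos hk, fun k hk => ?_, fun i hi => ?_⟩
  · refine (pivotProd_le_prod _ k).trans ?_
    calc _ ≤ ∏ _l ∈ Finset.range k, (2 : ℝ) ^ (44 * n) :=
          Finset.prod_le_prod (fun _ _ => by positivity) fun l hl =>
            hnorm l (by have := Finset.mem_range.mp hl; omega)
      _ = 2 ^ (44 * n * k) := by rw [Finset.prod_const, Finset.card_range, ← pow_mul]
      _ ≤ 2 ^ (88 * n ^ 2) := pow_le_pow_right₀ (by norm_num) (by nlinarith)
  · refine (sq_le_sq₀ (norm_nonneg _) (by positivity)).mp ((hnorm i hi).trans ?_)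
    rw [← pow_mul]
    exact pow_le_pow_right₀ (by norm_num) (by nlinarith)

theorem mul_le_sq_bound (n : ℕ) :
    ((2 * n : ℕ) : ℝ) * 2 ^ (88 * n ^ 2) ≤ (2 ^ (n + 88 * n ^ 2)) ^ 2 := by
  have h1 : 2 * n ≤ 2 ^ (2 * n) := Nat.lt_two_pow_self.le
  have h2 : ((2 * n : ℕ) : ℝ) ≤ 2 ^ (2 * n) := by exact_mod_cast h1
  calc ((2 * n : ℕ) : ℝ) * 2 ^ (88 * n ^ 2) ≤ 2 ^ (2 * n) * 2 ^ (88 * n ^ 2) := by gcongr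
    _ ≤ 2 ^ (2 * n) * 2 ^ (2 * (88 * n ^ 2)) :=
        mul_le_mul_of_nonneg_left (pow_le_pow_right₀ (by norm_num) (by omega)) (by positivity)
    _ = _ := by rw [← pow_add, ← pow_mul]; congr 1; ring

/-- A bound for the bit length of the entries of all bases that occur in the computation. -/
def entryBits (n : ℕ) : ℕ := 1000 * (n + 1) ^ 3

/-- The size of a row in the middle of its size reduction, with the parameters inserted. -/
theorem growth_bound (n : ℕ) : (2 : ℝ) ^ (n + 88 * n ^ 2) * (1 + 2 ^ (n + 88 * n ^ 2) +
    2 ^ (n + 88 * n ^ 2) * 2 ^ (n + 88 * n ^ 2) * 2 ^ (88 * n ^ 2)) ^ (2 * n) ≤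
    2 ^ entryBits n := by
  have h1 : (1 : ℝ) + 2 ^ (n + 88 * n ^ 2) +
      2 ^ (n + 88 * n ^ 2) * 2 ^ (n + 88 * n ^ 2) * 2 ^ (88 * n ^ 2) ≤
      2 ^ (2 + 2 * n + 264 * n ^ 2) := by
    rw [← pow_add, ← pow_add]
    have e : n + 88 * n ^ 2 + (n + 88 * n ^ 2) + 88 * n ^ 2 = 2 * n + 264 * n ^ 2 := by ring
    have h2 : (1 : ℝ) ≤ 2 ^ (2 * n + 264 * n ^ 2) := one_le_pow₀ (by norm_num)
    have h3 : (2 : ℝ) ^ (n + 88 * n ^ 2) ≤ 2 ^ (2 * n + 264 * n ^ 2) :=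
      pow_le_pow_right₀ (by norm_num) (by omega)
    rw [e, show 2 + 2 * n + 264 * n ^ 2 = 2 + (2 * n + 264 * n ^ 2) by ring, pow_add 2 2]
    linarith
  calc _ ≤ (2 : ℝ) ^ (n + 88 * n ^ 2) * (2 ^ (2 + 2 * n + 264 * n ^ 2)) ^ (2 * n) := by gcongr
    _ = 2 ^ (n + 88 * n ^ 2 + (2 + 2 * n + 264 * n ^ 2) * (2 * n)) := by
        rw [← pow_mul, ← pow_add]
    _ ≤ _ := by
        refine pow_le_pow_right₀ (by norm_num) ?_
        rw [entryBits]
        ring_nf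
        nlinarith [sq_nonneg (n : ℤ)]

theorem isBoundedBasis_lll_initRows
    (hY : ∀ i < 2 * n, ∀ l < n, |(Y i l : ℝ)| ≤ 2 ^ (21 * n)) (T : ℕ) :
    IsBoundedBasis (n + 2 * n) (2 * n) (2 ^ (88 * n ^ 2)) (2 ^ (n + 88 * n ^ 2))
      (lll (n + 2 * n) (2 * n) (initRows n Y) T) :=
  (isBoundedBasis_initRows hY).lll (one_le_pow₀ (by norm_num)) (mul_le_sq_bound n) T

/-- The `2 n`-th power of the first pivot is at most `4 ^ (4 n ^ 2)`, the loss from reduction, times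
the determinant `2 ^ (44 n ^ 2)`, together `2 ^ (52 n ^ 2)`. -/
theorem pivot_reducedBasis_le (hn : 1 ≤ n)
    (hY : ∀ i < 2 * n, ∀ l < n, |(Y i l : ℝ)| ≤ 2 ^ (21 * n)) :
    pivot (rowVec (n + 2 * n) (reducedBasis n Y)) 0 ≤ 2 ^ (26 * n) := by
  have hB := isBoundedBasis_initRows hY
  have hR : (1 : ℝ) ≤ 2 ^ (n + 88 * n ^ 2) := one_le_pow₀ (by norm_num)
  -- Termination needs more than `88 n ^ 2 * (2 n + 1)` iterations, and `300 (n + 1) ^ 3` exceeds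
  -- this.
  have hgf := isGapFree_lll hB hR (mul_le_sq_bound n) (T := iterations n) (by
    rw [← pow_mul]
    refine pow_lt_pow_right₀ (by norm_num) ?_
    rw [iterations]
    ring_nf
    nlinarith)
  have h1 := pivot_zero_pow_le _ hgf
  rw [pivotProd_lll hB hR (mul_le_sq_bound n)] at h1
  have h2 := (pivotProd_initRows_le hY).trans
    (pow_le_pow_left₀ (by positivity) (one_add_mul_le n le_rfl) n)
  refine le_of_pow_le_pow_left₀ (n := 2 * n) (by omega) (by positivity) (h1.trans ?_)
  calc _ ≤ ((4 : ℝ) ^ (2 * n)) ^ (2 * n) * (2 ^ (44 * n)) ^ n := by gcongr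
    _ = _ := by
      rw [show (4 : ℝ) = 2 ^ 2 by norm_num]
      simp only [← pow_mul, ← pow_add]
      congr 1
      ring

theorem norm_reducedBasis_le (hn : 1 ≤ n)
    (hY : ∀ i < 2 * n, ∀ l < n, |(Y i l : ℝ)| ≤ 2 ^ (21 * n)) :
    ‖rowVec (n + 2 * n) (reducedBasis n Y) 0‖ ≤ 2 ^ (13 * n) := by
  have h := pivot_reducedBasis_le hn hY
  rw [pivot, projInner_self] at h
  refine (sq_le_sq₀ (norm_nonneg _) (by positivity)).mp (h.trans_eq ?_)
  rw [← pow_mul]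
  congr 1
  ring

theorem abs_shortRelation_le (hn : 1 ≤ n)
    (hY : ∀ i < 2 * n, ∀ l < n, |(Y i l : ℝ)| ≤ 2 ^ (21 * n)) {l : ℕ} (hl : l < 2 * n) :
    |(shortRelation n Y l : ℝ)| ≤ 2 ^ (13 * n) :=
  (abs_entry_le (D := n + 2 * n) 0 (n + l) (by omega)).trans (norm_reducedBasis_le hn hY)

theorem isRelated_reducedBasis : IsRelated n (2 * n) Y (reducedBasis n Y) :=
  isRelated_initRows.lll _

theorem abs_sum_shortRelation_mul_le (hn : 1 ≤ n)
    (hY : ∀ i < 2 * n, ∀ l < n, |(Y i l : ℝ)| ≤ 2 ^ (21 * n)) {j : ℕ} (hj : j < n) :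
    |((∑ l ∈ Finset.range (2 * n), shortRelation n Y l * Y l j : ℤ) : ℝ)| ≤ 2 ^ (13 * n) := by
  have := isRelated_reducedBasis (Y := Y) 0 (by omega : 0 < 2 * n) j hj
  simp only [shortRelation]
  rw [← this]
  exact (abs_entry_le (D := n + 2 * n) 0 j (by omega)).trans (norm_reducedBasis_le hn hY)

/-- If all coefficients vanished, `IsRelated` would make the whole first row zero, although its
pivot is positive. -/
theorem exists_shortRelation_ne_zero (hn : 1 ≤ n)
    (hY : ∀ i < 2 * n, ∀ l < n, |(Y i l : ℝ)| ≤ 2 ^ (21 * n)) :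
    ∃ l < 2 * n, shortRelation n Y l ≠ 0 := by
  by_contra! h
  have h1 := (isBoundedBasis_lll_initRows hY (iterations n)).pivot_pos 0 (by omega)
  rw [pivot, projInner_self] at h1
  have h2 : rowVec (n + 2 * n) (reducedBasis n Y) 0 = 0 := by
    ext l
    simp only [rowVec, PiLp.zero_apply, Int.cast_eq_zero]
    rcases Nat.lt_or_ge l n with hl | hl
    · rw [isRelated_reducedBasis 0 (by omega : 0 < 2 * n) l hl]
      refine Finset.sum_eq_zero fun t ht => ?_
      have := h t (Finset.mem_range.mp ht)
      rw [shortRelation] at this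
      rw [this, zero_mul]
    · obtain ⟨t, ht⟩ := Nat.exists_eq_add_of_le hl
      rw [ht]
      exact h t (by have := l.isLt; omega)
  have h3 : projPerp (rowVec (n + 2 * n) (reducedBasis n Y)) 0 0 = 0 := h2
  rw [reducedBasis] at h3
  simp [h3] at h1

end Parameters

/-! ## The program -/

/-- The context in dimension `n`. -/
def ramContext (n : ℕ) (O : DigitOracle) (hO : O.IsBinary) : RamContext where
  oracle := O
  s := 10000 * (n + 1) ^ 3
  N := 1000 * (n + 1) ^ 3
  one_le_s := Nat.mul_pos (by norm_num) (by positivity)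
  N_le := by
    have : 1000 * (n + 1) ^ 3 ≤ 2 ^ (10000 * (n + 1) ^ 3) :=
      (Nat.lt_two_pow_self (n := 1000 * (n + 1) ^ 3)).le.trans
        (Nat.pow_le_pow_right (by norm_num) (Nat.mul_le_mul_right _ (by norm_num)))
    exact_mod_cast this
  isBinary := hO

/-- The global variables: the dimension, the number of samples, the number of columns, the number
of digits to be read, the modulus and the number of iterations. -/
structure HasGlobals (n : ℕ) (m : Memory) : Prop where
  dim : m.scalar 0 = n
  samples : m.scalar 1 = (2 * n : ℕ)
  columns : m.scalar 2 = (n + 2 * n : ℕ)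
  digits : m.scalar 3 = (21 * n : ℕ)
  modulus : m.scalar 4 = 2 ^ (20 * n)
  iterations : m.scalar 5 = (iterations n : ℕ)

theorem HasGlobals.agree {n c : ℕ} {m m' : Memory} (h : HasGlobals n m) (hc : 6 ≤ c)
    (ha : m.Agree c m') : HasGlobals n m' := by
  constructor <;> rw [ha _ (by omega)]
  exacts [h.1, h.2, h.3, h.4, h.5, h.6]

/-- The array `0` holds the rows of `B`. -/
def HasRows (n : ℕ) (B : ℕ → ℕ → ℤ) (m : Memory) : Prop :=
  ∀ i < 2 * n, ∀ l < n + 2 * n, m.array 0 i l = B i l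

/-- The array `1` holds the minors that determine the Gram–Schmidt orthogonalization of `B`. -/
def HasMinors (n : ℕ) (B : ℕ → ℕ → ℤ) (m : Memory) : Prop :=
  m.array 1 0 0 = 1 ∧ ∀ i < 2 * n, ∀ j < 2 * n,
    m.array 1 (i + 1) (j + 1) = gramMinor (n + 2 * n) B (min i j) i j

/-- Storing the minors with both indices shifted by one puts the leading determinants on the
diagonal, including the empty one at `(0, 0)`, so the divisor in the elimination is read in the same
way at every stage. -/
theorem HasMinors.gramDet {n : ℕ} {B : ℕ → ℕ → ℤ} {m : Memory} (h : HasMinors n B m) {k : ℕ}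
    (hk : k ≤ 2 * n) : m.array 1 k k = gramDet (n + 2 * n) B k := by
  cases k with
  | zero => exact h.1
  | succ k => rw [h.2 k (by omega) k (by omega), min_self]; rfl

/-- The entries that occur in the computation are bounded. -/
abbrev IsFeasible (n : ℕ) (B : ℕ → ℕ → ℤ) : Prop :=
  IsBoundedBasis (n + 2 * n) (2 * n) (2 ^ (88 * n ^ 2)) (2 ^ entryBits n) B

/-! ### Fitting the computed values into the cells -/

section Bounds

variable {n : ℕ} {O : DigitOracle} {hO : O.IsBinary} {B : ℕ → ℕ → ℤ}

theorem abs_le_of_cast {x : ℤ} {k : ℕ} (h : |(x : ℝ)| ≤ 2 ^ k)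
    (hk : k ≤ 10000 * (n + 1) ^ 3) : |x| ≤ 2 ^ (ramContext n O hO).s := by
  have h1 : |x| ≤ 2 ^ k := by exact_mod_cast h
  exact h1.trans (pow_le_pow_right₀ (by norm_num) hk)

theorem le_loopBound {k : ℕ} (hk : k ≤ 300 * (n + 1)) : k ≤ (ramContext n O hO).N := by
  refine hk.trans ?_
  simp only [ramContext]
  have : n + 1 ≤ (n + 1) ^ 3 := Nat.le_self_pow (by norm_num) _
  omega

theorem sq_le_cube (n : ℕ) : n ^ 2 ≤ (n + 1) ^ 3 ∧ n ≤ (n + 1) ^ 3 ∧ 1 ≤ (n + 1) ^ 3 := by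
  have : n ^ 2 ≤ (n + 1) ^ 3 :=
    (Nat.pow_le_pow_left (Nat.le_succ n) 2).trans (Nat.pow_le_pow_right (by omega) (by norm_num))
  have h2 : n + 1 ≤ (n + 1) ^ 3 := Nat.le_self_pow (by norm_num) _
  omega

theorem natCast_le_two_pow (n : ℕ) : ((n + 2 * n : ℕ) : ℝ) ≤ 2 ^ (n + 2 * n) := by
  exact_mod_cast (Nat.lt_two_pow_self (n := n + 2 * n)).le

namespace IsFeasible

theorem gramMinor_le (h : IsFeasible n B) {k i j : ℕ} (hk : k ≤ 2 * n) (hi : i < 2 * n)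
    (hj : j < 2 * n) : |gramMinor (n + 2 * n) B k i j| ≤ 2 ^ (ramContext n O hO).s := by
  refine abs_le_of_cast (k := 88 * n ^ 2 + (entryBits n + entryBits n)) ?_ ?_
  · rw [pow_add, pow_add]
    exact h.abs_gramMinor_le hk hi hj
  · have := sq_le_cube n
    rw [entryBits]
    omega

theorem entry_le (h : IsFeasible n B) {i l : ℕ} (hi : i < 2 * n) (hl : l < n + 2 * n) :
    |B i l| ≤ 2 ^ (ramContext n O hO).s :=
  abs_le_of_cast (h.abs_entry_le hi hl) (by rw [entryBits]; omega)

theorem partial_gram_le (h : IsFeasible n B) {i j t : ℕ} (hi : i < 2 * n) (hj : j < 2 * n)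
    (ht : t ≤ n + 2 * n) :
    |∑ l ∈ Finset.range t, B i l * B j l| ≤ 2 ^ (ramContext n O hO).s := by
  refine abs_le_of_cast (k := (n + 2 * n) + (entryBits n + entryBits n)) ?_ ?_
  · push_cast
    refine (Finset.abs_sum_le_sum_abs _ _).trans ?_
    have h1 : ∑ l ∈ Finset.range t, |(B i l : ℝ) * B j l| ≤
        ∑ _l ∈ Finset.range t, (2 : ℝ) ^ (entryBits n + entryBits n) :=
      Finset.sum_le_sum fun l hl => by
        have hl := Finset.mem_range.mp hl
        rw [abs_mul, pow_add]
        exact mul_le_mul (h.abs_entry_le hi (by omega)) (h.abs_entry_le hj (by omega))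
          (abs_nonneg _) (by positivity)
    rw [Finset.sum_const, Finset.card_range, nsmul_eq_mul] at h1
    refine h1.trans ?_
    rw [pow_add 2 (n + 2 * n)]
    refine mul_le_mul_of_nonneg_right (le_trans ?_ (natCast_le_two_pow n)) (by positivity)
    exact_mod_cast ht
  · have := sq_le_cube n
    rw [entryBits]
    omega

theorem nearestCoeff_le (h : IsFeasible n B) {i j : ℕ} (hi : i < 2 * n) (hj : j < 2 * n) :
    |nearestCoeff (n + 2 * n) B i j| ≤ 2 ^ (ramContext n O hO).s := by
  refine abs_le_of_cast (k := entryBits n + entryBits n + 88 * n ^ 2 + 1) ?_ ?_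
  · refine (h.abs_nearestCoeff_le hj hi (h.norm_le j hj)).trans ?_
    rw [← pow_add, ← pow_add, pow_succ (2 : ℝ)]
    have : (1 : ℝ) ≤ 2 ^ (entryBits n + entryBits n + 88 * n ^ 2) := one_le_pow₀ (by norm_num)
    linarith
  · have := sq_le_cube n
    rw [entryBits]
    omega

end IsFeasible

end Bounds

/-! ### Programs for the Gram matrix and its elimination -/

open RamExpr RamProgram

/-- Computation of the Gram matrix of the rows. -/
def gramProgram : RamProgram :=
  forLoop 20 (var 1) <| forLoop 21 (var 1) <|
    .seq (setVar 23 (.const 0)) <|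
    .seq (forLoop 22 (var 2) <| setVar 23 (.add (var 23)
      (.mul (entry 0 (var 20) (var 22)) (entry 0 (var 21) (var 22))))) <|
    setEntry 1 (.add (var 20) (.const 1)) (.add (var 21) (.const 1)) (var 23)

/-- An elimination step. -/
def eliminationStep : RamProgram :=
  forLoop 20 (var 1) <| forLoop 21 (var 1) <|
    .ite (.mul (.lt (var 24) (var 20)) (.lt (var 24) (var 21)))
      (setEntry 1 (.add (var 20) (.const 1)) (.add (var 21) (.const 1))
        (.div (.sub
          (.mul (entry 1 (.add (var 24) (.const 1)) (.add (var 24) (.const 1)))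
            (entry 1 (.add (var 20) (.const 1)) (.add (var 21) (.const 1))))
          (.mul (entry 1 (.add (var 20) (.const 1)) (.add (var 24) (.const 1)))
            (entry 1 (.add (var 24) (.const 1)) (.add (var 21) (.const 1)))))
          (entry 1 (var 24) (var 24))))
      .skip

/-- Gram–Schmidt orthogonalization. -/
def gramSchmidtProgram : RamProgram :=
  .seq gramProgram <| .seq (setEntry 1 (.const 0) (.const 0) (.const 1)) <|
    forLoop 24 (var 1) eliminationStep

section

variable {n : ℕ} {O : DigitOracle} {hO : O.IsBinary} {B : ℕ → ℕ → ℤ} {m : Memory}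

theorem gramProgram_spec (hg : HasGlobals n m) (hr : HasRows n B m) (hB : IsFeasible n B) :
    WP (ramContext n O hO) gramProgram (fun m' => m.Agree 20 m' ∧ m'.array 0 = m.array 0 ∧
      m'.array 2 = m.array 2 ∧ ∀ i < 2 * n, ∀ j < 2 * n,
        m'.array 1 (i + 1) (j + 1) = gram (n + 2 * n) B i j) m := by
  refine WP.forLoop₂ (by norm_num) (2 * n) (fun _ => 2 * n) (fun i j m' => m.Agree 20 m' ∧
    m'.array 0 = m.array 0 ∧ m'.array 2 = m.array 2 ∧ ∀ a b, b < 2 * n → (a < i ∨ a = i ∧ b < j) →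
        m'.array 1 (a + 1) (b + 1) = gram (n + 2 * n) B a b)
    (le_loopBound (by omega)) (fun _ _ => le_loopBound (by omega)) ?_ ?_ ?_ ?_ ?_ ?_ ?_ ?_
  · rintro i j m' x ⟨h1, h2⟩
    exact ⟨h1.setScalar (by norm_num) x, by simpa using h2⟩
  · rintro i j m' x ⟨h1, h2⟩
    exact ⟨h1.setScalar (by norm_num) x, by simpa using h2⟩
  · rintro i j m' ⟨h1, -⟩
    exact ⟨by simp, (hg.agree (by norm_num) h1).samples⟩
  · rintro i - j m' - ⟨h1, -⟩
    exact ⟨by simp, (hg.agree (by norm_num) h1).samples⟩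
  · exact ⟨.refl _ _, rfl, rfl, fun a b hb h => by omega⟩
  · rintro i hi m' ⟨h1, h2, h3, h4⟩
    exact ⟨h1, h2, h3, fun a b hb h => h4 a b hb (by omega)⟩
  · rintro i hi j hj m' hvi hvj ⟨h1, h2, h3, h4⟩
    refine .seq (.setVar (by simp) (by simp) (.seq ?_))
    refine WP.forLoop (n + 2 * n) (le_loopBound (by omega)) (fun t m' => m'.scalar 20 = i ∧
      m'.scalar 21 = j ∧ m.Agree 20 m' ∧
      m'.array 0 = m.array 0 ∧ m'.array 2 = m.array 2 ∧ (∀ a b, b < 2 * n →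
        (a < i ∨ a = i ∧ b < j) → m'.array 1 (a + 1) (b + 1) = gram (n + 2 * n) B a b) ∧
      m'.scalar 23 = ∑ l ∈ Finset.range t, B i l * B j l) ?_ ?_ ?_ ?_
    · rintro t m' ⟨-, -, h, -⟩
      exact ⟨by simp, (hg.agree (by norm_num) h).columns⟩
    · exact ⟨by simp [hvi], by simp [hvj], (h1.setScalar (by norm_num) _).setScalar (by norm_num) _,
        by simpa using h2, by simpa using h3, by simpa using h4, by simp⟩
    · rintro t ht m' hvt ⟨g1, g2, g3, g4, g5, g6, g7⟩
      have heval : (add (var 23) (mul (entry 0 (var 20) (var 22))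
          (entry 0 (var 21) (var 22)))).eval (ramContext n O hO).oracle m' =
           ∑ l ∈ Finset.range (t + 1), B i l * B j l := by
        rw [Finset.sum_range_succ, eval_add, eval_mul, eval_var, g7,
          eval_entry (i' := i) (j' := t) (by simp [g1]) (by simp [hvt]),
          eval_entry (i' := j) (j' := t) (by simp [g2]) (by simp [hvt]), g4,
          hr i hi t ht, hr j hj t ht]
      refine .setVar (by simp) ?_ ?_
      · rw [heval]
        exact hB.partial_gram_le (O := O) (hO := hO) hi hj ht
      · rw [heval]
        exact ⟨by simp [hvt], by simp [g1], by simp [g2],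
          (g3.setScalar (by norm_num) _).setScalar (by norm_num) _,
          by simpa using g4, by simpa using g5, by simpa using g6, by simp⟩
    · rintro m' ⟨g1, g2, g3, g4, g5, g6, g7⟩
      refine .setEntry (i' := i + 1) (j' := j + 1) (by simp [g1]) (by simp [g2]) (by simp) (by simp)
        (by simp) ?_ ?_
      · rw [eval_var, g7]
        exact hB.partial_gram_le hi hj le_rfl
      · rw [eval_var, g7]
        refine ⟨by simp [g1], by simp [g2], g3.setArray _ _ _ _, ?_, ?_, ?_⟩
        · rw [Memory.array_setArray_of_ne _ _ _ _ (by norm_num) (by norm_num) (by norm_num), g4]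
        · rw [Memory.array_setArray_of_ne _ _ _ _ (by norm_num) (by norm_num) (by norm_num), g5]
        · intro a b hb hab
          rw [Memory.array_setArray_self _ _ _ _ (by norm_num)]
          split_ifs with h
          · obtain ⟨rfl, rfl⟩ : a = i ∧ b = j := by omega
            rfl
          · exact g6 a b hb (by omega)
  · rintro m' ⟨h1, h2, h3, h4⟩
    exact ⟨h1, h2, h3, fun i hi j hj => h4 i j hj (by omega)⟩

/-- An entry is final once the stage reaches the smaller of its indices, hence the minor of size
parameter `min k (min i j)`. Stage `k` rewrites only entries with both indices above `k`, so the
pivot row, the pivot column and the divisor can be read during the update in place. -/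
theorem eliminationStep_spec (hg : HasGlobals n m) (hB : IsFeasible n B) {k : ℕ} (hk : k < 2 * n)
    (hvk : m.scalar 24 = k) (h00 : m.array 1 0 0 = 1) (hm : ∀ i < 2 * n, ∀ j < 2 * n,
      m.array 1 (i + 1) (j + 1) = gramMinor (n + 2 * n) B (min k (min i j)) i j) :
    WP (ramContext n O hO) eliminationStep (fun m' => m.Agree 20 m' ∧ m'.scalar 24 = k ∧
      m'.array 0 = m.array 0 ∧ m'.array 2 = m.array 2 ∧ m'.array 1 0 0 = 1 ∧
      ∀ i < 2 * n, ∀ j < 2 * n, m'.array 1 (i + 1) (j + 1) =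
        gramMinor (n + 2 * n) B (min (k + 1) (min i j)) i j) m := by
  refine WP.forLoop₂ (by norm_num) (2 * n) (fun _ => 2 * n) (fun i j m' => m.Agree 20 m' ∧
    m'.scalar 24 = k ∧ m'.array 0 = m.array 0 ∧ m'.array 2 = m.array 2 ∧ m'.array 1 0 0 = 1 ∧
    ∀ a < 2 * n, ∀ b < 2 * n, m'.array 1 (a + 1) (b + 1) = gramMinor (n + 2 * n) B
      (min (if a < i ∨ a = i ∧ b < j then k + 1 else k) (min a b)) a b)
    (le_loopBound (by omega)) (fun _ _ => le_loopBound (by omega)) ?_ ?_ ?_ ?_ ?_ ?_ ?_ ?_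
  · rintro i j m' x ⟨h1, h2⟩
    exact ⟨h1.setScalar (by norm_num) x, by simpa using h2⟩
  · rintro i j m' x ⟨h1, h2⟩
    exact ⟨h1.setScalar (by norm_num) x, by simpa using h2⟩
  · rintro i j m' ⟨h1, -⟩
    exact ⟨by simp, (hg.agree (by norm_num) h1).samples⟩
  · rintro i - j m' - ⟨h1, -⟩
    exact ⟨by simp, (hg.agree (by norm_num) h1).samples⟩
  · refine ⟨.refl _ _, hvk, rfl, rfl, h00, fun a ha b hb => ?_⟩
    rw [if_neg (by omega)]
    exact hm a ha b hb
  · rintro i hi m' ⟨h1, h2, h3, h4, h5, h6⟩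
    refine ⟨h1, h2, h3, h4, h5, fun a ha b hb => ?_⟩
    rw [h6 a ha b hb]
    congr 2
    exact if_congr (by omega) rfl rfl
  · rintro i hi j hj m' hvi hvj ⟨h1, h2, h3, h4, h5, h6⟩
    have hskip : ¬ (k < i ∧ k < j) → ∀ a < 2 * n, ∀ b < 2 * n,
        m'.array 1 (a + 1) (b + 1) = gramMinor (n + 2 * n) B
          (min (if a < i ∨ a = i ∧ b < j + 1 then k + 1 else k) (min a b)) a b := by
      intro hkij a ha b hb
      rw [h6 a ha b hb]
      congr 1
      split_ifs <;> omega
    refine .ite (by simp) (fun hne => ?_) (fun he => .skip ?_)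
    · have hkij : k < i ∧ k < j := by
        by_contra h
        refine hne ?_
        simp only [eval_mul, eval_lt, eval_var, h2, hvi, hvj, Nat.cast_lt]
        rcases not_and_or.mp h with h | h <;> simp [h]
      have hpos : ∀ t ≤ k, 0 < pivot (rowVec (n + 2 * n) B) t := fun t ht =>
        hB.pivot_pos t (by omega)
      -- Entries in row or column `k` have the same value before and after this pass, so their
      -- position relative to the progress of the loops does not matter.
      have hmin : ∀ a < 2 * n, ∀ b < 2 * n, min a b = k →
          m'.array 1 (a + 1) (b + 1) = gramMinor (n + 2 * n) B k a b := by
        intro a ha b hb hab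
        rw [h6 a ha b hb, hab]
        congr 1
        split_ifs <;> omega
      have hprev : m'.array 1 k k = gramDet (n + 2 * n) B k := by
        cases k with
        | zero => exact h5
        | succ k =>
          rw [h6 k (by omega) k (by omega), gramDet, min_self]
          congr 1
          split_ifs <;> omega
      have hij : m'.array 1 (i + 1) (j + 1) = gramMinor (n + 2 * n) B k i j := by
        rw [h6 i hi j hj, if_neg (by omega)]
        congr 1
        omega
      have heval : (RamExpr.div (.sub
          (.mul (entry 1 (.add (var 24) (.const 1)) (.add (var 24) (.const 1)))
            (entry 1 (.add (var 20) (.const 1)) (.add (var 21) (.const 1))))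
          (.mul (entry 1 (.add (var 20) (.const 1)) (.add (var 24) (.const 1)))
            (entry 1 (.add (var 24) (.const 1)) (.add (var 21) (.const 1)))))
          (entry 1 (var 24) (var 24))).eval (ramContext n O hO).oracle m' =
          gramMinor (n + 2 * n) B (k + 1) i j := by
        rw [eval_div, eval_sub, eval_mul, eval_mul,
          eval_entry (i' := k + 1) (j' := k + 1) (by simp [h2]) (by simp [h2]),
          eval_entry (i' := i + 1) (j' := j + 1) (by simp [hvi]) (by simp [hvj]),
          eval_entry (i' := i + 1) (j' := k + 1) (by simp [hvi]) (by simp [h2]),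
          eval_entry (i' := k + 1) (j' := j + 1) (by simp [h2]) (by simp [hvj]),
          eval_entry (i' := k) (j' := k) (by simp [h2]) (by simp [h2]),
          hmin k hk k hk (min_self k), hij, hmin i hi k hk (by omega), hmin k hk j hj (by omega),
          hprev, gramMinor_succ hpos]
      refine .setEntry (i' := i + 1) (j' := j + 1) (by simp [hvi]) (by simp [hvj]) (by simp)
        (by simp) (by simp) ?_ ?_
      · rw [heval]
        exact hB.gramMinor_le (by omega) hi hj
      · rw [heval]
        refine ⟨by simp [hvi], by simp [hvj], h1.setArray _ _ _ _, by simp [h2], ?_, ?_, ?_, ?_⟩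
        · rw [Memory.array_setArray_of_ne _ _ _ _ (by norm_num) (by norm_num) (by norm_num), h3]
        · rw [Memory.array_setArray_of_ne _ _ _ _ (by norm_num) (by norm_num) (by norm_num), h4]
        · rw [Memory.array_setArray_self _ _ _ _ (by norm_num), if_neg (by omega), h5]
        · intro a ha b hb
          rw [Memory.array_setArray_self _ _ _ _ (by norm_num)]
          by_cases hab : a = i ∧ b = j
          · obtain ⟨rfl, rfl⟩ := hab
            rw [if_pos ⟨rfl, rfl⟩, if_pos (by omega)]
            congr 1
            omega
          · rw [if_neg (by omega), h6 a ha b hb]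
            congr 2
            exact if_congr (by omega) rfl rfl
    · refine ⟨hvi, hvj, h1, h2, h3, h4, h5, hskip fun h => ?_⟩
      simp [h2, hvi, hvj, h.1, h.2] at he
  · rintro m' ⟨h1, h2, h3, h4, h5, h6⟩
    refine ⟨h1, h2, h3, h4, h5, fun i hi j hj => ?_⟩
    rw [h6 i hi j hj, if_pos (Or.inl hi)]

theorem gramMinor_zero (D i j : ℕ) : gramMinor D B 0 i j = gram D B i j := by
  simp [gramMinor]

theorem gramSchmidtProgram_spec (hg : HasGlobals n m) (hr : HasRows n B m) (hB : IsFeasible n B) :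
    WP (ramContext n O hO) gramSchmidtProgram (fun m' => m.Agree 20 m' ∧
      m'.array 0 = m.array 0 ∧ m'.array 2 = m.array 2 ∧ HasMinors n B m') m := by
  refine .seq ((gramProgram_spec hg hr hB).mono ?_)
  rintro m₁ ⟨h1, h2, h3, h4⟩
  refine .seq (.setEntry (i' := 0) (j' := 0) (by simp) (by simp) (by simp) (by simp) (by simp)
    (by simp [one_le_pow₀]) ?_)
  refine WP.forLoop (2 * n) (le_loopBound (by omega)) (fun k m' => m.Agree 20 m' ∧
    m'.array 0 = m.array 0 ∧ m'.array 2 = m.array 2 ∧ m'.array 1 0 0 = 1 ∧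
      ∀ i < 2 * n, ∀ j < 2 * n, m'.array 1 (i + 1) (j + 1) =
        gramMinor (n + 2 * n) B (min k (min i j)) i j) ?_ ?_ ?_ ?_
  · rintro k m' ⟨g1, -⟩
    exact ⟨by simp, (hg.agree (by norm_num) g1).samples⟩
  · refine ⟨(h1.setArray _ _ _ _).setScalar (by norm_num) _, ?_, ?_, ?_, ?_⟩
    · rw [Memory.array_setScalar, Memory.array_setArray_of_ne _ _ _ _ (by norm_num) (by norm_num)
        (by norm_num), h2]
    · rw [Memory.array_setScalar, Memory.array_setArray_of_ne _ _ _ _ (by norm_num) (by norm_num)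
        (by norm_num), h3]
    · rw [Memory.array_setScalar, Memory.array_setArray_self _ _ _ _ (by norm_num),
        if_pos ⟨rfl, rfl⟩, eval_const]
    · intro i hi j hj
      rw [Memory.array_setScalar, Memory.array_setArray_self _ _ _ _ (by norm_num),
        if_neg (by omega), h4 i hi j hj, Nat.zero_min, gramMinor_zero]
  · rintro k hk m' hvk ⟨g1, g2, g3, g4, g5⟩
    refine (eliminationStep_spec (hg.agree (by norm_num) g1) hB hk hvk g4 g5).mono ?_
    rintro m'' ⟨f1, f2, f3, f4, f5, f6⟩
    exact ⟨f2, (g1.trans f1 le_rfl).setScalar (by norm_num) _, by simp [f3, g2], by simp [f4, g3],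
      by simpa using f5, by simpa using f6⟩
  · rintro m' ⟨g1, g2, g3, g4, g5⟩
    refine ⟨g1, g2, g3, g4, fun i hi j hj => ?_⟩
    rw [g5 i hi j hj]
    congr 1
    omega

end

/-! ### Programs for the reduction -/

/-- Size reduction of all rows. -/
def reduceProgram : RamProgram :=
  forLoop 10 (var 1) <| forLoop 11 (var 10) <|
    .seq (setVar 12 (.sub (.sub (var 10) (.const 1)) (var 11))) <|
    .seq gramSchmidtProgram <|
    .seq (setVar 13 (.div
      (.add (.mul (.const 2) (entry 1 (.add (var 10) (.const 1)) (.add (var 12) (.const 1))))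
        (entry 1 (.add (var 12) (.const 1)) (.add (var 12) (.const 1))))
      (.mul (.const 2) (entry 1 (.add (var 12) (.const 1)) (.add (var 12) (.const 1)))))) <|
    forLoop 14 (var 2) <| setEntry 0 (var 10) (var 14)
      (.sub (entry 0 (var 10) (var 14)) (.mul (var 13) (entry 0 (var 12) (var 14))))

/-- Search for the last pair of consecutive rows to be swapped. -/
def searchProgram : RamProgram :=
  .seq (setVar 15 (.const 0)) <|
    forLoop 16 (var 1) <| .ite (.mul (.lt (.add (var 16) (.const 1)) (var 1))
      (.lt (.mul (.const 4) (.mul (entry 1 (var 16) (var 16))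
          (entry 1 (.add (var 16) (.const 2)) (.add (var 16) (.const 2)))))
        (.mul (entry 1 (.add (var 16) (.const 1)) (.add (var 16) (.const 1)))
          (entry 1 (.add (var 16) (.const 1)) (.add (var 16) (.const 1))))))
      (setVar 15 (.add (var 16) (.const 1))) .skip

/-- The swap of two consecutive rows. -/
def exchangeProgram : RamProgram :=
  .ite (var 15) (forLoop 17 (var 2) <|
    .seq (setVar 18 (entry 0 (.sub (var 15) (.const 1)) (var 17))) <|
    .seq (setEntry 0 (.sub (var 15) (.const 1)) (var 17) (entry 0 (var 15) (var 17))) <|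
    setEntry 0 (var 15) (var 17) (var 18)) .skip

/-- An iteration of the reduction algorithm. -/
def lllStepProgram : RamProgram :=
  .seq reduceProgram <| .seq gramSchmidtProgram <| .seq searchProgram exchangeProgram

/-- The reduction algorithm. -/
def lllProgram : RamProgram := forLoop 9 (var 5) lllStepProgram

section

variable {n : ℕ} {O : DigitOracle} {hO : O.IsBinary} {B : ℕ → ℕ → ℤ} {m : Memory}

/-- The entries are bounded after each complete iteration. -/
abbrev IsStage (n : ℕ) (B : ℕ → ℕ → ℤ) : Prop :=
  IsBoundedBasis (n + 2 * n) (2 * n) (2 ^ (88 * n ^ 2)) (2 ^ (n + 88 * n ^ 2)) B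

theorem IsStage.isFeasible_reduceRow (hB : IsStage n B) {i t : ℕ} (hi : i < 2 * n) (ht : t ≤ i) :
    IsFeasible n (reduceRow (n + 2 * n) B i t) :=
  (IsBoundedBasis.reduceRow hB (one_le_pow₀ (by norm_num)) hi ht).mono (growth_bound n)

theorem IsStage.reduceRows (hB : IsStage n B) {i : ℕ} (hi : i ≤ 2 * n) :
    IsStage n (reduceRows (n + 2 * n) B i) :=
  (reduceRows_spec hB (one_le_pow₀ (by norm_num)) (mul_le_sq_bound n) hi).1

theorem IsStage.isFeasible (hB : IsStage n B) : IsFeasible n B := by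
  refine hB.mono (pow_le_pow_right₀ (by norm_num) ?_)
  have := sq_le_cube n
  rw [entryBits]
  omega

/-- The minors are recomputed from scratch before every subtraction. This avoids update formulas and
costs only a polynomial factor. -/
theorem reduceProgram_spec (hg : HasGlobals n m) (hr : HasRows n B m) (hB : IsStage n B) :
    WP (ramContext n O hO) reduceProgram (fun m' => m.Agree 10 m' ∧
      m'.array 2 = m.array 2 ∧ HasRows n (reduceRows (n + 2 * n) B (2 * n)) m') m := by
  refine WP.forLoop₂ (by norm_num) (2 * n) (fun i => i) (fun i t m' => m.Agree 10 m' ∧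
    m'.array 2 = m.array 2 ∧
      HasRows n (reduceRow (n + 2 * n) (reduceRows (n + 2 * n) B i) i t) m')
    (le_loopBound (by omega)) (fun _ _ => le_loopBound (by omega)) ?_ ?_ ?_ ?_ ?_ ?_ ?_ ?_
  · rintro i j m' x ⟨h1, h2, h3⟩
    exact ⟨h1.setScalar (by norm_num) x, by simpa using h2, by simpa [HasRows] using h3⟩
  · rintro i j m' x ⟨h1, h2, h3⟩
    exact ⟨h1.setScalar (by norm_num) x, by simpa using h2, by simpa [HasRows] using h3⟩
  · rintro i j m' ⟨h1, -⟩
    exact ⟨by simp, (hg.agree (by norm_num) h1).samples⟩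
  · rintro i - j m' hvi -
    exact ⟨by simp, by simpa using hvi⟩
  · exact ⟨.refl _ _, rfl, hr⟩
  · rintro i hi m' h
    -- The last state of row `i` is by definition the initial state of row `i + 1`.
    exact h
  · rintro i hi t ht m' hvi hvt ⟨h1, h2, h3⟩
    have hF := (hB.reduceRows hi.le).isFeasible_reduceRow hi ht.le
    set B' := reduceRow (n + 2 * n) (reduceRows (n + 2 * n) B i) i t with hB'
    have hF' : IsFeasible n (rowOp (n + 2 * n) B' i (i - 1 - t)) :=
      (hB.reduceRows hi.le).isFeasible_reduceRow hi (t := t + 1) ht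
    obtain ⟨j, hj⟩ : ∃ j, j = i - 1 - t := ⟨_, rfl⟩
    rw [← hj] at hF'
    have hjM : j < 2 * n := by omega
    have hji : j ≠ i := by omega
    have hjv : (sub (sub (var 10) (.const 1)) (var 11)).eval (ramContext n O hO).oracle m' = j := by
      simp only [eval_sub, eval_var, eval_const, hvi, hvt]
      omega
    refine .seq (.setVar (by simp) ?_ (.seq ?_))
    · rw [hjv, Nat.abs_cast]
      exact_mod_cast (le_loopBound (O := O) (hO := hO) (by omega : j ≤ 300 * (n + 1))).trans (by
        exact_mod_cast (ramContext n O hO).N_le)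
    rw [hjv]
    refine (gramSchmidtProgram_spec (B := B') (hg.agree (by norm_num)
      (h1.setScalar (by norm_num) _)) (by simpa [HasRows] using h3) hF).mono ?_
    rintro m₁ ⟨f1, f2, f3, f4⟩
    have e10 : m₁.scalar 10 = i := by rw [f1 10 (by norm_num)]; simp [hvi]
    have e11 : m₁.scalar 11 = t := by rw [f1 11 (by norm_num)]; simp [hvt]
    have e12 : m₁.scalar 12 = j := by rw [f1 12 (by norm_num)]; simp
    have hq : (RamExpr.div
        (.add (.mul (.const 2) (entry 1 (.add (var 10) (.const 1)) (.add (var 12) (.const 1))))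
          (entry 1 (.add (var 12) (.const 1)) (.add (var 12) (.const 1))))
        (.mul (.const 2) (entry 1 (.add (var 12) (.const 1)) (.add (var 12) (.const 1))))).eval
        (ramContext n O hO).oracle m₁ = nearestCoeff (n + 2 * n) B' i j := by
      rw [eval_div, eval_add, eval_mul, eval_mul, eval_const,
        eval_entry (i' := i + 1) (j' := j + 1) (by simp [e10]) (by simp [e12]),
        eval_entry (i' := j + 1) (j' := j + 1) (by simp [e12]) (by simp [e12]),
        f4.2 i hi j hjM, f4.2 j hjM j hjM, min_eq_right (by omega), min_self, nearestCoeff]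
    refine .seq (.setVar (by simp) ?_ ?_)
    · rw [hq]
      exact hF.nearestCoeff_le hi hjM
    rw [hq]
    have f5 : m.Agree 10 m₁ := (h1.setScalar (by norm_num) _).trans f1 (by norm_num)
    have f6 : m₁.array 2 = m.array 2 := by rw [f3, Memory.array_setScalar, h2]
    have f7 : HasRows n B' m₁ := by
      intro a ha l hl
      rw [f2, Memory.array_setScalar]
      exact h3 a ha l hl
    refine WP.forLoop (n + 2 * n) (le_loopBound (by omega)) (fun c m' => m.Agree 10 m' ∧
      m'.scalar 10 = i ∧ m'.scalar 11 = t ∧ m'.scalar 12 = j ∧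
      m'.scalar 13 = nearestCoeff (n + 2 * n) B' i j ∧ m'.array 2 = m.array 2 ∧
      ∀ a < 2 * n, ∀ l < n + 2 * n, m'.array 0 a l =
        if a = i ∧ l < c then rowOp (n + 2 * n) B' i j a l else B' a l) ?_ ?_ ?_ ?_
    · rintro c m' ⟨g1, -⟩
      exact ⟨by simp, (hg.agree (by norm_num) g1).columns⟩
    · refine ⟨(f5.setScalar (by norm_num) _).setScalar (by norm_num) _, by simp [e10],
        by simp [e11], by simp [e12], by simp, by simpa using f6, fun a ha l hl => ?_⟩
      rw [if_neg (by omega), Memory.array_setScalar, Memory.array_setScalar]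
      exact f7 a ha l hl
    · rintro c hc m' hvc ⟨g1, g2, g3, g4, g5, g6, g7⟩
      have heval : (sub (entry 0 (var 10) (var 14))
          (mul (var 13) (entry 0 (var 12) (var 14)))).eval (ramContext n O hO).oracle m' =
          rowOp (n + 2 * n) B' i j i c := by
        rw [eval_sub, eval_mul, eval_var, g5,
          eval_entry (i' := i) (j' := c) (by simp [g2]) (by simp [hvc]),
          eval_entry (i' := j) (j' := c) (by simp [g4]) (by simp [hvc]),
          g7 i hi c hc, g7 j hjM c hc, if_neg (by omega), if_neg (by omega), rowOp, if_pos rfl]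
      refine .setEntry (i' := i) (j' := c) (by simp [g2]) (by simp [hvc]) (by simp) (by simp)
        (by simp) ?_ ?_
      · rw [heval]
        exact hF'.entry_le hi hc
      · rw [heval]
        refine ⟨by simp [hvc], (g1.setArray _ _ _ _).setScalar (by norm_num) _, by simp [g2],
          by simp [g3], by simp [g4], by simp [g5], ?_, fun a ha l hl => ?_⟩
        · rw [Memory.array_setScalar, Memory.array_setArray_of_ne _ _ _ _ (by norm_num)
            (by norm_num) (by norm_num), g6]
        · rw [Memory.array_setScalar, Memory.array_setArray_self _ _ _ _ (by norm_num),
            g7 a ha l hl]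
          by_cases hal : a = i ∧ l = c
          · obtain ⟨rfl, rfl⟩ := hal
            simp
          · rw [if_neg hal]
            exact if_congr (by omega) rfl rfl
    -- With all columns processed, row `i` is the new one and every other row agrees with its old
    -- version.
    · rintro m' ⟨g1, g2, g3, -, -, g6, g7⟩
      refine ⟨g2, g3, g1, g6, fun a ha l hl => ?_⟩
      rw [g7 a ha l hl, reduceRow, ← hj, ← hB']
      by_cases hai : a = i
      · rw [if_pos ⟨hai, hl⟩]
      · rw [if_neg (by omega), rowOp, if_neg hai]
  · rintro m' h
    exact h

theorem searchProgram_spec (hg : HasGlobals n m) (hm : HasMinors n B m) :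
    WP (ramContext n O hO) searchProgram (fun m' => m.Agree 10 m' ∧ m'.array = m.array ∧
      m'.scalar 15 = (lastGap (n + 2 * n) (2 * n) B (2 * n) : ℕ)) m := by
  refine .seq (.setVar (by simp) (by simp) ?_)
  refine WP.forLoop (2 * n) (le_loopBound (by omega)) (fun k m' => m.Agree 10 m' ∧
    m'.array = m.array ∧ m'.scalar 15 = (lastGap (n + 2 * n) (2 * n) B k : ℕ)) ?_ ?_ ?_ ?_
  · rintro c m' ⟨g1, -⟩
    exact ⟨by simp, (hg.agree (by norm_num) g1).samples⟩
  · exact ⟨((Memory.Agree.refl _ _).setScalar (by norm_num) _).setScalar (by norm_num) _,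
      by simp, by simp [lastGap]⟩
  · rintro k hk m' hvk ⟨g1, g2, g3⟩
    have hM := (hg.agree (by norm_num) g1).samples
    have heval : (mul (.lt (.add (var 16) (.const 1)) (var 1))
        (.lt (.mul (.const 4) (.mul (entry 1 (var 16) (var 16))
            (entry 1 (.add (var 16) (.const 2)) (.add (var 16) (.const 2)))))
          (.mul (entry 1 (.add (var 16) (.const 1)) (.add (var 16) (.const 1)))
            (entry 1 (.add (var 16) (.const 1)) (.add (var 16) (.const 1)))))).eval
        (ramContext n O hO).oracle m' ≠ 0 ↔ (k + 1 < 2 * n ∧ HasGap (n + 2 * n) B k) := by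
      by_cases hk1 : k + 1 < 2 * n
      · rw [eval_mul, eval_lt, eval_lt, eval_mul, eval_mul, eval_mul, eval_const,
          eval_entry (i' := k) (j' := k) (by simp [hvk]) (by simp [hvk]),
          eval_entry (i' := k + 2) (j' := k + 2) (by simp [hvk]) (by simp [hvk]),
          eval_entry (i' := k + 1) (j' := k + 1) (by simp [hvk]) (by simp [hvk]), g2,
          hm.gramDet (by omega), hm.gramDet (by omega), hm.gramDet (by omega)]
        have : (k : ℤ) + 1 < (2 * n : ℕ) := by exact_mod_cast hk1
        simp only [eval_add, eval_var, eval_const, hvk, hM, this, if_true, one_mul, hk1, true_and,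
          HasGap]
        split_ifs with h <;> simp [h]
      -- In the last round the second comparison reads cells without prescribed content; the factor
      -- 0 makes its value irrelevant.
      · have : ¬ ((k : ℤ) + 1 < (2 * n : ℕ)) := by exact_mod_cast hk1
        simp only [eval_mul, eval_lt, eval_add, eval_var, eval_const, hvk, hM, this, if_false,
          zero_mul, hk1, false_and, ne_eq, not_true_eq_false]
    refine .ite (by simp) (fun h => ?_) (fun h => ?_)
    · refine .setVar (by simp) ?_ ?_
      · simp only [eval_add, eval_var, eval_const, hvk]
        have h1 : (k : ℤ) + 1 ≤ (ramContext n O hO).N := by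
          exact_mod_cast (le_loopBound (by omega : k + 1 ≤ 300 * (n + 1)))
        rw [abs_of_nonneg (by positivity)]
        exact h1.trans (ramContext n O hO).N_le
      · refine ⟨by simp [hvk], (g1.setScalar (by norm_num) _).setScalar (by norm_num) _,
          by simpa using g2, ?_⟩
        rw [lastGap, if_pos (heval.mp h)]
        simp [hvk]
    · refine .skip ⟨hvk, g1.setScalar (by norm_num) _, by simpa using g2, ?_⟩
      rw [lastGap, if_neg fun h' => heval.mpr h' h]
      simpa using g3
  · rintro m' h
    exact h

theorem exchangeProgram_spec (hg : HasGlobals n m) (hr : HasRows n B m) (hB : IsStage n B)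
    (hv : m.scalar 15 = (lastGap (n + 2 * n) (2 * n) B (2 * n) : ℕ)) :
    WP (ramContext n O hO) exchangeProgram (fun m' => m.Agree 10 m' ∧
      m'.array 2 = m.array 2 ∧ HasRows n (swapStep (n + 2 * n) (2 * n) B) m') m := by
  refine .ite (by simp) (fun h => ?_) (fun h => ?_)
  · rw [eval_var, hv] at h
    have hne : lastGap (n + 2 * n) (2 * n) B (2 * n) ≠ 0 := by exact_mod_cast h
    have hlt := ((lastGap_spec (D := n + 2 * n) (M := 2 * n) (B := B) (2 * n)).2 hne).1
    obtain ⟨k, hk⟩ : ∃ k, lastGap (n + 2 * n) (2 * n) B (2 * n) = k + 1 :=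
      ⟨_, (Nat.succ_pred_eq_of_ne_zero hne).symm⟩
    rw [hk] at hlt hv
    have hsw : ∀ a, swapStep (n + 2 * n) (2 * n) B a = B (Equiv.swap k (k + 1) a) := by
      intro a
      rw [swapStep, if_neg hne, hk, Nat.add_sub_cancel]
    refine WP.forLoop (n + 2 * n) (le_loopBound (by omega)) (fun c m' => m.Agree 10 m' ∧
      m'.scalar 15 = (k + 1 : ℕ) ∧ m'.array 2 = m.array 2 ∧
      ∀ a < 2 * n, ∀ l < n + 2 * n, m'.array 0 a l =
        if l < c then B (Equiv.swap k (k + 1) a) l else B a l) ?_ ?_ ?_ ?_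
    · rintro c m' ⟨g1, -⟩
      exact ⟨by simp, (hg.agree (by norm_num) g1).columns⟩
    · refine ⟨(Memory.Agree.refl _ _).setScalar (by norm_num) _, by simp [hv], by simp,
        fun a ha l hl => ?_⟩
      rw [if_neg (by omega), Memory.array_setScalar]
      exact hr a ha l hl
    · rintro c hc m' hvc ⟨g1, g2, g3, g4⟩
      have e1 : (entry 0 (.sub (var 15) (.const 1)) (var 17)).eval (ramContext n O hO).oracle m' =
          B k c := by
        rw [eval_entry (i' := k) (j' := c) (by simp [g2]) (by simp [hvc]), g4 k (by omega) c hc,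
          if_neg (by omega)]
      have e2 : ∀ x, (entry 0 (var 15) (var 17)).eval (ramContext n O hO).oracle
          (m'.setScalar 18 x) = B (k + 1) c := by
        intro x
        rw [eval_entry (i' := k + 1) (j' := c) (by simp [g2]) (by simp [hvc]),
          Memory.array_setScalar, g4 (k + 1) hlt c hc, if_neg (by omega)]
      refine .seq (.setVar (by simp) ?_ (.seq (.setEntry (i' := k) (j' := c) (by simp [g2])
        (by simp [hvc]) (by simp) (by simp) (by simp) ?_
        (.setEntry (i' := k + 1) (j' := c) (by simp [g2]) (by simp [hvc]) (by simp) (by simp)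
          (by simp) ?_ ?_))))
      · rw [e1]; exact hB.isFeasible.entry_le (by omega) hc
      · rw [e2]; exact hB.isFeasible.entry_le hlt hc
      · rw [e2, e1]
        simpa using hB.isFeasible.entry_le (by omega) hc
      · rw [e2, e1]
        refine ⟨by simp [hvc], (((g1.setScalar (by norm_num) _).setArray _ _ _ _).setArray _ _ _
          _).setScalar (by norm_num) _, by simp [g2], ?_, fun a ha l hl => ?_⟩
        · rw [Memory.array_setScalar, Memory.array_setArray_of_ne _ _ _ _ (by norm_num)
            (by norm_num) (by norm_num), Memory.array_setArray_of_ne _ _ _ _ (by norm_num)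
            (by norm_num) (by norm_num), Memory.array_setScalar, g3]
        · rw [Memory.array_setScalar, Memory.array_setArray_self _ _ _ _ (by norm_num),
            Memory.array_setArray_self _ _ _ _ (by norm_num), Memory.array_setScalar,
            g4 a ha l hl]
          by_cases hlc : l = c
          · subst hlc
            rw [if_pos (Nat.lt_succ_self l), if_neg (lt_irrefl l)]
            rcases eq_or_ne a k with rfl | h3
            · simp
            · rcases eq_or_ne a (k + 1) with rfl | h4
              · simp
              · rw [if_neg (by omega), if_neg (by omega), Equiv.swap_apply_of_ne_of_ne h3 h4]
          · rw [if_neg (by omega), if_neg (by omega)]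
            exact if_congr (by omega) rfl rfl
    · rintro m' ⟨g1, -, g3, g4⟩
      refine ⟨g1, g3, fun a ha l hl => ?_⟩
      rw [g4 a ha l hl, if_pos hl, hsw]
  · rw [eval_var, hv] at h
    have h0 : lastGap (n + 2 * n) (2 * n) B (2 * n) = 0 := by exact_mod_cast h
    refine .skip ⟨.refl _ _, rfl, ?_⟩
    rw [swapStep, if_pos h0]
    exact hr

theorem lllStepProgram_spec (hg : HasGlobals n m) (hr : HasRows n B m) (hB : IsStage n B) :
    WP (ramContext n O hO) lllStepProgram (fun m' => m.Agree 10 m' ∧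
      m'.array 2 = m.array 2 ∧ HasRows n (lllStep (n + 2 * n) (2 * n) B) m') m := by
  have hB' := hB.reduceRows le_rfl
  refine .seq ((reduceProgram_spec hg hr hB).mono ?_)
  rintro m₁ ⟨h1, h2, h3⟩
  have hg1 := hg.agree (by norm_num) h1
  refine .seq ((gramSchmidtProgram_spec hg1 h3 hB'.isFeasible).mono ?_)
  rintro m₂ ⟨f1, f2, f3, f4⟩
  have hg2 := hg1.agree (by norm_num) f1
  refine .seq ((searchProgram_spec hg2 f4).mono ?_)
  rintro m₃ ⟨g1, g2, g3⟩
  refine (exchangeProgram_spec (hg2.agree (by norm_num) g1) (fun a ha l hl => ?_) hB' g3).mono ?_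
  · rw [g2, f2]
    exact h3 a ha l hl
  · rintro m₄ ⟨k1, k2, k3⟩
    exact ⟨((h1.trans f1 (by norm_num)).trans g1 le_rfl).trans k1 le_rfl,
      by rw [k2, g2, f3, h2], k3⟩

/-- The bounds are required at every stage, since each intermediate basis must fit into the memory
cells. -/
theorem lllProgram_spec (hg : HasGlobals n m) (hr : HasRows n B m)
    (hB : ∀ T, IsStage n (lll (n + 2 * n) (2 * n) B T)) :
    WP (ramContext n O hO) lllProgram (fun m' => m.Agree 9 m' ∧
      m'.array 2 = m.array 2 ∧ HasRows n (lll (n + 2 * n) (2 * n) B (iterations n)) m') m := by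
  refine WP.forLoop (iterations n) ?_ (fun T m' => m.Agree 9 m' ∧ m'.array 2 = m.array 2 ∧
    HasRows n (lll (n + 2 * n) (2 * n) B T) m') ?_ ?_ ?_ ?_
  · exact Nat.mul_le_mul_right _ (by norm_num)
  · rintro c m' ⟨g1, -⟩
    exact ⟨by simp, (hg.agree (by norm_num) g1).iterations⟩
  · exact ⟨(Memory.Agree.refl _ _).setScalar le_rfl _, by simp, by simpa [HasRows, lll] using hr⟩
  · rintro T hT m' hvT ⟨g1, g2, g3⟩
    refine (lllStepProgram_spec (hg.agree (by norm_num) g1) g3 (hB T)).mono ?_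
    rintro m'' ⟨h1, h2, h3⟩
    exact ⟨by rw [h1 9 (by norm_num), hvT], (g1.trans h1 (by norm_num)).setScalar le_rfl _,
      by rw [Memory.array_setScalar, h2, g2], by simpa [HasRows, lll] using h3⟩
  · rintro m' h
    exact h

end

/-! ### Reading the samples, and the complete program -/

/-- The number in two's complement with the digits of the coordinate `j` of sample `i` at the places
`-n, …, t - n`. -/
def readDigits (O : DigitOracle) (n i j : ℕ) : ℕ → ℤ
  | 0 => -O i j (-n)
  | t + 1 => 2 * readDigits O n i j t + O i j (t + 1 - n)

/-- The first components of the samples, scaled by `2 ^ (20 n)` and rounded. -/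
def roundedVectors (O : DigitOracle) (n i j : ℕ) : ℤ :=
  if i < 2 * n ∧ j < n then readDigits O n i j (21 * n) else 0

/-- The linear combination of the second components of the samples, scaled by `2 ^ (20 n)` and
rounded. -/
def combinedSample (O : DigitOracle) (n : ℕ) : ℤ :=
  ∑ l ∈ Finset.range (2 * n),
    shortRelation n (roundedVectors O n) l * readDigits O n l n (21 * n)

/-- The combined sample, shifted by `1 / 4`, lies in the first half of the circle. -/
def Accepts (O : DigitOracle) (n : ℕ) : Prop :=
  (combinedSample O n + 2 ^ (20 * n) / 4) % 2 ^ (20 * n) < 2 ^ (20 * n) / 2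

instance (O : DigitOracle) (n : ℕ) : Decidable (Accepts O n) := Int.decLt _ _

/-- Initialization of the global variables. -/
def initProgram : RamProgram :=
  .seq (setVar 0 (.load (.const 0))) <|
  .seq (setVar 1 (.mul (.const 2) (var 0))) <|
  .seq (setVar 2 (.add (var 0) (var 1))) <|
  .seq (setVar 3 (.mul (.const 21) (var 0))) <|
  .seq (setVar 5 (.mul (.const 300) (.mul (.mul (.add (var 0) (.const 1))
    (.add (var 0) (.const 1))) (.add (var 0) (.const 1))))) <|
  .seq (setVar 4 (.const 1)) <|
  forLoop 6 (.mul (.const 20) (var 0)) (setVar 4 (.mul (.const 2) (var 4)))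

/-- Reading the samples. -/
def readProgram : RamProgram :=
  forLoop 6 (var 1) <| forLoop 7 (.add (var 0) (.const 1)) <|
    .seq (setVar 8 (.sub (.const 0) (.digit (var 6) (var 7) (.sub (.const 0) (var 0))))) <|
    .seq (forLoop 9 (var 3) <| setVar 8 (.add (.mul (.const 2) (var 8))
      (.digit (var 6) (var 7) (.sub (.add (var 9) (.const 1)) (var 0))))) <|
    setEntry 2 (var 6) (var 7) (var 8)

/-- Construction of the initial basis. -/
def initRowsProgram : RamProgram :=
  forLoop 6 (var 1) <| forLoop 7 (var 2) <|
    setEntry 0 (var 6) (var 7) (.add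
      (.mul (.lt (var 7) (var 0)) (entry 2 (var 6) (var 7)))
      (.mul (.lt (var 7) (.add (.add (var 6) (var 0)) (.const 1)))
        (.lt (.add (var 6) (var 0)) (.add (var 7) (.const 1)))))

/-- The final test. -/
def testProgram : RamProgram :=
  .seq (setVar 6 (.const 0)) <|
  .seq (forLoop 7 (var 1) <| setVar 6 (.add (var 6)
    (.mul (entry 0 (.const 0) (.add (var 0) (var 7))) (entry 2 (var 7) (var 0))))) <|
  .seq (setVar 6 (.add (var 6) (.div (var 4) (.const 4)))) <|
  .seq (setVar 6 (.sub (var 6) (.mul (var 4) (.div (var 6) (var 4))))) <|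
  .store (.const 0) (.lt (var 6) (.div (var 4) (.const 2)))

/-- The distinguishing algorithm. -/
def distinguisher : RamProgram :=
  .seq initProgram <| .seq readProgram <| .seq initRowsProgram <| .seq lllProgram testProgram

section

variable {n : ℕ} {O : DigitOracle} {hO : O.IsBinary} {m : Memory}

theorem abs_le_memoryBound {x : ℤ} {k : ℕ} (h : |x| ≤ 2 ^ k) (hk : k ≤ 10000 * (n + 1) ^ 3) :
    |x| ≤ 2 ^ (ramContext n O hO).s :=
  h.trans (pow_le_pow_right₀ (by norm_num) hk)

theorem abs_natCast_le {x : ℕ} (h : x ≤ 1000 * (n + 1) ^ 3) :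
    |(x : ℤ)| ≤ 2 ^ (ramContext n O hO).s := by
  have h1 : (x : ℤ) ≤ (ramContext n O hO).N := by exact_mod_cast h
  rw [Nat.abs_cast]
  exact h1.trans (ramContext n O hO).N_le

theorem readDigits_bounds (hO : O.IsBinary) (i j t : ℕ) :
    -2 ^ t ≤ readDigits O n i j t ∧ readDigits O n i j t ≤ 2 ^ t - 1 := by
  induction t with
  | zero =>
    have := hO i j (-n)
    simp only [readDigits]
    norm_num
    omega
  | succ t ih =>
    have := hO i j (t + 1 - n)
    simp only [readDigits, pow_succ]
    omega

theorem abs_readDigits_le (hO : O.IsBinary) (i j t : ℕ) : |readDigits O n i j t| ≤ 2 ^ t := by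
  have := readDigits_bounds (n := n) hO i j t
  rw [abs_le]
  omega

theorem abs_roundedVectors_le (hO : O.IsBinary) (i j : ℕ) :
    |roundedVectors O n i j| ≤ 2 ^ (21 * n) := by
  rw [roundedVectors]
  split_ifs
  · exact abs_readDigits_le hO i j _
  · simp

theorem cast_abs_roundedVectors_le (hO : O.IsBinary) (i j : ℕ) :
    |(roundedVectors O n i j : ℝ)| ≤ 2 ^ (21 * n) := by
  exact_mod_cast abs_roundedVectors_le hO i j

/-- The input cell 0 is also the address of the first entry of array 0, so the dimension is first
copied to a scalar variable. -/
theorem initProgram_spec :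
    WP (ramContext n O hO) initProgram (HasGlobals n) (initialMemory n) := by
  have hn := sq_le_cube n
  have e0 : (load (.const 0)).eval (ramContext n O hO).oracle (initialMemory n) = n := by
    simp [RamExpr.eval, initialMemory]
  refine .seq (.setVar (by trivial) ?_ (.seq (.setVar (by simp) ?_ (.seq (.setVar (by simp) ?_
    (.seq (.setVar (by simp) ?_ (.seq (.setVar (by simp) ?_ (.seq (.setVar (by simp) ?_
    ?_)))))))))))
  · rw [e0]
    exact abs_natCast_le (by omega)
  · rw [e0]
    simpa using abs_natCast_le (O := O) (hO := hO) (by omega : 2 * n ≤ 1000 * (n + 1) ^ 3)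
  · rw [e0]
    simpa using abs_natCast_le (O := O) (hO := hO) (by omega : n + 2 * n ≤ 1000 * (n + 1) ^ 3)
  · rw [e0]
    simpa using abs_natCast_le (O := O) (hO := hO) (by omega : 21 * n ≤ 1000 * (n + 1) ^ 3)
  · rw [e0]
    have := abs_natCast_le (O := O) (hO := hO)
      (by omega : 300 * ((n + 1) ^ 3) ≤ 1000 * (n + 1) ^ 3)
    push_cast at this
    simpa [pow_succ] using this
  · simp [one_le_pow₀]
  · rw [e0]
    refine WP.forLoop (20 * n) (le_loopBound (by omega)) (fun t m' => m'.scalar 0 = n ∧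
      m'.scalar 1 = (2 * n : ℕ) ∧ m'.scalar 2 = (n + 2 * n : ℕ) ∧ m'.scalar 3 = (21 * n : ℕ) ∧
      m'.scalar 5 = (iterations n : ℕ) ∧ m'.scalar 4 = 2 ^ t) ?_ ?_ ?_ ?_
    · rintro t m' ⟨h, -⟩
      simp [h]
    · simp [iterations, pow_succ]
    · rintro t ht m' hvt ⟨h0, h1, h2, h3, h5, h4⟩
      refine .setVar (by simp) ?_ ?_
      · rw [eval_mul, eval_const, eval_var, h4, ← pow_succ']
        refine abs_le_memoryBound (k := t + 1) (by simp) (by omega)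
      · simp [h0, h1, h2, h3, h4, h5, hvt, pow_succ']
    · rintro m' ⟨h0, h1, h2, h3, h5, h4⟩
      exact ⟨h0, h1, h2, h3, h4, h5⟩

theorem readProgram_spec (hg : HasGlobals n m) :
    WP (ramContext n O hO) readProgram (fun m' => HasGlobals n m' ∧
      ∀ i < 2 * n, ∀ j < n + 1, m'.array 2 i j = readDigits O n i j (21 * n)) m := by
  have hn := sq_le_cube n
  have habs := fun i j t => abs_readDigits_le (n := n) hO i j t
  refine WP.forLoop₂ (by norm_num) (2 * n) (fun _ => n + 1) (fun i j m' => m.Agree 6 m' ∧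
    ∀ a b, b < n + 1 → (a < i ∨ a = i ∧ b < j) → m'.array 2 a b = readDigits O n a b (21 * n))
    (le_loopBound (by omega)) (fun _ _ => le_loopBound (by omega)) ?_ ?_ ?_ ?_ ?_ ?_ ?_ ?_
  · rintro i j m' x ⟨h1, h2⟩
    exact ⟨h1.setScalar (by norm_num) x, by simpa using h2⟩
  · rintro i j m' x ⟨h1, h2⟩
    exact ⟨h1.setScalar (by norm_num) x, by simpa using h2⟩
  · rintro i j m' ⟨h1, -⟩
    exact ⟨by simp, (hg.agree (by norm_num) h1).samples⟩
  · rintro i - j m' - ⟨h1, -⟩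
    exact ⟨by simp, by simp [(hg.agree (by norm_num) h1).dim]⟩
  · exact ⟨.refl _ _, fun a b hb h => by omega⟩
  · rintro i hi m' ⟨h1, h2⟩
    exact ⟨h1, fun a b hb h => h2 a b hb (by omega)⟩
  · rintro i hi j hj m' hvi hvj ⟨h1, h2⟩
    have hg' := hg.agree (by norm_num) h1
    have e0 : (sub (.const 0) (.digit (var 6) (var 7) (.sub (.const 0) (var 0)))).eval
        (ramContext n O hO).oracle m' = readDigits O n i j 0 := by
      simp [hvi, hvj, hg'.dim, readDigits, ramContext]
    refine .seq (.setVar ?_ ?_ (.seq ?_))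
    · have : n ≤ (ramContext n O hO).N := le_loopBound (by omega)
      simpa [hg'.dim] using this
    · rw [e0]
      exact abs_le_memoryBound (habs i j 0) (by omega)
    rw [e0]
    refine WP.forLoop (21 * n) (le_loopBound (by omega)) (fun t m' => m'.scalar 6 = i ∧
      m'.scalar 7 = j ∧ m.Agree 6 m' ∧ (∀ a b, b < n + 1 → (a < i ∨ a = i ∧ b < j) →
        m'.array 2 a b = readDigits O n a b (21 * n)) ∧ m'.scalar 8 = readDigits O n i j t) ?_ ?_ ?_ ?_
    · rintro t m' ⟨-, -, h, -⟩
      exact ⟨by simp, (hg.agree (by norm_num) h).digits⟩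
    · exact ⟨by simp [hvi], by simp [hvj], (h1.setScalar (by norm_num) _).setScalar (by norm_num) _,
        by simpa using h2, by simp⟩
    · rintro t ht m' hvt ⟨g1, g2, g3, g4, g5⟩
      have hg' := hg.agree (by norm_num) g3
      have heval : (add (.mul (.const 2) (var 8)) (.digit (var 6) (var 7)
          (.sub (.add (var 9) (.const 1)) (var 0)))).eval (ramContext n O hO).oracle m' =
          readDigits O n i j (t + 1) := by
        simp [g1, g2, g5, hvt, hg'.dim, readDigits, ramContext]
      refine .setVar ?_ ?_ ?_
      · have : ((t : ℤ) + 1 - n).natAbs ≤ (ramContext n O hO).N :=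
          le_loopBound (by omega)
        simpa [hg'.dim, hvt] using this
      · rw [heval]
        exact abs_le_memoryBound (habs i j (t + 1)) (by omega)
      · rw [heval]
        exact ⟨by simp [hvt], by simp [g1], by simp [g2],
          (g3.setScalar (by norm_num) _).setScalar (by norm_num) _, by simpa using g4, by simp⟩
    · rintro m' ⟨g1, g2, g3, g4, g5⟩
      refine .setEntry (i' := i) (j' := j) (by simp [g1]) (by simp [g2]) (by simp) (by simp)
        (by simp) ?_ ?_
      · rw [eval_var, g5]
        exact abs_le_memoryBound (habs i j _) (by omega)
      · rw [eval_var, g5]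
        refine ⟨by simp [g1], by simp [g2], g3.setArray _ _ _ _, fun a b hb hab => ?_⟩
        rw [Memory.array_setArray_self _ _ _ _ (by norm_num)]
        split_ifs with h
        · obtain ⟨rfl, rfl⟩ := h
          rfl
        · exact g4 a b hb (by omega)
  · rintro m' ⟨h1, h2⟩
    exact ⟨hg.agree le_rfl h1, fun i hi j hj => h2 i j hj (by omega)⟩

theorem initRowsProgram_spec (hg : HasGlobals n m) {Y : ℕ → ℕ → ℤ}
    (hY : ∀ i j, |Y i j| ≤ 2 ^ (21 * n)) (hm : ∀ i < 2 * n, ∀ j < n, m.array 2 i j = Y i j) :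
    WP (ramContext n O hO) initRowsProgram (fun m' => HasGlobals n m' ∧ m'.array 2 = m.array 2 ∧
      HasRows n (initRows n Y) m') m := by
  have hn := sq_le_cube n
  refine WP.forLoop₂ (by norm_num) (2 * n) (fun _ => n + 2 * n) (fun i j m' => m.Agree 6 m' ∧
    m'.array 2 = m.array 2 ∧
    ∀ a b, b < n + 2 * n → (a < i ∨ a = i ∧ b < j) → m'.array 0 a b = initRows n Y a b)
    (le_loopBound (by omega)) (fun _ _ => le_loopBound (by omega)) ?_ ?_ ?_ ?_ ?_ ?_ ?_ ?_
  · rintro i j m' x ⟨h1, h2⟩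
    exact ⟨h1.setScalar (by norm_num) x, by simpa using h2⟩
  · rintro i j m' x ⟨h1, h2⟩
    exact ⟨h1.setScalar (by norm_num) x, by simpa using h2⟩
  · rintro i j m' ⟨h1, -⟩
    exact ⟨by simp, (hg.agree (by norm_num) h1).samples⟩
  · rintro i - j m' - ⟨h1, -⟩
    exact ⟨by simp, (hg.agree (by norm_num) h1).columns⟩
  · exact ⟨.refl _ _, rfl, fun a b hb h => by omega⟩
  · rintro i hi m' ⟨h1, h2, h3⟩
    exact ⟨h1, h2, fun a b hb h => h3 a b hb (by omega)⟩
  · rintro i hi j hj m' hvi hvj ⟨h1, h2, h3⟩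
    have hg' := hg.agree (by norm_num) h1
    have heval : (add (.mul (.lt (var 7) (var 0)) (entry 2 (var 6) (var 7)))
        (.mul (.lt (var 7) (.add (.add (var 6) (var 0)) (.const 1)))
          (.lt (.add (var 6) (var 0)) (.add (var 7) (.const 1))))).eval
        (ramContext n O hO).oracle m' = initRows n Y i j := by
      rw [eval_add, eval_mul, eval_mul, eval_entry (i' := i) (j' := j) (by simp [hvi])
        (by simp [hvj]), h2]
      simp only [eval_lt, eval_add, eval_var, eval_const, hvi, hvj, hg'.dim, initRows]
      congr 1
      -- Column `n` of array 2 holds the digits of the second components; the factor 0 keeps it out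
      -- of the lattice.
      · by_cases hjn : j < n
        · rw [if_pos (by exact_mod_cast hjn), if_pos hjn, one_mul, hm i hi j hjn]
        · rw [if_neg (by exact_mod_cast hjn), if_neg hjn, zero_mul]
      -- Equality of integers is tested as two strict inequalities, each with one side raised by 1.
      · by_cases hji : j = i + n
        · rw [if_pos (by omega), if_pos (by omega), if_pos hji, one_mul]
        · rw [if_neg hji]
          split_ifs <;> omega
    refine .setEntry (i' := i) (j' := j) (by simp [hvi]) (by simp [hvj]) (by simp) (by simp)
      (by simp) ?_ ?_
    · rw [heval]
      refine abs_le_memoryBound (k := 21 * n + 1) ?_ (by omega)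
      have h4 := hY i j
      have h5 : (1 : ℤ) ≤ 2 ^ (21 * n) := one_le_pow₀ (by norm_num)
      rw [initRows, pow_succ]
      refine (abs_add_le _ _).trans ?_
      split_ifs <;> simp <;> omega
    · rw [heval]
      refine ⟨by simp [hvi], by simp [hvj], h1.setArray _ _ _ _, ?_, fun a b hb hab => ?_⟩
      · rw [Memory.array_setArray_of_ne _ _ _ _ (by norm_num) (by norm_num) (by norm_num), h2]
      · rw [Memory.array_setArray_self _ _ _ _ (by norm_num)]
        split_ifs with h
        · obtain ⟨rfl, rfl⟩ := h
          rfl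
        · exact h3 a b hb (by omega)
  · rintro m' ⟨h1, h2, h3⟩
    exact ⟨hg.agree le_rfl h1, h2, fun i hi j hj => h3 i j hj (by omega)⟩

theorem abs_sum_mul_le {a z : ℕ → ℤ} (ha : ∀ l < 2 * n, |a l| ≤ 2 ^ entryBits n)
    (hz : ∀ l, |z l| ≤ 2 ^ (21 * n)) {t : ℕ} (ht : t ≤ 2 * n) :
    |∑ l ∈ Finset.range t, a l * z l| ≤ 2 ^ (2 * n + (entryBits n + 21 * n)) := by
  have h1 : ∑ l ∈ Finset.range t, |a l * z l| ≤
      ∑ _l ∈ Finset.range t, (2 : ℤ) ^ (entryBits n + 21 * n) :=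
    Finset.sum_le_sum fun l hl => by
      have hl := Finset.mem_range.mp hl
      rw [abs_mul, pow_add]
      exact mul_le_mul (ha l (by omega)) (hz l) (abs_nonneg _) (by positivity)
  rw [Finset.sum_const, Finset.card_range, nsmul_eq_mul] at h1
  refine (Finset.abs_sum_le_sum_abs _ _).trans (h1.trans ?_)
  rw [pow_add 2 (2 * n)]
  refine mul_le_mul_of_nonneg_right ?_ (by positivity)
  have : t ≤ 2 ^ (2 * n) := ht.trans Nat.lt_two_pow_self.le
  exact_mod_cast this

theorem testProgram_spec (hg : HasGlobals n m) {a z : ℕ → ℤ}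
    (ha : ∀ l < 2 * n, |a l| ≤ 2 ^ entryBits n) (hz : ∀ l, |z l| ≤ 2 ^ (21 * n))
    (hma : ∀ l < 2 * n, m.array 0 0 (n + l) = a l) (hmz : ∀ l < 2 * n, m.array 2 l n = z l) :
    WP (ramContext n O hO) testProgram (fun m' => m' 0 =
      if (∑ l ∈ Finset.range (2 * n), a l * z l + 2 ^ (20 * n) / 4) % 2 ^ (20 * n) <
        2 ^ (20 * n) / 2 then 1 else 0) m := by
  have hn := sq_le_cube n
  have hbits : 2 * n + (entryBits n + 21 * n) + 20 * n + 1 ≤ 10000 * (n + 1) ^ 3 := by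
    rw [entryBits]
    omega
  refine .seq (.setVar (by simp) (by simp) (.seq ?_))
  refine WP.forLoop (2 * n) (le_loopBound (by omega)) (fun t m' => m.Agree 6 m' ∧
    m'.array = m.array ∧ m'.scalar 6 = ∑ l ∈ Finset.range t, a l * z l) ?_ ?_ ?_ ?_
  · rintro t m' ⟨h, -⟩
    exact ⟨by simp, (hg.agree (by norm_num) h).samples⟩
  · exact ⟨((Memory.Agree.refl _ _).setScalar (by norm_num) _).setScalar (by norm_num) _, by simp,
      by simp⟩
  · rintro t ht m' hvt ⟨g1, g2, g3⟩
    have hg' := hg.agree (by norm_num) g1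
    have heval : (add (var 6) (.mul (entry 0 (.const 0) (.add (var 0) (var 7)))
        (entry 2 (var 7) (var 0)))).eval (ramContext n O hO).oracle m' =
        ∑ l ∈ Finset.range (t + 1), a l * z l := by
      rw [eval_add, eval_mul, eval_var, g3,
        eval_entry (i' := 0) (j' := n + t) (by simp) (by simp [hg'.dim, hvt]),
        eval_entry (i' := t) (j' := n) (by simp [hvt]) (by simp [hg'.dim]), g2, hma t ht, hmz t ht,
        Finset.sum_range_succ]
    refine .setVar (by simp) ?_ ?_
    · rw [heval]
      exact abs_le_memoryBound (abs_sum_mul_le ha hz ht) (by omega)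
    · rw [heval]
      exact ⟨by simp [hvt], (g1.setScalar (by norm_num) _).setScalar (by norm_num) _,
        by simpa using g2, by simp⟩
  · rintro m' ⟨g1, g2, g3⟩
    have hg' := hg.agree (by norm_num) g1
    have hS := abs_sum_mul_le ha hz le_rfl
    set S := ∑ l ∈ Finset.range (2 * n), a l * z l with hSdef
    have hQ : (0 : ℤ) < 2 ^ (20 * n) := by positivity
    have e1 : (add (var 6) (.div (var 4) (.const 4))).eval (ramContext n O hO).oracle m' =
        S + 2 ^ (20 * n) / 4 := by simp [g3, hg'.modulus]
    refine .seq (.setVar (by simp) ?_ (.seq (.setVar (by simp) ?_ ?_)))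
    · rw [e1]
      refine abs_le_memoryBound (k := 2 * n + (entryBits n + 21 * n) + 20 * n + 1) ?_ hbits
      have h1 : |(2 : ℤ) ^ (20 * n) / 4| ≤ 2 ^ (20 * n) := by
        rw [abs_of_nonneg (Int.ediv_nonneg hQ.le (by norm_num))]
        omega
      have h2 : (2 : ℤ) ^ (2 * n + (entryBits n + 21 * n)) ≤
          2 ^ (2 * n + (entryBits n + 21 * n) + 20 * n) :=
        pow_le_pow_right₀ (by norm_num) (by omega)
      have h3 : (2 : ℤ) ^ (20 * n) ≤ 2 ^ (2 * n + (entryBits n + 21 * n) + 20 * n) :=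
        pow_le_pow_right₀ (by norm_num) (by omega)
      refine (abs_add_le _ _).trans ?_
      rw [pow_succ]
      linarith
    · rw [e1]
      simp only [eval_sub, eval_mul, eval_div, eval_var, Memory.scalar_setScalar, if_true,
        hg'.modulus, if_neg (by norm_num : ¬ (4 = 6))]
      -- The machine has no remainder operation; it is expressed through the quotient.
      rw [← Int.emod_def, abs_of_nonneg (Int.emod_nonneg _ hQ.ne')]
      have h1 := Int.emod_lt_of_pos (S + 2 ^ (20 * n) / 4) hQ
      exact h1.le.trans (pow_le_pow_right₀ (by norm_num) (by simp only [ramContext]; omega))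
    · rw [e1]
      simp only [eval_sub, eval_mul, eval_div, eval_var, Memory.scalar_setScalar, if_true,
        hg'.modulus, if_neg (by norm_num : ¬ (4 = 6))]
      rw [← Int.emod_def]
      refine .store (by simp) (by simp) ?_ ?_
      · simp only [eval_lt]
        split_ifs <;> simp [one_le_pow₀]
      · simp [hg'.modulus]

theorem distinguisher_spec : WP (ramContext n O hO) distinguisher
    (fun m' => m' 0 = if Accepts O n then 1 else 0) (initialMemory n) := by
  have hY : ∀ i < 2 * n, ∀ l < n, |(roundedVectors O n i l : ℝ)| ≤ 2 ^ (21 * n) :=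
    fun i _ l _ => cast_abs_roundedVectors_le hO i l
  refine .seq (initProgram_spec.mono fun m₁ h1 => .seq ((readProgram_spec h1).mono ?_))
  rintro m₂ ⟨h2, h3⟩
  refine .seq ((initRowsProgram_spec h2 (abs_roundedVectors_le hO) fun i hi j hj => ?_).mono ?_)
  · rw [h3 i hi j (by omega), roundedVectors, if_pos ⟨hi, hj⟩]
  rintro m₃ ⟨h4, h5, h6⟩
  refine .seq ((lllProgram_spec h4 h6 fun T => isBoundedBasis_lll_initRows hY T).mono ?_)
  rintro m₄ ⟨h7, h8, h9⟩
  refine testProgram_spec (h4.agree (by norm_num) h7)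
    (a := shortRelation n (roundedVectors O n)) (z := fun l => readDigits O n l n (21 * n))
    (fun l hl => ?_) (fun l => abs_readDigits_le hO l n _) (fun l hl => ?_) (fun l hl => ?_)
  · have hF := (show IsStage n _ from isBoundedBasis_lll_initRows hY (iterations n)).isFeasible
    exact_mod_cast hF.abs_entry_le (i := 0) (l := n + l) (by omega) (by omega)
  · exact h9 0 (by omega) (n + l) (by omega)
  · rw [h8, h5]
    exact h3 l hl n (by omega)

end

/-! ### Running time and answer of the program -/

theorem initialMemory_boundedBy (n : ℕ) (O : DigitOracle) (hO : O.IsBinary) :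
    (initialMemory n).BoundedBy (ramContext n O hO).s := by
  intro x
  rw [initialMemory, Function.update_apply]
  split_ifs
  · exact abs_natCast_le (by have := sq_le_cube n; omega)
  · simp

theorem exists_distinguisher_run (n : ℕ) (O : DigitOracle) (hO : O.IsBinary) :
    ∃ m t, RamRun O distinguisher (initialMemory n) m t ∧
      t ≤ distinguisher.timeBound (10000 * (n + 1) ^ 3) (1000 * (n + 1) ^ 3) ∧
      m 0 = if Accepts O n then 1 else 0 := by
  obtain ⟨m, t, h1, h2, -, h3⟩ := distinguisher_spec (hO := hO) (initialMemory_boundedBy n O hO)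
  exact ⟨m, t, h1, h2, h3⟩

theorem isBinary_sampleOracle {n : ℕ} (ω : ℕ → CLWESample n) : (sampleOracle ω).IsBinary := by
  intro i j k
  simp only [sampleOracle, binaryDigit]
  split_ifs <;> omega

theorem isPolyTime_distinguisher : IsPolyTime distinguisher := by
  have hpoly : ∀ c : ℕ, PolyBounded fun n => c * (n + 1) ^ 3 := fun c =>
    ⟨Polynomial.C c * (Polynomial.X + 1) ^ 3, fun n => by simp⟩
  obtain ⟨p, hp⟩ := distinguisher.polyBounded_timeBound (hpoly 10000) (hpoly 1000)
  refine ⟨p, fun n ω => ?_⟩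
  obtain ⟨m, t, h1, h2, -⟩ := exists_distinguisher_run n _ (isBinary_sampleOracle ω)
  exact ⟨m, t, h1, h2.trans (hp n)⟩

/-- Determinism identifies any halting run with the one provided by the program logic. -/
theorem answersYes_distinguisher_iff {n : ℕ} (ω : ℕ → CLWESample n) :
    AnswersYes distinguisher ω ↔ Accepts (sampleOracle ω) n := by
  obtain ⟨m, t, h1, -, h3⟩ := exists_distinguisher_run n _ (isBinary_sampleOracle ω)
  constructor
  · rintro ⟨m', t', h, h'⟩
    obtain ⟨rfl, -⟩ := h1.deterministic h
    by_contra hA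
    rw [h3, if_neg hA] at h'
    exact zero_ne_one h'
  · intro hA
    exact ⟨m, t, h1, by rw [h3, if_pos hA]⟩

/-! ## Correctness of the test -/

/-- For `x` in the stated range the floor at place `-n` is `-1` or `0`, and the parity read there is
minus that value: it acts as sign bit. Each further digit is the difference between `⌊2 u⌋` and `2
⌊u⌋`. -/
theorem readDigits_eq_floor_zpow {O : DigitOracle} {n i j : ℕ} {x : ℝ}
    (hO : ∀ k, O i j k = binaryDigit x k) (h1 : -2 ^ n ≤ x) (h2 : x < 2 ^ n) (t : ℕ) :
    readDigits O n i j t = ⌊(2 : ℝ) ^ ((t : ℤ) - n) * x⌋ := by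
  induction t with
  | zero =>
    have hp : (0 : ℝ) < 2 ^ n := by positivity
    rw [readDigits, hO, binaryDigit, Nat.cast_zero, zero_sub, zpow_neg, zpow_natCast]
    have h3 : -1 ≤ ⌊((2 : ℝ) ^ n)⁻¹ * x⌋ := by
      rw [Int.le_floor, inv_mul_eq_div, le_div_iff₀ hp]
      push_cast
      linarith
    have h4 : ⌊((2 : ℝ) ^ n)⁻¹ * x⌋ < 1 := by
      rw [Int.floor_lt, inv_mul_eq_div, div_lt_iff₀ hp]
      push_cast
      linarith
    omega
  | succ t ih =>
    rw [readDigits, hO, ih, binaryDigit, show ((t + 1 : ℕ) : ℤ) - n = t - n + 1 by push_cast; ring,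
      show ((t : ℤ) + 1 - n) = t - n + 1 by ring, zpow_add_one₀ (by norm_num)]
    set u := (2 : ℝ) ^ ((t : ℤ) - n) * x with hu
    rw [show (2 : ℝ) ^ ((t : ℤ) - n) * 2 * x = 2 * u by rw [hu]; ring]
    have h3 : 2 * ⌊u⌋ ≤ ⌊2 * u⌋ := by
      rw [Int.le_floor]
      push_cast
      linarith [Int.floor_le u]
    have h4 : ⌊2 * u⌋ < 2 * ⌊u⌋ + 2 := by
      rw [Int.floor_lt]
      push_cast
      linarith [Int.lt_floor_add_one u]
    omega

theorem readDigits_eq_floor {O : DigitOracle} {n i j : ℕ} {x : ℝ}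
    (hO : ∀ k, O i j k = binaryDigit x k) (h1 : -2 ^ n ≤ x) (h2 : x < 2 ^ n) :
    readDigits O n i j (21 * n) = ⌊(2 : ℝ) ^ (20 * n) * x⌋ := by
  rw [readDigits_eq_floor_zpow hO h1 h2, show ((21 * n : ℕ) : ℤ) - n = (20 * n : ℕ) by
    push_cast; ring, zpow_natCast]

theorem abs_sum_floor_sub_le {N : ℕ} {a : ℕ → ℤ} {x : ℕ → ℝ} {A c : ℝ}
    (ha : ∀ l < N, |(a l : ℝ)| ≤ A) :
    |((∑ l ∈ Finset.range N, a l * ⌊c * x l⌋ : ℤ) : ℝ) - c * ∑ l ∈ Finset.range N, a l * x l| ≤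
      N * A := by
  push_cast
  rw [Finset.mul_sum, ← Finset.sum_sub_distrib]
  refine (Finset.abs_sum_le_sum_abs _ _).trans ?_
  have : ∑ l ∈ Finset.range N, |(a l : ℝ) * ⌊c * x l⌋ - c * (a l * x l)| ≤
      ∑ _l ∈ Finset.range N, A := Finset.sum_le_sum fun l hl => by
    have h := ha l (Finset.mem_range.mp hl)
    rw [show (a l : ℝ) * ⌊c * x l⌋ - c * (a l * x l) = a l * (⌊c * x l⌋ - c * x l) by ring, abs_mul]
    have h1 : |(⌊c * x l⌋ : ℝ) - c * x l| ≤ 1 := by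
      rw [abs_le]
      constructor <;> linarith [Int.floor_le (c * x l), Int.lt_floor_add_one (c * x l)]
    calc _ ≤ A * 1 := mul_le_mul h h1 (abs_nonneg _) ((abs_nonneg _).trans h)
      _ = A := mul_one A
  simpa using this

section Test

variable {q S : ℤ} {s : ℝ}

/-- The modulus is `4 q`, and the shift by `q` turns the window of a quarter circle on each side of
0 into one half. The rounding error is at most `1 / 64` of the circle, so distance `1 / 8` is safely
accepted, and acceptance conversely forces distance at most `1 / 4 + 1 / 64 ≤ 3 / 8`. -/
theorem emod_lt_of_near (hq : 0 < q) (hS : |(S : ℝ) - 4 * q * s| ≤ q / 16) {k : ℤ}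
    (hk : |s - k| ≤ 1 / 8) : (S + 4 * q / 4) % (4 * q) < 4 * q / 2 := by
  have hq' : (0 : ℝ) < q := by exact_mod_cast hq
  rw [abs_le] at hS hk
  have h1 : (0 : ℝ) ≤ S + q - 4 * q * k := by nlinarith
  have h2 : (S + q - 4 * q * k : ℝ) < 2 * q := by nlinarith
  have h1' : 0 ≤ S + q - 4 * q * k := by exact_mod_cast h1
  have h2' : S + q - 4 * q * k < 2 * q := by exact_mod_cast h2
  have e : (S + 4 * q / 4) % (4 * q) = S + q - 4 * q * k := by
    have h3 := Int.emod_eq_of_lt h1' (by omega : S + q - 4 * q * k < 4 * q)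
    rw [Int.sub_mul_emod_self_left] at h3
    rw [Int.mul_ediv_cancel_left _ (by norm_num), h3]
  rw [e]
  omega

theorem near_of_emod_lt (hq : 0 < q) (hS : |(S : ℝ) - 4 * q * s| ≤ q / 16)
    (h : (S + 4 * q / 4) % (4 * q) < 4 * q / 2) : ∃ k : ℤ, |s - k| ≤ 3 / 8 := by
  have hq' : (0 : ℝ) < q := by exact_mod_cast hq
  rw [Int.mul_ediv_cancel_left _ (by norm_num)] at h
  have h0 := Int.emod_nonneg (S + q) (by omega : 4 * q ≠ 0)
  have h1 := Int.emod_def (S + q) (4 * q)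
  generalize (S + q) / (4 * q) = k at h1
  have h2 : 0 ≤ S + q - 4 * q * k := by omega
  have h3 : S + q - 4 * q * k ≤ 2 * q := by omega
  have h2' : (0 : ℝ) ≤ S + q - 4 * q * k := by exact_mod_cast h2
  have h3' : (S + q - 4 * q * k : ℝ) ≤ 2 * q := by exact_mod_cast h3
  refine ⟨k, ?_⟩
  rw [abs_le] at hS ⊢
  constructor <;> nlinarith

end Test

section Accepts

variable {n : ℕ} {ω : ℕ → CLWESample n}

theorem accepts_sampleOracle_iff (ω : ℕ → CLWESample n) (hz : ∀ i < 2 * n, (ω i).2 ∈ Set.Ico (0 : ℝ) 1) :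
    Accepts (sampleOracle ω) n ↔ ((∑ l ∈ Finset.range (2 * n),
      shortRelation n (roundedVectors (sampleOracle ω) n) l * ⌊(2 : ℝ) ^ (20 * n) * (ω l).2⌋) +
        2 ^ (20 * n) / 4) % 2 ^ (20 * n) < 2 ^ (20 * n) / 2 := by
  have h : combinedSample (sampleOracle ω) n = ∑ l ∈ Finset.range (2 * n),
      shortRelation n (roundedVectors (sampleOracle ω) n) l * ⌊(2 : ℝ) ^ (20 * n) * (ω l).2⌋ := by
    refine Finset.sum_congr rfl fun l hl => ?_
    have hz := hz l (Finset.mem_range.mp hl)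
    rw [readDigits_eq_floor (x := (ω l).2) (fun k => by simp [sampleOracle])]
    · have : (0 : ℝ) < 2 ^ n := by positivity
      linarith [hz.1]
    · exact hz.2.trans_le (one_le_pow₀ (by norm_num))
  rw [Accepts, h]

theorem abs_shortRelation_sampleOracle_le (hn : 1 ≤ n) {l : ℕ} (hl : l < 2 * n) :
    |(shortRelation n (roundedVectors (sampleOracle ω) n) l : ℝ)| ≤ 2 ^ (13 * n) :=
  abs_shortRelation_le hn
    (fun i _ l _ => cast_abs_roundedVectors_le (isBinary_sampleOracle ω) i l) hl

theorem two_mul_le_two_pow (hn : 1 ≤ n) : 2 * n ≤ 2 ^ n := by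
  induction n, hn using Nat.le_induction with
  | base => norm_num
  | succ n hn ih => rw [pow_succ]; omega

theorem rounding_error_le (hn : 1 ≤ n) :
    ((2 * n : ℕ) : ℝ) * 2 ^ (13 * n) ≤ (2 : ℝ) ^ (14 * n) := by
  rw [show 14 * n = n + 13 * n by ring, pow_add]
  refine mul_le_mul_of_nonneg_right ?_ (by positivity)
  exact_mod_cast two_mul_le_two_pow hn

theorem two_pow_eq_four_mul (hn : 1 ≤ n) :
    (2 : ℤ) ^ (20 * n) = 4 * 2 ^ (20 * n - 2) := by
  rw [show (4 : ℤ) = 2 ^ 2 by norm_num, ← pow_add]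
  congr 1
  omega

theorem abs_sum_sub_le (hn : 1 ≤ n) (ω : ℕ → CLWESample n) :
    |((∑ l ∈ Finset.range (2 * n), shortRelation n (roundedVectors (sampleOracle ω) n) l *
      ⌊(2 : ℝ) ^ (20 * n) * (ω l).2⌋ : ℤ) : ℝ) - 4 * ((2 ^ (20 * n - 2) : ℤ) : ℝ) *
      ∑ l ∈ Finset.range (2 * n), shortRelation n (roundedVectors (sampleOracle ω) n) l *
        (ω l).2| ≤ ((2 ^ (20 * n - 2) : ℤ) : ℝ) / 16 := by
  have e : 4 * ((2 ^ (20 * n - 2) : ℤ) : ℝ) = 2 ^ (20 * n) := by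
    exact_mod_cast (two_pow_eq_four_mul hn).symm
  rw [e]
  refine (abs_sum_floor_sub_le fun l hl => abs_shortRelation_sampleOracle_le hn hl).trans
    ((rounding_error_le hn).trans ?_)
  -- The factor is `4 * 16`: a quarter of the modulus, divided by the tolerance 16.
  have h1 : (2 : ℝ) ^ (14 * n) * 64 ≤ 2 ^ (20 * n) := by
    rw [show (64 : ℝ) = 2 ^ 6 by norm_num, ← pow_add]
    exact pow_le_pow_right₀ (by norm_num) (by omega)
  linarith

/-- If the sampled second components are independent of the first ones, then acceptance means that
a nontrivial integer combination of them is close to an integer. -/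
theorem near_of_accepts (hn : 1 ≤ n) (hz : ∀ i < 2 * n, (ω i).2 ∈ Set.Ico (0 : ℝ) 1)
    (hA : Accepts (sampleOracle ω) n) : ∃ k : ℤ, |(∑ l ∈ Finset.range (2 * n),
      (shortRelation n (roundedVectors (sampleOracle ω) n) l : ℝ) * (ω l).2) - k| ≤ 3 / 8 := by
  rw [accepts_sampleOracle_iff ω hz, two_pow_eq_four_mul hn] at hA
  exact near_of_emod_lt (by positivity) (abs_sum_sub_le hn ω) hA

theorem abs_inner_le_of_coord_le {u w : EuclideanSpace ℝ (Fin n)} {c : ℝ} (hw : ‖w‖ = 1)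
    (hu : ∀ j, |u j| ≤ c) : |inner ℝ u w| ≤ n * c := by
  rw [PiLp.inner_apply]
  refine (Finset.abs_sum_le_sum_abs _ _).trans ?_
  have : ∑ j : Fin n, |inner ℝ (u j) (w j)| ≤ ∑ _j : Fin n, c := Finset.sum_le_sum fun j _ => by
    have h1 : |w j| ≤ 1 := by
      rw [← hw]
      exact PiLp.norm_apply_le w j
    have h2 : inner ℝ (u j) (w j) = u j * w j := by simp [mul_comm]
    rw [h2, abs_mul]
    calc |u j| * |w j| ≤ c * 1 :=
          mul_le_mul (hu j) h1 (abs_nonneg _) ((abs_nonneg _).trans (hu j))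
      _ = c := mul_one c
  simpa using this

/-- The vector part of the short relation. -/
theorem abs_coord_combination_le (hn : 1 ≤ n)
    (hy : ∀ i < 2 * n, ∀ j, |(ω i).1 j| < 2 ^ n) (j : Fin n) :
    |(∑ l ∈ Finset.range (2 * n),
      (shortRelation n (roundedVectors (sampleOracle ω) n) l : ℝ) • (ω l).1) j| ≤
      2 ^ (15 * n) / 2 ^ (20 * n) := by
  set a := shortRelation n (roundedVectors (sampleOracle ω) n) with ha
  have hbin := isBinary_sampleOracle ω
  have e1 : (∑ l ∈ Finset.range (2 * n), (a l : ℝ) • (ω l).1) j =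
      ∑ l ∈ Finset.range (2 * n), (a l : ℝ) * (ω l).1 j := by
    simp
  have hfl : ∀ l ∈ Finset.range (2 * n), a l * roundedVectors (sampleOracle ω) n l j =
      a l * ⌊(2 : ℝ) ^ (20 * n) * (ω l).1 j⌋ := by
    intro l hl
    have hl := Finset.mem_range.mp hl
    have := abs_lt.mp (hy l hl j)
    rw [roundedVectors, if_pos ⟨hl, j.isLt⟩, readDigits_eq_floor (x := (ω l).1 j)
      (fun k => by simp [sampleOracle]) this.1.le this.2]
  have h1 := abs_sum_floor_sub_le (N := 2 * n) (a := a) (x := fun l => (ω l).1 j)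
    (c := 2 ^ (20 * n)) fun l hl => abs_shortRelation_sampleOracle_le hn hl
  rw [← Finset.sum_congr rfl hfl] at h1
  have h2 := abs_sum_shortRelation_mul_le hn (Y := roundedVectors (sampleOracle ω) n)
    (fun i _ l _ => cast_abs_roundedVectors_le hbin i l) j.isLt
  rw [← ha] at h2
  have h3 := rounding_error_le hn
  have hp : (0 : ℝ) < 2 ^ (20 * n) := by positivity
  rw [e1, le_div_iff₀ hp]
  -- The first term bounds the combination of the rounded vectors, the second one the accumulated
  -- rounding error.
  have h4 : (2 : ℝ) ^ (13 * n) + 2 ^ (14 * n) ≤ 2 ^ (15 * n) := by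
    have h5 : (2 : ℝ) ^ (13 * n) ≤ 2 ^ (14 * n) := pow_le_pow_right₀ (by norm_num) (by omega)
    have h6 : (2 : ℝ) ^ (14 * n) * 2 ≤ 2 ^ (15 * n) := by
      rw [← pow_succ]
      exact pow_le_pow_right₀ (by norm_num) (by omega)
    linarith
  have h7 := abs_sub_abs_le_abs_sub
    ((2 : ℝ) ^ (20 * n) * ∑ l ∈ Finset.range (2 * n), (a l : ℝ) * (ω l).1 j)
    ((∑ l ∈ Finset.range (2 * n), a l * roundedVectors (sampleOracle ω) n l j : ℤ) : ℝ)
  rw [abs_sub_comm, abs_mul, abs_of_pos hp] at h7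
  rw [mul_comm]
  linarith

/-- The same relation that makes the vectors cancel up to `2 ^ (-5 n)` per coordinate makes the
second components cancel modulo 1; the factors `γ ≤ 2 ^ n` and `n ≤ 2 ^ n` leave at most `2 ^ (-3 n)
≤ 1 / 8`. -/
theorem accepts_of_clwe (hn : 1 ≤ n) {w : EuclideanSpace ℝ (Fin n)} (hw : ‖w‖ = 1) {γ : ℝ}
    (hγ0 : 0 ≤ γ) (hγ : γ ≤ 2 ^ n)
    (hy : ∀ i < 2 * n, ∀ j, |(ω i).1 j| < 2 ^ n)
    (hyz : ∀ i < 2 * n, (ω i).2 = Int.fract (γ * inner ℝ (ω i).1 w)) :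
    Accepts (sampleOracle ω) n := by
  have hz : ∀ i < 2 * n, (ω i).2 ∈ Set.Ico (0 : ℝ) 1 := fun i hi => by
    rw [hyz i hi]
    exact ⟨Int.fract_nonneg _, Int.fract_lt_one _⟩
  rw [accepts_sampleOracle_iff ω hz, two_pow_eq_four_mul hn]
  refine emod_lt_of_near (by positivity) (abs_sum_sub_le hn ω)
    -- The integer parts dropped by the fractional parts, combined with the same coefficients; after
    -- restoring them the sum is exactly `γ` times an inner product.
    (k := -∑ l ∈ Finset.range (2 * n), shortRelation n (roundedVectors (sampleOracle ω) n) l *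
      ⌊γ * inner ℝ (ω l).1 w⌋) ?_
  have h1 := abs_inner_le_of_coord_le hw (abs_coord_combination_le hn hy)
  set a := shortRelation n (roundedVectors (sampleOracle ω) n) with ha
  have e : (∑ l ∈ Finset.range (2 * n), (a l : ℝ) * (ω l).2) -
      ((-∑ l ∈ Finset.range (2 * n), a l * ⌊γ * inner ℝ (ω l).1 w⌋ : ℤ) : ℝ) =
      γ * inner ℝ (∑ l ∈ Finset.range (2 * n), (a l : ℝ) • (ω l).1) w := by
    rw [sum_inner, Finset.mul_sum]
    push_cast
    rw [sub_neg_eq_add, ← Finset.sum_add_distrib]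
    refine Finset.sum_congr rfl fun l hl => ?_
    rw [hyz l (Finset.mem_range.mp hl), Int.fract, real_inner_smul_left]
    ring
  rw [e, abs_mul, abs_of_nonneg hγ0]
  have h2 : (n : ℝ) ≤ 2 ^ n := by exact_mod_cast Nat.lt_two_pow_self.le
  have hp : (0 : ℝ) < 2 ^ (20 * n) := by positivity
  calc γ * |inner ℝ (∑ l ∈ Finset.range (2 * n), (a l : ℝ) • (ω l).1) w|
      ≤ 2 ^ n * (2 ^ n * (2 ^ (15 * n) / 2 ^ (20 * n))) := by
        refine mul_le_mul hγ (h1.trans ?_) (abs_nonneg _) (by positivity)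
        exact mul_le_mul_of_nonneg_right h2 (by positivity)
    _ = 2 ^ (17 * n) / 2 ^ (20 * n) := by
        rw [← mul_div_assoc, ← mul_div_assoc, ← pow_add, ← pow_add]
        congr 2
        ring
    _ ≤ 1 / 8 := by
        rw [div_le_div_iff₀ hp (by norm_num), one_mul, show (8 : ℝ) = 2 ^ 3 by norm_num, ← pow_add]
        exact pow_le_pow_right₀ (by norm_num) (by omega)

end Accepts

/-! ## The acceptance probabilities -/

instance (r : ℝ) : IsProbabilityMeasure (gaussianWidth r) := by
  unfold gaussianWidth; infer_instance

instance (n : ℕ) : IsProbabilityMeasure (gaussianSpace n) :=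
  Measure.isProbabilityMeasure_map (by fun_prop)

instance : IsProbabilityMeasure uniformTorus := ⟨by simp [uniformTorus]⟩

instance (n : ℕ) : IsProbabilityMeasure (nullDistribution n) := by
  unfold nullDistribution; infer_instance

theorem measurable_clweMap {n : ℕ} (w : EuclideanSpace ℝ (Fin n)) (γ : ℝ) :
    Measurable fun p : EuclideanSpace ℝ (Fin n) × ℝ =>
      ((p.1, Int.fract (γ * inner ℝ p.1 w + p.2)) : CLWESample n) := by
  refine measurable_fst.prodMk (Measurable.fract ?_)
  fun_prop

instance {n : ℕ} (w : EuclideanSpace ℝ (Fin n)) (β γ : ℝ) :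
    IsProbabilityMeasure (clweDistribution w β γ) :=
  Measure.isProbabilityMeasure_map (measurable_clweMap w γ).aemeasurable

/-! ### Combinations of uniform variables -/

theorem measurePreserving_coe_uniformTorus :
    MeasurePreserving (fun x : ℝ => (x : UnitAddCircle)) uniformTorus volume := by
  have h := UnitAddCircle.measurePreserving_mk 0
  rw [zero_add, ← restrict_Ico_eq_restrict_Ioc] at h
  exact h

/-- A nontrivial integer combination of independent uniform variables on the circle is uniform. -/
theorem measurePreserving_sum_zsmul {ι : Type*} [Fintype ι] {a : ι → ℤ} (ha : ∃ l, a l ≠ 0) :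
    MeasurePreserving (fun t : ι → UnitAddCircle => ∑ l, a l • t l) volume volume := by
  classical
  let f : (ι → UnitAddCircle) →+ UnitAddCircle :=
    ∑ l, a l • Pi.evalAddMonoidHom (fun _ : ι => UnitAddCircle) l
  have hf : ∀ t, f t = ∑ l, a l • t l := fun t => by simp [f]
  have hcont : Continuous f := by
    rw [show (f : (ι → UnitAddCircle) → UnitAddCircle) = fun t => ∑ l, a l • t l from funext hf]
    exact continuous_finsetSum _ fun l _ => (continuous_apply l).zsmul _
  -- The circle is divisible, so a single nonzero coefficient suffices; a continuous surjective
  -- homomorphism of compact groups then carries the invariant probability measure to the invariant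
  -- one.
  have hsurj : Function.Surjective f := by
    obtain ⟨l, hl⟩ := ha
    intro x
    obtain ⟨r, rfl⟩ := QuotientAddGroup.mk_surjective x
    refine ⟨Pi.single l ((r / a l : ℝ) : UnitAddCircle), ?_⟩
    rw [hf, Finset.sum_eq_single l (fun b _ hb => by simp [hb]) (by simp), Pi.single_eq_same,
      ← AddCircle.coe_zsmul, zsmul_eq_mul, mul_div_cancel₀ _ (by exact_mod_cast hl)]
  have := AddMonoidHom.measurePreserving (μ := (volume : Measure (ι → UnitAddCircle)))
    (ν := (volume : Measure UnitAddCircle)) hcont hsurj (by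
      rw [volume_pi, Measure.pi_univ]
      simp)
  rwa [show (f : (ι → UnitAddCircle) → UnitAddCircle) = fun t => ∑ l, a l • t l from funext hf]
    at this

theorem coe_sum_mul {ι : Type*} [Fintype ι] (a : ι → ℤ) (z : ι → ℝ) :
    ((∑ l, (a l : ℝ) * z l : ℝ) : UnitAddCircle) = ∑ l, a l • (z l : UnitAddCircle) := by
  rw [← QuotientAddGroup.mk'_apply, map_sum]
  refine Finset.sum_congr rfl fun l _ => ?_
  rw [← zsmul_eq_mul, map_zsmul]
  rfl

/-- The norm on the circle is the distance to the nearest integer, so this is the length of an arc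
of radius `3 / 8`. -/
theorem measure_near_integer {ι : Type*} [Fintype ι] {a : ι → ℤ} (ha : ∃ l, a l ≠ 0) :
    (Measure.pi fun _ : ι => uniformTorus)
      {z | ‖((∑ l, (a l : ℝ) * z l : ℝ) : UnitAddCircle)‖ ≤ 3 / 8} = ENNReal.ofReal (3 / 4) := by
  have h1 : MeasurePreserving (fun (z : ι → ℝ) l => (z l : UnitAddCircle))
      (Measure.pi fun _ : ι => uniformTorus) volume :=
    measurePreserving_pi _ _ fun _ => measurePreserving_coe_uniformTorus
  have h2 := (measurePreserving_sum_zsmul ha).comp h1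
  have h3 := h2.measure_preimage (s := Metric.closedBall 0 (3 / 8))
    Metric.isClosed_closedBall.measurableSet.nullMeasurableSet
  rw [AddCircle.volume_closedBall, min_eq_right (by norm_num)] at h3
  rw [show (3 / 4 : ℝ) = 2 * (3 / 8) by norm_num, ← h3]
  congr 1
  ext z
  simp only [Set.mem_ofPred_eq, Set.mem_preimage, Function.comp_apply, mem_closedBall_zero_iff,
    coe_sum_mul]

/-! ### The null distribution -/

/-- The rounding of a real number by reading its digits. -/
noncomputable def roundByDigits (n : ℕ) (x : ℝ) : ℤ :=
  readDigits (fun _ _ k => binaryDigit x k) n 0 0 (21 * n)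

theorem measurable_roundByDigits (n : ℕ) : Measurable (roundByDigits n) := by
  have hd : ∀ k, Measurable fun x => binaryDigit x k := fun k =>
    (Measurable.of_discrete (f := fun a : ℤ => a % 2)).comp
      (Int.measurable_floor.comp (measurable_const_mul _))
  have : ∀ t, Measurable fun x => readDigits (fun _ _ k => binaryDigit x k) n 0 0 t := by
    intro t
    induction t with
    | zero => exact (Measurable.of_discrete (f := fun a : ℤ => -a)).comp (hd _)
    | succ t ih => exact (ih.const_mul 2).add (hd _)
  exact this _

theorem readDigits_sampleOracle {n : ℕ} (ω : ℕ → CLWESample n) (i : ℕ) (j : Fin n) (t : ℕ) :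
    readDigits (sampleOracle ω) n i j t =
      readDigits (fun _ _ k => binaryDigit ((ω i).1 j) k) n 0 0 t := by
  induction t with
  | zero => simp [readDigits, sampleOracle]
  | succ t ih => simp [readDigits, ih, sampleOracle]

/-- The extension of a finite matrix by zero. -/
def extendMatrix (n : ℕ) (V : Finset.range (2 * n) → Fin n → ℤ) (i j : ℕ) : ℤ :=
  if h : i < 2 * n ∧ j < n then V ⟨i, Finset.mem_range.mpr h.1⟩ ⟨j, h.2⟩ else 0

/-- The short relation found for given vectors. -/
noncomputable def relationOf (n : ℕ) (y : Finset.range (2 * n) → EuclideanSpace ℝ (Fin n))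
    (l : Finset.range (2 * n)) : ℤ :=
  shortRelation n (extendMatrix n fun i j => roundByDigits n (y i j)) l

/-- The relation depends only on a finite integer matrix, and every function on that countable
discrete space is measurable. No analysis of the reduction algorithm is needed; this is why the
matrix is cut down to finite size by `extendMatrix`. -/
theorem measurable_relationOf (n : ℕ) (l : Finset.range (2 * n)) :
    Measurable fun y => relationOf n y l := by
  have h : Measurable fun (y : Finset.range (2 * n) → EuclideanSpace ℝ (Fin n)) i j =>
      roundByDigits n (y i j) := by
    refine measurable_pi_lambda _ fun i => measurable_pi_lambda _ fun j =>
      (measurable_roundByDigits n).comp ?_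
    fun_prop
  exact (Measurable.of_discrete
    (f := fun V : Finset.range (2 * n) → Fin n → ℤ => shortRelation n (extendMatrix n V) l)).comp h

theorem exists_relationOf_ne_zero {n : ℕ} (hn : 1 ≤ n)
    (y : Finset.range (2 * n) → EuclideanSpace ℝ (Fin n)) : ∃ l, relationOf n y l ≠ 0 := by
  obtain ⟨l, hl, h⟩ := exists_shortRelation_ne_zero hn
    (Y := extendMatrix n fun i j => roundByDigits n (y i j)) fun i hi j hj => by
      rw [extendMatrix, dif_pos ⟨hi, hj⟩]
      have hO : DigitOracle.IsBinary fun _ _ k =>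
          binaryDigit (y ⟨i, Finset.mem_range.mpr hi⟩ ⟨j, hj⟩) k := by
        intro _ _ k
        simp only [binaryDigit]
        omega
      exact_mod_cast abs_readDigits_le hO (n := n) 0 0 (21 * n)
  exact ⟨⟨l, Finset.mem_range.mpr hl⟩, h⟩

theorem roundedVectors_sampleOracle {n : ℕ} (ω : ℕ → CLWESample n) :
    roundedVectors (sampleOracle ω) n =
      extendMatrix n fun i j => roundByDigits n ((ω i).1 j) := by
  ext i j
  by_cases h : i < 2 * n ∧ j < n
  · rw [roundedVectors, if_pos h, extendMatrix, dif_pos h]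
    exact readDigits_sampleOracle ω i ⟨j, h.2⟩ _
  · rw [roundedVectors, if_neg h, extendMatrix, dif_neg h]

theorem measurableSet_relationOf_near (n : ℕ) : MeasurableSet
    {p : (Finset.range (2 * n) → EuclideanSpace ℝ (Fin n)) × (Finset.range (2 * n) → ℝ) |
      ‖((∑ l, (relationOf n p.1 l : ℝ) * p.2 l : ℝ) : UnitAddCircle)‖ ≤ 3 / 8} := by
  have h : Measurable fun p : (Finset.range (2 * n) → EuclideanSpace ℝ (Fin n)) ×
      (Finset.range (2 * n) → ℝ) => ∑ l, (relationOf n p.1 l : ℝ) * p.2 l := by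
    refine Finset.measurable_sum _ fun l _ => Measurable.mul ?_ (by fun_prop)
    exact (Measurable.of_discrete (f := fun a : ℤ => (a : ℝ))).comp
      ((measurable_relationOf n l).comp measurable_fst)
  exact measurableSet_le
    (measurable_norm.comp (measurePreserving_coe_uniformTorus.measurable.comp h)) measurable_const

/-- Fubini: for fixed vectors the relation is a fixed nonzero integer vector, and only the
independent uniform variables remain random. -/
theorem measure_relationOf_near_le {n : ℕ} (hn : 1 ≤ n) :
    ((Measure.pi fun _ : Finset.range (2 * n) => gaussianSpace n).prod
      (Measure.pi fun _ : Finset.range (2 * n) => uniformTorus))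
      {p | ‖((∑ l, (relationOf n p.1 l : ℝ) * p.2 l : ℝ) : UnitAddCircle)‖ ≤ 3 / 8} ≤
      ENNReal.ofReal (3 / 4) := by
  rw [Measure.prod_apply (measurableSet_relationOf_near n)]
  simp only [Set.preimage_ofPred_eq, measure_near_integer (exists_relationOf_ne_zero hn _)]
  simp

theorem measure_answersYes_null_le {n : ℕ} (hn : 1 ≤ n) :
    Measure.infinitePi (fun _ : ℕ => nullDistribution n) {ω | AnswersYes distinguisher ω} ≤
      ENNReal.ofReal (3 / 4) := by
  set μ := Measure.infinitePi (fun _ : ℕ => nullDistribution n) with hμ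
  let S : Set ((Finset.range (2 * n) → EuclideanSpace ℝ (Fin n)) × (Finset.range (2 * n) → ℝ)) :=
    {p | ‖((∑ l, (relationOf n p.1 l : ℝ) * p.2 l : ℝ) : UnitAddCircle)‖ ≤ 3 / 8}
  have hS : MeasurableSet S := measurableSet_relationOf_near n
  have h1 : MeasurePreserving (Finset.range (2 * n)).restrict μ
      (Measure.pi fun _ => nullDistribution n) :=
    ⟨by fun_prop, Measure.infinitePi_map_restrict _⟩
  -- Only the first `2 n` samples matter; their vectors and their second components are collected
  -- into two independent blocks.
  have h2 := (measurePreserving_arrowProdEquivProdArrow _ _ (Finset.range (2 * n))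
    (fun _ => gaussianSpace n) (fun _ => uniformTorus)).comp h1
  refine le_trans ?_ (measure_relationOf_near_le hn)
  rw [← h2.measure_preimage hS.nullMeasurableSet]
  -- Almost sure inclusion in a measurable event is enough, so measurability of the acceptance event
  -- is not needed.
  refine measure_mono_ae ?_
  have hz : ∀ᵐ ω ∂μ, ∀ i, (ω i).2 ∈ Set.Ico (0 : ℝ) 1 := by
    refine ae_all_iff.mpr fun i => ?_
    have h3 : ∀ᵐ p ∂(nullDistribution n), p.2 ∈ Set.Ico (0 : ℝ) 1 :=
      (Measure.quasiMeasurePreserving_snd (μ := gaussianSpace n) (ν := uniformTorus)).ae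
        (ae_restrict_mem measurableSet_Ico)
    exact (measurePreserving_eval_infinitePi (fun _ : ℕ => nullDistribution n)
      i).quasiMeasurePreserving.ae h3
  filter_upwards [hz] with ω hω hyes
  obtain ⟨k, hk⟩ := near_of_accepts hn (fun i _ => hω i) ((answersYes_distinguisher_iff ω).mp hyes)
  change ‖((∑ l, (relationOf n (fun i => (ω i).1) l : ℝ) * (ω l).2 : ℝ) : UnitAddCircle)‖ ≤ 3 / 8
  rw [UnitAddCircle.norm_eq]
  refine (round_le _ k).trans ?_
  rw [← Finset.sum_coe_sort] at hk
  rw [roundedVectors_sampleOracle] at hk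
  exact hk

/-! ### The CLWE distribution -/

/-- Chebyshev's inequality, with variance `1 / (2π) ≤ 1`. -/
theorem gaussianWidth_tail_le {c : ℝ} (hc : 0 < c) :
    gaussianWidth 1 {x | c ≤ |x|} ≤ ENNReal.ofReal (1 / c ^ 2) := by
  have h := meas_ge_le_variance_div_sq (μ := gaussianWidth 1) (X := id)
    (by exact_mod_cast memLp_id_gaussianReal 2) hc
  have hm : ∫ x, id x ∂(gaussianWidth 1) = 0 := by
    simp [gaussianWidth]
  rw [hm] at h
  simp only [id, sub_zero] at h
  refine h.trans (ENNReal.ofReal_le_ofReal ?_)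
  rw [gaussianWidth, variance_id_gaussianReal]
  gcongr
  rw [Real.coe_toNNReal _ (by positivity), one_pow, div_le_one (by positivity)]
  linarith [Real.pi_gt_three]

theorem gaussianSpace_coord {n : ℕ} (j : Fin n) :
    MeasurePreserving (fun y : EuclideanSpace ℝ (Fin n) => y j) (gaussianSpace n)
      (gaussianWidth 1) := by
  refine ⟨by fun_prop, ?_⟩
  rw [gaussianSpace, Measure.map_map (by fun_prop) (by fun_prop)]
  exact (measurePreserving_eval (fun _ : Fin n => gaussianWidth 1) j).map_eq

theorem clweDistribution_fst {n : ℕ} (w : EuclideanSpace ℝ (Fin n)) (γ : ℝ) :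
    MeasurePreserving Prod.fst (clweDistribution w 0 γ) (gaussianSpace n) := by
  refine ⟨measurable_fst, ?_⟩
  rw [clweDistribution, Measure.map_map measurable_fst (measurable_clweMap w γ)]
  exact measurePreserving_fst.map_eq

theorem clweDistribution_ae_eq {n : ℕ} (w : EuclideanSpace ℝ (Fin n)) (γ : ℝ) :
    ∀ᵐ p ∂(clweDistribution w 0 γ), p.2 = Int.fract (γ * inner ℝ p.1 w) := by
  rw [clweDistribution, ae_map_iff (measurable_clweMap w γ).aemeasurable
    (measurableSet_eq_fun measurable_snd (Measurable.fract (by fun_prop)))]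
  -- A Gaussian of variance 0 is the point mass, so there is no noise.
  have h : ∀ᵐ e ∂(gaussianWidth 0), e = 0 := by
    simp [gaussianWidth, ae_dirac_eq]
  filter_upwards [Measure.quasiMeasurePreserving_snd.ae h] with p hp
  simp [hp]

/-- The equation holds almost surely; a coordinate too large for the digits that are read has
probability at most `4 ^ (-n)`, and there are `n` of them. -/
theorem measure_bad_sample_le {n : ℕ} (w : EuclideanSpace ℝ (Fin n)) (γ : ℝ) :
    clweDistribution w 0 γ {p | ¬ (p.2 = Int.fract (γ * inner ℝ p.1 w) ∧ ∀ j, |p.1 j| < 2 ^ n)} ≤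
      ENNReal.ofReal (n / 4 ^ n) := by
  have hsub : {p : CLWESample n | ¬ (p.2 = Int.fract (γ * inner ℝ p.1 w) ∧
      ∀ j, |p.1 j| < 2 ^ n)} ⊆ {p | ¬ p.2 = Int.fract (γ * inner ℝ p.1 w)} ∪
      ⋃ j, {p | 2 ^ n ≤ |p.1 j|} := by
    intro p hp
    simp only [Set.mem_ofPred_eq, not_and_or, not_forall, not_lt] at hp
    rcases hp with hp | ⟨j, hj⟩
    · exact Or.inl hp
    · exact Or.inr (Set.mem_iUnion.mpr ⟨j, hj⟩)
  refine (measure_mono hsub).trans ((measure_union_le _ _).trans ?_)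
  rw [ae_iff.mp (clweDistribution_ae_eq w γ), zero_add]
  have hj : ∀ j : Fin n, clweDistribution w 0 γ {p | 2 ^ n ≤ |p.1 j|} ≤
      ENNReal.ofReal (1 / 4 ^ n) := by
    intro j
    have h := ((gaussianSpace_coord j).comp (clweDistribution_fst w γ)).measure_preimage
      (s := {x | (2 : ℝ) ^ n ≤ |x|}) (measurableSet_le measurable_const
        measurable_id.abs).nullMeasurableSet
    have h2 := gaussianWidth_tail_le (c := 2 ^ n) (by positivity)
    rw [← h, ← pow_mul, mul_comm n 2, pow_mul] at h2
    norm_num at h2 ⊢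
    exact h2
  refine (measure_iUnion_fintype_le _ _).trans ((Finset.sum_le_sum fun j _ => hj j).trans ?_)
  rw [Finset.sum_const, Finset.card_univ, Fintype.card_fin, ← ENNReal.ofReal_nsmul, nsmul_eq_mul,
    mul_one_div]

theorem le_measure_answersYes_clwe {n : ℕ} (hn : 1 ≤ n) (hn' : (2 * n * n : ℝ) ≤ 4 ^ n / 8)
    {w : EuclideanSpace ℝ (Fin n)} (hw : ‖w‖ = 1) {γ : ℝ} (hγ0 : 0 ≤ γ) (hγ : γ ≤ 2 ^ n) :
    ENNReal.ofReal (7 / 8) ≤ Measure.infinitePi (fun _ : ℕ => clweDistribution w 0 γ)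
      {ω | AnswersYes distinguisher ω} := by
  set μ := Measure.infinitePi (fun _ : ℕ => clweDistribution w 0 γ) with hμ
  let bad : Set (CLWESample n) :=
    {p | ¬ (p.2 = Int.fract (γ * inner ℝ p.1 w) ∧ ∀ j, |p.1 j| < 2 ^ n)}
  have hbad : ∀ i, μ (Function.eval i ⁻¹' bad) ≤ ENNReal.ofReal (n / 4 ^ n) := fun i =>
    ((measurePreserving_eval_infinitePi (fun _ : ℕ => clweDistribution w 0 γ)
      i).measure_preimage_le _).trans (measure_bad_sample_le w γ)
  have hsub : {ω | AnswersYes distinguisher ω}ᶜ ⊆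
      ⋃ i ∈ Finset.range (2 * n), Function.eval i ⁻¹' bad := by
    intro ω hω
    by_contra h
    refine hω ((answersYes_distinguisher_iff ω).mpr ?_)
    simp only [Set.mem_iUnion, Set.mem_preimage, not_exists, Finset.mem_range, bad,
      Set.mem_ofPred_eq, not_not, Function.eval] at h
    exact accepts_of_clwe hn hw hγ0 hγ (fun i hi => (h i hi).2) fun i hi => (h i hi).1
  have hcompl : μ {ω | AnswersYes distinguisher ω}ᶜ ≤ ENNReal.ofReal (1 / 8) := by
    refine (measure_mono hsub).trans ((measure_biUnion_finset_le _ _).trans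
      ((Finset.sum_le_sum fun i _ => hbad i).trans ?_))
    rw [Finset.sum_const, Finset.card_range, ← ENNReal.ofReal_nsmul, nsmul_eq_mul]
    refine ENNReal.ofReal_le_ofReal ?_
    push_cast
    rw [← mul_div_assoc, div_le_iff₀ (by positivity)]
    linarith
  -- Subadditivity holds for arbitrary sets, so the lower bound again does without measurability of
  -- the event.
  have h1 : 1 ≤ μ {ω | AnswersYes distinguisher ω} + ENNReal.ofReal (1 / 8) := by
    rw [← measure_univ (μ := μ)]
    exact (measure_univ_le_add_compl _).trans (add_le_add_right hcompl _)
  have h2 : ENNReal.ofReal (7 / 8) + ENNReal.ofReal (1 / 8) = 1 := by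
    rw [← ENNReal.ofReal_add (by norm_num) (by norm_num)]
    norm_num
  rw [← h2] at h1
  exact (ENNReal.add_le_add_iff_right ENNReal.ofReal_ne_top).mp h1

/-! ### The advantage -/

theorem uniformSphere_univ {n : ℕ} (hn : 1 ≤ n) : uniformSphere n Set.univ = 1 := by
  have : Nonempty (Fin n) := ⟨⟨0, hn⟩⟩
  rw [uniformSphere, Measure.smul_apply, smul_eq_mul, ENNReal.inv_mul_cancel]
  · rw [Measure.toSphere_apply_univ]
    refine mul_ne_zero ?_ (Metric.measure_ball_pos _ _ one_pos).ne'
    simp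
    omega
  · rw [Measure.toSphere_apply_univ]
    exact ENNReal.mul_ne_top (by simp) measure_ball_lt_top.ne

theorem le_clweAdvantage {n : ℕ} (hn : 1 ≤ n) (hn' : (2 * n * n : ℝ) ≤ 4 ^ n / 8) {γ : ℝ}
    (hγ0 : 0 ≤ γ) (hγ : γ ≤ 2 ^ n) : 1 / 8 ≤ clweAdvantage distinguisher n 0 γ := by
  have h1 : 7 / 8 ≤ probYesCLWE distinguisher n 0 γ := by
    rw [probYesCLWE, ← ENNReal.ofReal_le_iff_le_toReal]
    · calc ENNReal.ofReal (7 / 8) = ∫⁻ _w, ENNReal.ofReal (7 / 8) ∂(uniformSphere n) := by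
            rw [lintegral_const, uniformSphere_univ hn, mul_one]
        _ ≤ _ := lintegral_mono fun w => le_measure_answersYes_clwe hn hn'
            (by simp) hγ0 hγ
    · refine ne_top_of_le_ne_top ENNReal.one_ne_top ?_
      calc _ ≤ ∫⁻ _w, 1 ∂(uniformSphere n) := lintegral_mono fun w => prob_le_one
        _ = 1 := by rw [lintegral_const, uniformSphere_univ hn, mul_one]
  have h2 : probYesNull distinguisher n ≤ 3 / 4 :=
    ENNReal.toReal_le_of_le_ofReal (by norm_num) (measure_answersYes_null_le hn)
  rw [clweAdvantage]
  exact le_trans (by linarith) (le_abs_self _)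

theorem mainTheorem8 (γ : ℕ → ℝ) (hγ_pos : ∀ n : ℕ, 1 ≤ n → 0 < γ n)
    (hγ_poly : ∃ k : ℕ, γ =O[atTop] fun n : ℕ => (n : ℝ) ^ k) :
    ∃ A : RamProgram, IsPolyTime A ∧ SolvesCLWE A (fun _ => 0) γ := by
  -- The advantage is eventually at least `1 / 8`, so any exponent would do; 1 is taken.
  refine ⟨distinguisher, isPolyTime_distinguisher, 1, one_pos, ?_⟩
  obtain ⟨k, hk⟩ := hγ_poly
  -- Polynomial growth enters only here: the precision leaves room for any `γ` up to `2 ^ n`.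
  have h1 : ∀ᶠ n : ℕ in atTop, γ n ≤ 2 ^ n := by
    have h := (hk.trans_isLittleO
      (isLittleO_pow_const_const_pow_of_one_lt k (one_lt_two : (1 : ℝ) < 2))).bound one_pos
    filter_upwards [h] with n hn
    have h3 := (le_abs_self _).trans hn
    simpa using h3
  have h2 : ∀ᶠ n : ℕ in atTop, (2 * n * n : ℝ) ≤ 4 ^ n / 8 := by
    have h := (isLittleO_pow_const_const_pow_of_one_lt (R := ℝ) 2
      (by norm_num : (1 : ℝ) < 4)).bound (by norm_num : (0 : ℝ) < 1 / 16)
    filter_upwards [h] with n hn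
    simp only [norm_pow, Real.norm_natCast, Real.norm_ofNat] at hn
    linarith
  refine IsBigO.of_bound 8 ?_
  filter_upwards [h1, h2, eventually_ge_atTop 1] with n hn1 hn2 hn
  have h3 := le_clweAdvantage hn hn2 (hγ_pos n hn).le hn1
  have h4 : (1 : ℝ) ≤ n := by exact_mod_cast hn
  rw [Real.rpow_neg_one, Real.norm_of_nonneg (by positivity), Real.norm_of_nonneg (by linarith)]
  have h5 : (n : ℝ)⁻¹ ≤ 1 := inv_le_one_of_one_le₀ h4
  linarith
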